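/- **Setup.** A *polytope* is the convex hull of a nonempty finite set of points in a real vector space. Two polytopes are *combinatorially equivalent* if their face lattices are isomorphic; combinatorially equivalent polytopes are identified. The *ring of polytopes* $\mathcal P$ is the free abelian group on the combinatorial types of polytopes, with product induced by the Cartesian product (the unit is the point); addition corresponds to disjoint union. The types of *simple* polytopes (every vertex lies in exactly $\dim P$ facets) span a subring. The additive map $d:\mathcal P\to\mathcal P$ sends a polytope to the sum of its facets. A *building set* $B$ on a finite set $V$ is a set of nonempty subsets of $V$ containing all singletons and such that $S_1\cup S_2\in B$ whenever $S_1,S_2\in B$ and $S_1\cap S_2\ne\varnothing$. Its *nestohedron* is the Minkowski sum $P_B=\sum_{S\in B}\operatorname{conv}(e_i\mid i\in S)\subset\mathbb R^{V}$. For a simple graph $G$ on $V$, the graphical building set $B(G)$ consists of the vertex sets that induce connected subgraphs. Let $[n+1]=\{1,\dots,n+1\}$. * $Pe^n=P_{B(K_{n+1})}$ (permutohedron) and $St^n=P_{B(K_{1,n})}$ (stellahedron), for $n\ge 0$. * $P^0_{Mas}$ is a point, $P^1_{Mas}$ is a segment, and for $n\ge2$, $P^n_{Mas}=P_{B(P,n)}$,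 where $B(P,n)$ consists of the singletons of $[n+1]$, all sets $\{1,2\}\cup I$ with $I\subseteq\{3,\dots,n+1\}$, and all sets $\{1\}\cup J$ with $\varnothing\ne J\subseteq\{3,\dots,n\}$. * $P^0_\Gamma$ is a point, $P^1_\Gamma$ is a segment, and for $n\ge2$, $P^n_\Gamma=P_{B(\Gamma,n)}$, where $B(\Gamma,n)$ consists of the singletons of $[n+1]$, all subsets of $\{1,\dots,n\}$ with at least two elements, and all sets $\{1,n+1\}\cup J$ with $J\subseteq\{2,\dots,n\}$. A *family* is a set $\mathcal F$ of (combinatorial types of) simple polytopes that has, for each $n\ge0$, a nonempty finite set of $n$-dimensional members; a *line family* has exactly one member in each dimension. A *$d$-family* is a family $\mathcal F$ such that the subring of $\mathcal P$ generated by $\mathcal F$ is closed under $d$. The *$d$-closure* of $\mathcal F$ is the smallest $d$-family containing $\mathcal F$. The family $\mathcal F$ has *complexity* $k$ if its $d$-closure exists and is a union of $k$ line families but not of fewer than $k$. **Theorem.** For every $n\ge 2$, $$ dP^n_{Mas}=2St^{n-1}+(n-2)P^{n-1}_{Mas}+\sum_{s=0}^{n-2}\binom{n-2}{s}St^{s}\times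 P^{n-s-1}_{\Gamma} +\sum_{s=0}^{n-2}\binom{n-2}{s}St^{s+1}\times Pe^{n-s-2}+\sum_{s=0}^{n-3}\binom{n-2}{s}P^{s+2}_{Mas}\times Pe^{n-s-3}, $$ where the last sum is empty for $n=2$. Moreover, the family $\mathcal P_{Mas}=\{P^n_{Mas}\mid n\ge0\}$ has complexity $4$. -/

import Mathlib

open scoped Pointwise

noncomputable section

/-! ### Convex polytopes, faces, combinatorial equivalence -/

/-- A (nonempty) convex polytope: the convex hull of a nonempty finite set of points of a real
vector space. The polytope need not span its ambient space. -/
structure Polytope : Type 1 where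
  /-- the ambient real vector space -/
  V : Type
  [instAddCommGroup : AddCommGroup V]
  [instModule : Module ℝ V]
  /-- the underlying set of points -/
  carrier : Set V
  exists_finset : ∃ t : Finset V, t.Nonempty ∧ carrier = convexHull ℝ (t : Set V)

namespace Polytope

attribute [instance] Polytope.instAddCommGroup Polytope.instModule

/-- The dimension of a polytope, that is, of its affine hull. -/
def dim (P : Polytope) : ℕ := Module.finrank ℝ (vectorSpan ℝ P.carrier)

/-- `F` is a nonempty face of `P`: a nonempty convex subset of `P` such that every segment in `P`
with an interior point in `F` lies in `F`. For polytopes these are exactly the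
intersections with supporting hyperplanes, together with `P` itself. -/
structure IsFace (P : Polytope) (F : Set P.V) : Prop where
  nonempty : F.Nonempty
  convex : Convex ℝ F
  extreme : IsExtreme ℝ P.carrier F

/-- The poset of nonempty faces of `P` (including `P` itself), ordered by inclusion. It is the face
lattice of `P` with its bottom element, the empty face, removed. -/
def Face (P : Polytope) : Type := {F : Set P.V // P.IsFace F}

instance (P : Polytope) : PartialOrder P.Face :=
  inferInstanceAs (PartialOrder {F : Set P.V // P.IsFace F})

theorem carrier_nonempty (P : Polytope) : P.carrier.Nonempty := by
  obtain ⟨t, ht, h⟩ := P.exists_finset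
  rw [h]
  exact (Finset.coe_nonempty.2 ht).convexHull

theorem carrier_convex (P : Polytope) : Convex ℝ P.carrier := by
  obtain ⟨t, ht, h⟩ := P.exists_finset
  rw [h]
  exact convex_convexHull ℝ _

theorem isFace_carrier (P : Polytope) : P.IsFace P.carrier :=
  ⟨P.carrier_nonempty, P.carrier_convex, IsExtreme.rfl⟩

instance (P : Polytope) : OrderTop P.Face where
  top := ⟨P.carrier, P.isFace_carrier⟩
  le_top F := F.2.extreme.subset

/-- A face of the convex hull of `t` is the convex hull of the points of `t` that it contains. -/
theorem face_eq_convexHull {V : Type} [AddCommGroup V] [Module ℝ V] (t : Finset V) {F : Set V}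
    (hc : Convex ℝ F) (he : IsExtreme ℝ (convexHull ℝ (t : Set V)) F) :
    F = convexHull ℝ ((t : Set V) ∩ F) := by
  classical
  apply Set.Subset.antisymm
  · intro x hx
    have hxt := he.subset hx
    obtain ⟨w, hw0, hw1, hwx⟩ := Finset.mem_convexHull'.1 hxt
    have key : ∀ y ∈ t, w y ≠ 0 → y ∈ F := by
      intro y hy hwy
      have hypos : 0 < w y := lt_of_le_of_ne (hw0 y hy) (Ne.symm hwy)
      have hsum : w y + ∑ z ∈ t.erase y, w z = 1 := by
        rw [Finset.add_sum_erase _ _ hy, hw1]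
      have hsumx : w y • y + ∑ z ∈ t.erase y, w z • z = x := by
        rw [Finset.add_sum_erase t (fun z => w z • z) hy, hwx]
      have hs0 : 0 ≤ ∑ z ∈ t.erase y, w z :=
        Finset.sum_nonneg fun z hz => hw0 z (Finset.mem_of_mem_erase hz)
      rcases hs0.eq_or_lt with h0 | hpos
      · have hz : ∀ z ∈ t.erase y, w z = 0 :=
          (Finset.sum_eq_zero_iff_of_nonneg
            (fun z hz => hw0 z (Finset.mem_of_mem_erase hz))).1 h0.symm
        have : ∑ z ∈ t.erase y, w z • z = 0 :=
          Finset.sum_eq_zero fun z h => by rw [hz z h, zero_smul]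
        rw [this, add_zero] at hsumx
        rw [← h0, add_zero] at hsum
        rw [hsum, one_smul] at hsumx
        rwa [hsumx]
      · have hmem : (t.erase y).centerMass w id ∈ convexHull ℝ (t : Set V) :=
          Finset.centerMass_mem_convexHull _ (fun z hz => hw0 z (Finset.mem_of_mem_erase hz)) hpos
            (fun z hz => Finset.mem_of_mem_erase hz)
        refine he.left_mem_of_mem_openSegment (subset_convexHull ℝ _ hy) hmem hx
          ⟨w y, ∑ z ∈ t.erase y, w z, hypos, hpos, hsum, ?_⟩
        rw [Finset.centerMass, smul_smul, mul_inv_cancel₀ hpos.ne', one_smul]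
        exact hsumx
    have hft : (t : Set V) ∩ F = ((t.filter (· ∈ F) : Finset V) : Set V) := by
      ext z; simp
    rw [hft]
    refine Finset.mem_convexHull'.2 ⟨w, fun y hy => hw0 y (Finset.mem_filter.1 hy).1, ?_, ?_⟩
    · rw [← hw1]
      refine Finset.sum_subset (Finset.filter_subset _ _) fun y hy hn => ?_
      by_contra h
      exact hn (Finset.mem_filter.2 ⟨hy, key y hy h⟩)
    · rw [← hwx]
      refine Finset.sum_subset (Finset.filter_subset _ _) fun y hy hn => ?_
      by_contra h
      exact hn (Finset.mem_filter.2 ⟨hy, key y hy fun h0 => h (by rw [h0, zero_smul])⟩)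
  · exact convexHull_min Set.inter_subset_right hc

instance (P : Polytope) : Finite P.Face := by
  obtain ⟨t, ht, h⟩ := P.exists_finset
  have hinj : Function.Injective
      (fun F : P.Face => (⟨(t : Set P.V) ∩ F.1, Set.inter_subset_left⟩ : Set.powerset (t : Set P.V))) := by
    intro F G hFG
    have hFG' : (t : Set P.V) ∩ F.1 = (t : Set P.V) ∩ G.1 := congrArg Subtype.val hFG
    apply Subtype.ext
    rw [face_eq_convexHull t F.2.convex (h ▸ F.2.extreme), hFG',
      ← face_eq_convexHull t G.2.convex (h ▸ G.2.extreme)]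
  have : Finite (Set.powerset (t : Set P.V)) := (t.finite_toSet.powerset).to_subtype
  exact Finite.of_injective _ hinj

/-- A nonempty face of a polytope, as a polytope in the same ambient space. -/
def Face.toPolytope {P : Polytope} (F : P.Face) : Polytope where
  V := P.V
  carrier := F.1
  exists_finset := by
    classical
    obtain ⟨t, ht, h⟩ := P.exists_finset
    have hF := face_eq_convexHull t F.2.convex (h ▸ F.2.extreme)
    have hft : ((t.filter (· ∈ F.1) : Finset P.V) : Set P.V) = (t : Set P.V) ∩ F.1 := by
      ext z; simp
    refine ⟨t.filter (· ∈ F.1), ?_, ?_⟩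
    · rw [← Finset.coe_nonempty, hft, ← convexHull_nonempty_iff (𝕜 := ℝ), ← hF]
      exact F.2.nonempty
    · rw [hft]
      exact hF

/-- The facets of `P`: its maximal proper faces. -/
def Facet (P : Polytope) : Type := {F : P.Face // IsCoatom F}

instance (P : Polytope) : Finite P.Facet :=
  inferInstanceAs (Finite {F : P.Face // IsCoatom F})

instance (P : Polytope) : Fintype P.Facet := Fintype.ofFinite _

/-- `P` is simple: every vertex of `P` lies in exactly `dim P` facets. -/
def IsSimple (P : Polytope) : Prop :=
  ∀ v ∈ P.carrier.extremePoints ℝ, Nat.card {F : P.Facet // v ∈ F.1.1} = P.dim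

/-- Two polytopes are combinatorially equivalent if their face lattices are isomorphic. -/
def CombEquiv (P Q : Polytope) : Prop := Nonempty (P.Face ≃o Q.Face)

instance combSetoid : Setoid Polytope where
  r := CombEquiv
  iseqv := ⟨fun _ => ⟨OrderIso.refl _⟩, fun ⟨e⟩ => ⟨e.symm⟩, fun ⟨e⟩ ⟨f⟩ => ⟨e.trans f⟩⟩

/-- The Cartesian product of two polytopes. -/
def prod (P Q : Polytope) : Polytope where
  V := P.V × Q.V
  carrier := P.carrier ×ˢ Q.carrier
  exists_finset := by
    obtain ⟨s, hs, h⟩ := P.exists_finset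
    obtain ⟨t, ht, h'⟩ := Q.exists_finset
    refine ⟨s ×ˢ t, hs.product ht, ?_⟩
    rw [h, h', Finset.coe_product, convexHull_prod]

/-- The point. -/
def point : Polytope where
  V := Fin 0 → ℝ
  carrier := {0}
  exists_finset := ⟨{0}, by simp, by simp⟩

/-- The segment `[0, 1]`. -/
def segment : Polytope where
  V := ℝ
  carrier := Set.Icc 0 1
  exists_finset := ⟨{0, 1}, by simp, by
    rw [Finset.coe_insert, Finset.coe_singleton, convexHull_pair, segment_eq_Icc zero_le_one]⟩

/-- The faces of a product are the products of faces. -/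
theorem isFace_prod (P Q : Polytope) {F : Set P.V} {G : Set Q.V} (hF : P.IsFace F)
    (hG : Q.IsFace G) : (P.prod Q).IsFace (F ×ˢ G : Set (P.V × Q.V)) := by
  refine ⟨hF.nonempty.prod hG.nonempty, hF.convex.prod hG.convex,
    ⟨Set.prod_mono hF.extreme.subset hG.extreme.subset, ?_⟩⟩
  rintro ⟨x₁, x₂⟩ hx ⟨y₁, y₂⟩ hy ⟨z₁, z₂⟩ hz ⟨a, b, ha, hb, hab, h⟩
  have h1 : a • x₁ + b • y₁ = z₁ := congrArg Prod.fst h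
  have h2 : a • x₂ + b • y₂ = z₂ := congrArg Prod.snd h
  exact ⟨hF.extreme.left_mem_of_mem_openSegment hx.1 hy.1 hz.1 ⟨a, b, ha, hb, hab, h1⟩,
    hG.extreme.left_mem_of_mem_openSegment hx.2 hy.2 hz.2 ⟨a, b, ha, hb, hab, h2⟩⟩

theorem face_swap (P Q : Polytope) {F : Set (P.V × Q.V)} (hF : (P.prod Q).IsFace F)
    {x x' : P.V} {y y' : Q.V} (h : (x, y) ∈ F) (h' : (x', y') ∈ F) : (x, y') ∈ F := by
  have hp : (x, y) ∈ P.carrier ×ˢ Q.carrier := hF.extreme.subset h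
  have hp' : (x', y') ∈ P.carrier ×ˢ Q.carrier := hF.extreme.subset h'
  have hhalf : (0 : ℝ) < 1 / 2 := by norm_num
  have hm : (1 / 2 : ℝ) • (x, y) + (1 / 2 : ℝ) • (x', y') ∈ F :=
    hF.convex h h' hhalf.le hhalf.le (by norm_num)
  refine hF.extreme.left_mem_of_mem_openSegment (x := (x, y')) (y := (x', y))
    ⟨hp.1, hp'.2⟩ ⟨hp'.1, hp.2⟩ hm ⟨1 / 2, 1 / 2, hhalf, hhalf, by norm_num, ?_⟩
  apply Prod.ext
  · rfl
  · exact add_comm ((1 / 2 : ℝ) • y') ((1 / 2 : ℝ) • y)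

theorem isFace_fst (P Q : Polytope) {F : Set (P.V × Q.V)} (hF : (P.prod Q).IsFace F) :
    P.IsFace (Prod.fst '' F) := by
  refine ⟨hF.nonempty.image _, hF.convex.linear_image (LinearMap.fst ℝ P.V Q.V), ⟨?_, ?_⟩⟩
  · rintro _ ⟨p, hp, rfl⟩
    exact (hF.extreme.subset hp).1
  · rintro x hx x' hx' _ ⟨⟨z, y⟩, hz, rfl⟩ ⟨a, b, ha, hb, hab, h⟩
    have hy : y ∈ Q.carrier := (hF.extreme.subset hz).2
    refine ⟨(x, y), hF.extreme.left_mem_of_mem_openSegment (x := (x, y)) (y := (x', y))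
      ⟨hx, hy⟩ ⟨hx', hy⟩ hz ⟨a, b, ha, hb, hab, ?_⟩, rfl⟩
    apply Prod.ext
    · exact h
    · change a • y + b • y = y
      rw [← add_smul, hab, one_smul]

theorem isFace_snd (P Q : Polytope) {F : Set (P.V × Q.V)} (hF : (P.prod Q).IsFace F) :
    Q.IsFace (Prod.snd '' F) := by
  refine ⟨hF.nonempty.image _, hF.convex.linear_image (LinearMap.snd ℝ P.V Q.V), ⟨?_, ?_⟩⟩
  · rintro _ ⟨p, hp, rfl⟩
    exact (hF.extreme.subset hp).2
  · rintro x hx x' hx' _ ⟨⟨y, z⟩, hz, rfl⟩ ⟨a, b, ha, hb, hab, h⟩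
    have hy : y ∈ P.carrier := (hF.extreme.subset hz).1
    refine ⟨(y, x), hF.extreme.left_mem_of_mem_openSegment (x := (y, x)) (y := (y, x'))
      ⟨hy, hx⟩ ⟨hy, hx'⟩ hz ⟨a, b, ha, hb, hab, ?_⟩, rfl⟩
    apply Prod.ext
    · change a • y + b • y = y
      rw [← add_smul, hab, one_smul]
    · exact h

/-- The product of two isomorphisms of posets. -/
def isoProd {α β γ δ : Type} [PartialOrder α] [PartialOrder β] [PartialOrder γ] [PartialOrder δ]
    (e : α ≃o γ) (f : β ≃o δ) : α × β ≃o γ × δ where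
  toEquiv := Equiv.prodCongr e.toEquiv f.toEquiv
  map_rel_iff' {a b} := and_congr (e.le_iff_le (x := a.1) (y := b.1))
    (f.le_iff_le (x := a.2) (y := b.2))

/-- The face poset of a product is the product of the face posets. -/
def faceProdIso (P Q : Polytope) : (P.prod Q).Face ≃o P.Face × Q.Face where
  toFun F := (⟨Prod.fst '' F.1, isFace_fst P Q F.2⟩, ⟨Prod.snd '' F.1, isFace_snd P Q F.2⟩)
  invFun G := ⟨(G.1.1 ×ˢ G.2.1 : Set (P.V × Q.V)), isFace_prod P Q G.1.2 G.2.2⟩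
  left_inv F := by
    apply Subtype.ext
    apply Set.Subset.antisymm
    · rintro ⟨x, y⟩ ⟨⟨⟨x₁, y₁⟩, h₁, hx⟩, ⟨⟨x₂, y₂⟩, h₂, hy⟩⟩
      obtain rfl : x₁ = x := hx
      obtain rfl : y₂ = y := hy
      exact face_swap P Q F.2 h₁ h₂
    · intro p hp
      exact ⟨⟨p, hp, rfl⟩, ⟨p, hp, rfl⟩⟩
  right_inv G := by
    apply Prod.ext
    · exact Subtype.ext (Set.fst_image_prod _ G.2.2.nonempty)
    · exact Subtype.ext (Set.snd_image_prod G.1.2.nonempty _)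
  map_rel_iff' := by
    intro F F'
    constructor
    · rintro ⟨h1, h2⟩ ⟨x, y⟩ hp
      obtain ⟨⟨x₁, y₁⟩, h₁, hx⟩ := h1 ⟨(x, y), hp, rfl⟩
      obtain ⟨⟨x₂, y₂⟩, h₂, hy⟩ := h2 ⟨(x, y), hp, rfl⟩
      obtain rfl : x₁ = x := hx
      obtain rfl : y₂ = y := hy
      exact face_swap P Q F'.2 h₁ h₂
    · intro h
      exact ⟨Set.image_mono h, Set.image_mono h⟩

instance : Unique point.Face where
  default := ⊤
  uniq F := Subtype.ext (Set.Nonempty.subset_singleton_iff F.2.nonempty |>.1 F.2.extreme.subset)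

/-- An isomorphism of posets restricts to the elements below a given one. -/
def iicIso {α β : Type} [PartialOrder α] [PartialOrder β] (e : α ≃o β) (a : α) :
    Set.Iic a ≃o Set.Iic (e a) where
  toEquiv := Equiv.subtypeEquiv e.toEquiv fun _ => (e.le_iff_le).symm
  map_rel_iff' {b c} := e.le_iff_le (x := b.1) (y := c.1)

/-- The faces of a face `F` of `P` are the faces of `P` contained in `F`. -/
def faceToPolytopeIso {P : Polytope} (F : P.Face) : F.toPolytope.Face ≃o Set.Iic F where
  toFun G := ⟨⟨G.1, G.2.nonempty, G.2.convex, F.2.extreme.trans G.2.extreme⟩, G.2.extreme.subset⟩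
  invFun G := ⟨G.1.1, G.1.2.nonempty, G.1.2.convex, G.1.2.extreme.mono F.2.extreme.subset G.2⟩
  left_inv _ := rfl
  right_inv _ := rfl
  map_rel_iff' := Iff.rfl

end Polytope

/-! ### The ring of polytopes and its boundary operator -/

/-- Combinatorial types of convex polytopes. -/
def CombType : Type 1 := Quotient Polytope.combSetoid

namespace CombType

open Polytope

/-- The combinatorial type of a polytope. -/
def of (P : Polytope) : CombType := Quotient.mk _ P

/-- Combinatorial types are multiplied by the Cartesian product; the unit is the point. -/
instance : CommMonoid CombType where
  mul := Quotient.map₂ Polytope.prod fun P P' ⟨e⟩ Q Q' ⟨f⟩ =>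
    ⟨(faceProdIso P Q).trans ((isoProd e f).trans (faceProdIso P' Q').symm)⟩
  one := of point
  mul_assoc := by
    rintro ⟨P⟩ ⟨Q⟩ ⟨R⟩
    refine Quotient.sound ⟨?_⟩
    exact (faceProdIso (P.prod Q) R).trans
      ((isoProd (faceProdIso P Q) (OrderIso.refl _)).trans
        ((OrderIso.prodAssoc _ _ _).trans
          ((isoProd (OrderIso.refl _) (faceProdIso Q R).symm).trans
            (faceProdIso P (Q.prod R)).symm)))
  mul_comm := by
    rintro ⟨P⟩ ⟨Q⟩
    exact Quotient.sound
      ⟨(faceProdIso P Q).trans (OrderIso.prodComm.trans (faceProdIso Q P).symm)⟩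
  one_mul := by
    rintro ⟨P⟩
    refine Quotient.sound ⟨(faceProdIso point P).trans
      { Equiv.uniqueProd P.Face point.Face with map_rel_iff' := ?_ }⟩
    rintro ⟨a, b⟩ ⟨a', b'⟩
    exact ⟨fun h => ⟨(Subsingleton.elim a a').le, h⟩, fun h => h.2⟩
  mul_one := by
    rintro ⟨P⟩
    refine Quotient.sound ⟨(faceProdIso P point).trans
      { Equiv.prodUnique P.Face point.Face with map_rel_iff' := ?_ }⟩
    rintro ⟨a, b⟩ ⟨a', b'⟩
    exact ⟨fun h => ⟨h, (Subsingleton.elim b b').le⟩, fun h => h.1⟩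

/-- The combinatorial type `c` is represented by a simple polytope. -/
def IsSimple (c : CombType) : Prop := ∃ P : Polytope, of P = c ∧ P.IsSimple

/-- The combinatorial type `c` is represented by an `n`-dimensional polytope. -/
def HasDim (c : CombType) (n : ℕ) : Prop := ∃ P : Polytope, of P = c ∧ P.dim = n

end CombType

/-- The ring of polytopes: the free abelian group on the combinatorial types of polytopes, with
addition corresponding to disjoint union and multiplication induced by the Cartesian product.
The ring of simple polytopes is its subring spanned by the types of simple polytopes. -/
abbrev PolytopeRing : Type 1 := MonoidAlgebra ℤ CombType

namespace PolytopeRing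

open Polytope

/-- The generator of the ring of polytopes given by a combinatorial type. -/
def gen (c : CombType) : PolytopeRing := MonoidAlgebra.single c 1

/-- The disjoint union of the facets of a polytope. -/
def facetSum (P : Polytope) : PolytopeRing := ∑ F : P.Facet, gen (CombType.of F.1.toPolytope)

theorem facetSum_congr (P Q : Polytope) (h : P.CombEquiv Q) : facetSum P = facetSum Q := by
  obtain ⟨e⟩ := h
  have σ : ∀ F : P.Face, IsCoatom F ↔ IsCoatom (e.toEquiv F) := fun F => (e.isCoatom_iff F).symm
  refine Fintype.sum_equiv (show P.Facet ≃ Q.Facet from Equiv.subtypeEquiv e.toEquiv σ) _ _ ?_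
  intro F
  refine congrArg gen (Quotient.sound ⟨?_⟩)
  exact (faceToPolytopeIso F.1).trans
    ((iicIso e F.1).trans (faceToPolytopeIso (e F.1)).symm)

/-- The boundary operator: the additive map sending a polytope to the disjoint union of its
facets. -/
def d : PolytopeRing →ₗ[ℤ] PolytopeRing :=
  (Finsupp.linearCombination ℤ fun c : CombType => Quotient.lift facetSum facetSum_congr c) ∘ₗ
    (MonoidAlgebra.coeffLinearEquiv ℤ).toLinearMap

theorem d_gen_of (P : Polytope) : d (gen (CombType.of P)) = facetSum P := by
  simp only [d, gen, LinearMap.comp_apply, LinearEquiv.coe_coe]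
  change Finsupp.linearCombination ℤ _ (Finsupp.single (CombType.of P) (1 : ℤ)) = _
  rw [Finsupp.linearCombination_single, one_smul]
  rfl

end PolytopeRing

/-! ### Families of polytopes, `d`-closure and complexity -/

/-- A family of (simple) polytopes: for each `n` the set of its `n`-dimensional elements is nonempty
and finite. -/
def IsFamily (F : Set CombType) : Prop :=
  (∀ c ∈ F, c.IsSimple) ∧ ∀ n : ℕ, {c ∈ F | c.HasDim n}.Nonempty ∧ {c ∈ F | c.HasDim n}.Finite

/-- A line family: it has exactly one element in each dimension. -/
def IsLineFamily (F : Set CombType) : Prop :=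
  IsFamily F ∧ ∀ n : ℕ, ∃! c : CombType, c ∈ F ∧ c.HasDim n

/-- The subring of the ring of polytopes generated by the members of `F`. -/
def familyRing (F : Set CombType) : Subring PolytopeRing :=
  Subring.closure (PolytopeRing.gen '' F)

/-- A differential family: the ring generated by it is closed under `d`. (As `d` lowers the
dimension by one, `d` then automatically respects the grading.) -/
def IsDFamily (F : Set CombType) : Prop :=
  IsFamily F ∧ ∀ x ∈ familyRing F, PolytopeRing.d x ∈ familyRing F

/-- `D` is the `d`-closure of `F`: the smallest differential family containing `F`. -/
def IsDClosure (F D : Set CombType) : Prop := IsLeast {D | F ⊆ D ∧ IsDFamily D} D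

/-- `D` is a union of `k` line families. -/
def IsUnionOfLineFamilies (D : Set CombType) (k : ℕ) : Prop :=
  ∃ L : Fin k → Set CombType, (∀ i, IsLineFamily (L i)) ∧ D = ⋃ i, L i

/-- The family `F` has complexity `k`: its `d`-closure is a union of `k` line families, and not of
fewer. -/
def HasComplexity (F : Set CombType) (k : ℕ) : Prop :=
  ∃ D, IsDClosure F D ∧ IsLeast {k | IsUnionOfLineFamilies D k} k

/-! ### Building sets and nestohedra -/

/-- A building set on the finite set `ι`: a set of nonempty subsets which contains all singletons,
and the union of any two of its members that meet. -/
structure BuildingSet (ι : Type) [DecidableEq ι] where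
  sets : Finset (Finset ι)
  nonempty_of_mem : ∀ S ∈ sets, S.Nonempty
  singleton_mem : ∀ i : ι, {i} ∈ sets
  union_mem : ∀ S ∈ sets, ∀ T ∈ sets, (S ∩ T).Nonempty → S ∪ T ∈ sets

/-- The nestohedron of a building set: the Minkowski sum of the simplices
`conv (e_i : i ∈ S)`, `S ∈ B`, in the space with basis `(e_i)`. -/
def nestohedron {ι : Type} [DecidableEq ι] (B : BuildingSet ι) : Polytope where
  V := ι → ℝ
  carrier := ∑ S ∈ B.sets, convexHull ℝ ((fun i : ι => (Pi.single i 1 : ι → ℝ)) '' (S : Set ι))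
  exists_finset := by
    classical
    refine ⟨∑ S ∈ B.sets, S.image fun i : ι => (Pi.single i 1 : ι → ℝ), ?_, ?_⟩
    · have h : ∀ A : Finset (Finset ι), (∀ S ∈ A, S.Nonempty) →
          (∑ S ∈ A, S.image fun i : ι => (Pi.single i 1 : ι → ℝ)).Nonempty := by
        intro A
        induction A using Finset.induction_on with
        | empty => simp
        | insert S A hS ih =>
          intro hA
          rw [Finset.sum_insert hS]
          exact ((hA S (Finset.mem_insert_self _ _)).image _).add
            (ih fun T hT => hA T (Finset.mem_insert_of_mem hT))
      exact h _ B.nonempty_of_mem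
    · rw [Finset.coe_sum, convexHull_sum]
      simp only [Finset.coe_image]

open Classical in
/-- The graphical building set of a graph: all sets of vertices that induce a connected (in
particular nonempty) subgraph. -/
def graphBuildingSet {ι : Type} [Fintype ι] [DecidableEq ι] (G : SimpleGraph ι) :
    BuildingSet ι where
  sets := Finset.univ.filter fun S => (G.induce (S : Set ι)).Connected
  nonempty_of_mem S hS := by
    obtain ⟨x⟩ := (Finset.mem_filter.1 hS).2.nonempty
    exact ⟨x.1, x.2⟩
  singleton_mem i := by
    refine Finset.mem_filter.2 ⟨Finset.mem_univ _, ?_⟩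
    rw [Finset.coe_singleton]
    have : Subsingleton ({i} : Set ι) := inferInstance
    exact ⟨SimpleGraph.Preconnected.of_subsingleton⟩
  union_mem S hS T hT h := by
    refine Finset.mem_filter.2 ⟨Finset.mem_univ _, ?_⟩
    rw [Finset.coe_union]
    refine SimpleGraph.induce_union_connected (Finset.mem_filter.1 hS).2.preconnected
      (Finset.mem_filter.1 hT).2.preconnected ?_
    rw [← Finset.coe_inter]
    exact Finset.coe_nonempty.2 h

/-- The permutohedron `Pe^n`: the graph-associahedron of the complete graph on `n + 1` vertices. -/
def permutohedron (n : ℕ) : CombType :=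
  CombType.of (nestohedron (graphBuildingSet (⊤ : SimpleGraph (Fin (n + 1)))))

/-- The stellahedron `St^n`: the graph-associahedron of the star graph on `n + 1` vertices. -/
def stellahedron (n : ℕ) : CombType :=
  CombType.of (nestohedron (graphBuildingSet (SimpleGraph.starGraph (0 : Fin (n + 1)))))

/-- Membership in the building set `B(P,n)`, where the points `1, 2, …, n + 1` of `[n+1]` are
written `0, 1, …, n`: singletons; `{1, 2, i₁, …, i_k}` with `3 ≤ i₁ < … < i_k ≤ n + 1`;
and `{1, j₁, …, j_p}` with `p ≥ 1` and `3 ≤ j₁ < … < j_p ≤ n`. -/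
def masRel (n : ℕ) (S : Finset (Fin (n + 1))) : Prop :=
  S.card = 1 ∨ (0 ∈ S ∧ 1 ∈ S) ∨ (0 ∈ S ∧ 1 ∉ S ∧ Fin.last n ∉ S ∧ 2 ≤ S.card)

open Classical in
/-- The building set `B(P,n)`. -/
def masBuildingSet (n : ℕ) : BuildingSet (Fin (n + 1)) where
  sets := Finset.univ.filter (masRel n)
  nonempty_of_mem S hS := by
    rcases (Finset.mem_filter.1 hS).2 with h | h | h
    · exact Finset.card_pos.1 (by omega)
    · exact ⟨0, h.1⟩
    · exact ⟨0, h.1⟩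
  singleton_mem i := by simp [masRel]
  union_mem S hS T hT h := by
    have hS := (Finset.mem_filter.1 hS).2
    have hT := (Finset.mem_filter.1 hT).2
    refine Finset.mem_filter.2 ⟨Finset.mem_univ _, ?_⟩
    obtain ⟨x, hx⟩ := h
    obtain ⟨hxS, hxT⟩ := Finset.mem_inter.1 hx
    have single : ∀ {A C : Finset (Fin (n + 1))}, A.card = 1 → x ∈ A → x ∈ C → A ∪ C = C := by
      intro A C hA hxA hxC
      obtain ⟨a, rfl⟩ := Finset.card_eq_one.1 hA
      obtain rfl := Finset.mem_singleton.1 hxA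
      exact Finset.union_eq_right.2 (Finset.singleton_subset_iff.2 hxC)
    by_cases h1 : S.card = 1
    · rwa [single h1 hxS hxT]
    by_cases h2 : T.card = 1
    · rwa [Finset.union_comm, single h2 hxT hxS]
    have hcard : S.card ≤ (S ∪ T).card := Finset.card_le_card Finset.subset_union_left
    simp only [masRel, Finset.mem_union] at hS hT ⊢
    by_cases hm : (1 : Fin (n + 1)) ∈ S ∨ (1 : Fin (n + 1)) ∈ T
    · exact Or.inr (Or.inl ⟨by tauto, hm⟩)
    · have hS' : 0 ∈ S ∧ Fin.last n ∉ S ∧ 2 ≤ S.card := by tauto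
      have hT' : 0 ∈ T ∧ Fin.last n ∉ T ∧ 2 ≤ T.card := by tauto
      exact Or.inr (Or.inr ⟨Or.inl hS'.1, hm, by tauto, by omega⟩)

/-- The family `P_Mas`: a point, a segment, and the nestohedra of `B(P,n)` for `n ≥ 2`. -/
def PMas : ℕ → CombType
  | 0 => CombType.of Polytope.point
  | 1 => CombType.of Polytope.segment
  | n + 2 => CombType.of (nestohedron (masBuildingSet (n + 2)))

/-- Membership in the building set `B(Γ,n)`, where the points `1, 2, …, n + 1` of `[n+1]` are
written `0, 1, …, n`: singletons; all subsets of `{1, …, n}` with at least two elements; and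
`{1, j₁, …, j_p, n + 1}` with `2 ≤ j₁ < … < j_p ≤ n`. -/
def gammaRel (n : ℕ) (S : Finset (Fin (n + 1))) : Prop :=
  S.card = 1 ∨ (Fin.last n ∉ S ∧ 2 ≤ S.card) ∨ (0 ∈ S ∧ Fin.last n ∈ S)

open Classical in
/-- The building set `B(Γ,n)`: the graphical building set of the complete graph on `{1, …, n}` with
a pendant edge joining `1` and `n + 1`. -/
def gammaBuildingSet (n : ℕ) : BuildingSet (Fin (n + 1)) where
  sets := Finset.univ.filter (gammaRel n)
  nonempty_of_mem S hS := by
    rcases (Finset.mem_filter.1 hS).2 with h | h | h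
    · exact Finset.card_pos.1 (by omega)
    · exact Finset.card_pos.1 (by omega)
    · exact ⟨0, h.1⟩
  singleton_mem i := by simp [gammaRel]
  union_mem S hS T hT h := by
    have hS := (Finset.mem_filter.1 hS).2
    have hT := (Finset.mem_filter.1 hT).2
    refine Finset.mem_filter.2 ⟨Finset.mem_univ _, ?_⟩
    obtain ⟨x, hx⟩ := h
    obtain ⟨hxS, hxT⟩ := Finset.mem_inter.1 hx
    have single : ∀ {A C : Finset (Fin (n + 1))}, A.card = 1 → x ∈ A → x ∈ C → A ∪ C = C := by
      intro A C hA hxA hxC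
      obtain ⟨a, rfl⟩ := Finset.card_eq_one.1 hA
      obtain rfl := Finset.mem_singleton.1 hxA
      exact Finset.union_eq_right.2 (Finset.singleton_subset_iff.2 hxC)
    by_cases h1 : S.card = 1
    · rwa [single h1 hxS hxT]
    by_cases h2 : T.card = 1
    · rwa [Finset.union_comm, single h2 hxT hxS]
    have hcard : S.card ≤ (S ∪ T).card := Finset.card_le_card Finset.subset_union_left
    have hpos : 0 < S.card := Finset.card_pos.2 ⟨x, hxS⟩
    simp only [gammaRel, Finset.mem_union] at hS hT ⊢
    by_cases hm : Fin.last n ∈ S ∨ Fin.last n ∈ T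
    · exact Or.inr (Or.inr ⟨by tauto, hm⟩)
    · exact Or.inr (Or.inl ⟨hm, by omega⟩)

/-- The family `P_Γ`: a point, a segment, and the nestohedra of `B(Γ,n)` for `n ≥ 2`. -/
def PGamma : ℕ → CombType
  | 0 => CombType.of Polytope.point
  | 1 => CombType.of Polytope.segment
  | n + 2 => CombType.of (nestohedron (gammaBuildingSet (n + 2)))

end

/-! The proof turns the face lattice of a nestohedron into combinatorics. A linear functional is
minimised on a Minkowski sum exactly when it is minimised on every summand. Hence the face selected
by coefficients `c` is determined by the minimiser sets `argmin c S`, `S ∈ B`, and inclusion of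
faces is inclusion of these sets (`face_le_iff`). Since every face of a polytope is exposed
(`exists_minFace_eq`), all faces arise in this way, and comparing two face posets amounts to
comparing two preorders on functionals (`nonempty_orderIso_of_surjective`).

For a building set containing the full set, the facets correspond to the proper members `S`, through
their indicator functions. The facet of `S` is the product of the nestohedra of the restriction to
`S` and of the contraction by `S`, whose members are the nonempty traces `T \ S` (`of_face_ind`). In
`B(P,n)`, with special points `0`, `1` and the last point `z`, the proper members are `{1}` and
`{z}` (two stellahedra), the other singletons except `{0}`, and the sets `{0} ∪ J`, `{0, 1} ∪ J`,
`{0, 1, z} ∪ J` with `J` among the remaining `n - 2` points. Grouping by the size of `J` gives the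
terms of the boundary formula.

For the complexity, the facets of `Pe`, `St` and `P_Γ` are again products of members of the four
families, and `d` is a derivation (`d_mul`), so the union of the four lines is a `d`-family. It is
the smallest one: a boundary has nonnegative coefficients, so nothing cancels, and each facet of a
member of a `d`-family is a product of members (`facet_mem_closure`). Each positive-dimensional `St`
and `P_Γ` occurs as a facet of some `P_Mas`, and each such `Pe` as a facet of a stellahedron. All of
them are indecomposable (`indecomposable_of_hub`), hence are members themselves.

Four lines are needed because the four 3-dimensional members have different numbers of facets.
Counting by dimension makes sense because the dimension is the height of the face poset
(`height_eq_finrank`) and hence a combinatorial invariant. -/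

set_option linter.unusedSectionVars false
set_option linter.unusedDecidableInType false
set_option linter.unusedFintypeInType false

noncomputable section

namespace Polytope

/-! ### Relative interiors and exposed faces -/

section Exposed

variable {V : Type} [AddCommGroup V] [Module ℝ V]

/-- Every real vector space carries a Hausdorff locally convex topology. -/
theorem exists_locallyConvex_topology (V : Type) [AddCommGroup V] [Module ℝ V] :
    ∃ _ : TopologicalSpace V, IsTopologicalAddGroup V ∧ ContinuousSMul ℝ V ∧
      LocallyConvexSpace ℝ V ∧ T2Space V := by
  -- The weak topology defined by all linear functionals; it is Hausdorff because they separate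
  -- points. It makes Hahn–Banach separation available in a bare vector space.
  let B : V →ₗ[ℝ] (Module.Dual ℝ V) →ₗ[ℝ] ℝ := Module.Dual.eval ℝ V
  refine ⟨(inferInstance : TopologicalSpace (WeakBilin B)),
    (inferInstance : IsTopologicalAddGroup (WeakBilin B)),
    (inferInstance : ContinuousSMul ℝ (WeakBilin B)),
    (inferInstance : LocallyConvexSpace ℝ (WeakBilin B)), ?_⟩
  have hB : Function.Injective B := by
    intro x y h
    exact (Module.forall_dual_apply_eq_zero_iff ℝ (x - y)).1 (fun f => by
      rw [map_sub, sub_eq_zero]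
      exact LinearMap.congr_fun h f) |> sub_eq_zero.1
  exact (WeakBilin.isEmbedding hB).t2Space

/-- A point in the relative interior of the convex hull of a finite set. -/
theorem exists_relint {s : Finset V} (hs : s.Nonempty) :
    ∃ p ∈ convexHull ℝ (s : Set V), ∀ u ∈ vectorSpan ℝ (s : Set V),
      ∃ ε : ℝ, 0 < ε ∧ p - ε • u ∈ convexHull ℝ (s : Set V) := by
  classical
  set k : ℝ := (s.card : ℝ) with hk
  have hk0 : 0 < k := by rw [hk]; exact_mod_cast hs.card_pos
  set p : V := ∑ y ∈ s, k⁻¹ • y with hp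
  have hpm : p ∈ convexHull ℝ (s : Set V) :=
    Finset.mem_convexHull'.2 ⟨fun _ => k⁻¹, fun _ _ => by positivity, by
      rw [Finset.sum_const, nsmul_eq_mul, ← hk, mul_inv_cancel₀ hk0.ne'], rfl⟩
  have hconv := convex_convexHull ℝ (s : Set V)
  refine ⟨p, hpm, ?_⟩
  -- the set of directions in which one can move from `p`
  let K : Set V := {u | ∃ ε : ℝ, 0 < ε ∧ p - ε • u ∈ convexHull ℝ (s : Set V)}
  -- `K` is a convex cone. The step length `a * b / (a + b)` is the one for which the weights `b /
  -- (a + b)` and `a / (a + b)` average the two displaced points.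
  have hadd : ∀ u ∈ K, ∀ v ∈ K, u + v ∈ K := by
    rintro u ⟨a, ha, hu⟩ v ⟨b, hb, hv⟩
    refine ⟨a * b / (a + b), by positivity, ?_⟩
    have := hconv hu hv (a := b / (a + b)) (b := a / (a + b)) (by positivity) (by positivity)
      (by field_simp; ring)
    convert this using 1
    have h1 : b / (a + b) + a / (a + b) = 1 := by field_simp; ring
    have h2 : p = (b / (a + b)) • p + (a / (a + b)) • p := by rw [← add_smul, h1, one_smul]
    conv_lhs => rw [h2]
    module
  have hsmul : ∀ (r : ℝ), 0 ≤ r → ∀ u ∈ K, r • u ∈ K := by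
    rintro r hr u ⟨a, ha, hu⟩
    rcases hr.eq_or_lt with rfl | hr
    · exact ⟨1, one_pos, by simpa using hpm⟩
    · refine ⟨a / r, by positivity, ?_⟩
      rwa [smul_smul, div_mul_cancel₀ _ hr.ne']
  have hpos : ∀ x ∈ s, x - p ∈ K := by
    intro x hx
    -- The displaced point is `(1 + k⁻¹) p - k⁻¹ x`. As `p` has weight `k⁻¹` at every point, the
    -- weight left at `x` is `k⁻²`, still nonnegative.
    refine ⟨k⁻¹, by positivity, ?_⟩
    refine Finset.mem_convexHull'.2
      ⟨fun y => k⁻¹ * (1 + k⁻¹) - if y = x then k⁻¹ else 0, ?_, ?_, ?_⟩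
    · intro y _
      have : 0 ≤ k⁻¹ := by positivity
      dsimp only
      split_ifs <;> nlinarith
    · rw [Finset.sum_sub_distrib, Finset.sum_const, nsmul_eq_mul, ← hk, Finset.sum_ite_eq' s x,
        if_pos hx]
      field_simp
      ring
    · have : ∀ y ∈ s, (k⁻¹ * (1 + k⁻¹) - if y = x then k⁻¹ else 0) • y =
          (1 + k⁻¹) • (k⁻¹ • y) - (if y = x then k⁻¹ • x else 0) := by
        intro y _
        split_ifs with h
        · subst h; module
        · module
      rw [Finset.sum_congr rfl this, Finset.sum_sub_distrib, ← Finset.smul_sum, ← hp,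
        Finset.sum_ite_eq' s x, if_pos hx]
      module
  have hneg : ∀ x ∈ s, p - x ∈ K := by
    intro x hx
    refine ⟨1, one_pos, ?_⟩
    rw [one_smul, sub_sub_cancel]
    exact subset_convexHull ℝ _ hx
  intro u hu
  -- The part of the cone `K` symmetric under negation is a subspace, and it contains all
  -- differences of points of `s`.
  have hK : ∀ u ∈ vectorSpan ℝ (s : Set V), u ∈ K ∧ -u ∈ K := by
    intro u hu
    refine Submodule.span_induction (p := fun u _ => u ∈ K ∧ -u ∈ K) ?_ ?_ ?_ ?_ hu
    · rintro _ ⟨x, hx, y, hy, rfl⟩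
      have h1 : x -ᵥ y = (x - p) + (p - y) := by rw [vsub_eq_sub]; abel
      have h2 : -(x -ᵥ y) = (p - x) + (y - p) := by rw [vsub_eq_sub]; abel
      dsimp only
      rw [h2, h1]
      exact ⟨hadd _ (hpos x hx) _ (hneg y hy), hadd _ (hneg x hx) _ (hpos y hy)⟩
    · have : (0 : V) ∈ K := ⟨1, one_pos, by simpa using hpm⟩
      exact ⟨this, by simpa using this⟩
    · rintro x y _ _ ⟨h1, h2⟩ ⟨h3, h4⟩
      exact ⟨hadd _ h1 _ h3, by rw [neg_add]; exact hadd _ h2 _ h4⟩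
    · rintro a x _ ⟨h1, h2⟩
      rcases le_total 0 a with ha | ha
      · exact ⟨hsmul a ha _ h1, by rw [← smul_neg]; exact hsmul a ha _ h2⟩
      · have h3 := hsmul (-a) (by linarith) _ h1
        have h4 := hsmul (-a) (by linarith) _ h2
        rw [neg_smul] at h3
        rw [neg_smul, smul_neg, neg_neg] at h4
        exact ⟨h4, h3⟩
  exact (hK u hu).1

theorem vectorSpan_convexHull (s : Set V) :
    vectorSpan ℝ (convexHull ℝ s) = vectorSpan ℝ s := by
  rw [← direction_affineSpan, affineSpan_convexHull, direction_affineSpan]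

/-- If `x`, `p` lie in `A`, one can move from the point `p` of the extreme subset `F` away from `x`
inside `F`, then `x ∈ F`. -/
theorem mem_of_sub_smul_mem {A F : Set V} (he : IsExtreme ℝ A F) {x p : V} (hx : x ∈ A)
    (hp : p ∈ F) {ε : ℝ} (hε : 0 < ε) (h : p - ε • (x - p) ∈ F) : x ∈ F := by
  refine he.left_mem_of_mem_openSegment hx (he.subset h) hp
    ⟨ε / (1 + ε), 1 / (1 + ε), by positivity, by positivity, by field_simp; ring, ?_⟩
  have h1 : p = (ε / (1 + ε)) • p + (1 / (1 + ε)) • p := by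
    rw [← add_smul]
    have : ε / (1 + ε) + 1 / (1 + ε) = 1 := by field_simp; ring
    rw [this, one_smul]
  have h2 : ε / (1 + ε) = (1 / (1 + ε)) * ε := by ring
  conv_rhs => rw [h1]
  rw [h2]
  module

end Exposed

variable (P : Polytope)

theorem IsFace.exists_finset {P : Polytope} {F : Set P.V} (hF : P.IsFace F) :
    ∃ s : Finset P.V, s.Nonempty ∧ F = convexHull ℝ (s : Set P.V) :=
  (show P.Face from ⟨F, hF⟩).toPolytope.exists_finset

instance (P : Polytope) : FiniteDimensional ℝ (vectorSpan ℝ P.carrier) := by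
  obtain ⟨t, -, h⟩ := P.exists_finset
  rw [h, vectorSpan_convexHull]
  exact finiteDimensional_vectorSpan_of_finite ℝ t.finite_toSet

/-- The minimum of a linear functional on a polytope is attained. -/
theorem exists_minimizer (f : P.V →ₗ[ℝ] ℝ) : ∃ x ∈ P.carrier, ∀ y ∈ P.carrier, f x ≤ f y := by
  obtain ⟨t, ht, hP⟩ := P.exists_finset
  obtain ⟨x, hx, hmin⟩ := t.exists_min_image f ht
  refine ⟨x, hP ▸ subset_convexHull ℝ _ hx, fun y hy => ?_⟩
  have : convexHull ℝ (t : Set P.V) ⊆ {y | f x ≤ f y} :=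
    convexHull_min (fun z hz => hmin z hz) (convex_halfSpace_ge f.isLinear _)
  exact this (hP ▸ hy)

/-- The face of `P` on which the linear functional `f` is minimal. -/
def minFace (f : P.V →ₗ[ℝ] ℝ) : P.Face :=
  ⟨{x ∈ P.carrier | ∀ y ∈ P.carrier, f x ≤ f y}, P.exists_minimizer f, by
    obtain ⟨x₀, hx₀, hmin⟩ := P.exists_minimizer f
    have : {x ∈ P.carrier | ∀ y ∈ P.carrier, f x ≤ f y} = P.carrier ∩ {x | f x ≤ f x₀} := by
      ext x
      exact and_congr_right fun _ => ⟨fun h => h x₀ hx₀, fun h y hy => le_trans h (hmin y hy)⟩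
    rw [this]
    exact P.carrier_convex.inter (convex_halfSpace_le f.isLinear _), by
    refine ⟨fun x hx => hx.1, ?_⟩
    rintro x hx y hy z hz ⟨a, b, ha, hb, hab, rfl⟩
    refine ⟨hx, fun w hw => ?_⟩
    have h1 := hz.2 w hw
    have h2 := hz.2 y hy
    simp only [map_add, map_smul, smul_eq_mul] at h1 h2
    obtain rfl : b = 1 - a := by linarith
    -- Minimality at the interior point `z` gives `a f x + (1 - a) f y ≤ f y`; then `f x` is at most
    -- the value at `z`.
    have h3 : f x ≤ f y := by
      by_contra hlt
      push Not at hlt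
      nlinarith
    nlinarith⟩

/-- Every face of a polytope is exposed: it is the set of minimisers of a linear functional. -/
theorem exists_minFace_eq (F : P.Face) : ∃ f : P.V →ₗ[ℝ] ℝ, P.minFace f = F := by
  classical
  obtain ⟨F, hF⟩ := F
  obtain ⟨t, ht, hP⟩ := P.exists_finset
  obtain ⟨s, hs, hFs⟩ := hF.exists_finset
  obtain ⟨p, hp, hrel⟩ := exists_relint hs
  rw [← hFs] at hp hrel
  obtain ⟨τ, h1, h2, h3, h4⟩ := exists_locallyConvex_topology P.V
  set W := vectorSpan ℝ (s : Set P.V) with hW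
  have hfd : FiniteDimensional ℝ W := finiteDimensional_vectorSpan_of_finite ℝ s.finite_toSet
  set u := t.filter (· ∉ F) with hu
  have hut : (u : Set P.V) ⊆ P.carrier := fun x hx =>
    hP ▸ subset_convexHull ℝ _ (Finset.mem_filter.1 hx).1
  -- The complement of an extreme subset of a convex set is convex, so the hull of the generators
  -- outside `F` misses `F`.
  have hC : convexHull ℝ (u : Set P.V) ⊆ P.carrier \ F := by
    refine convexHull_min (fun x hx => ⟨hut hx, ?_⟩) (hF.extreme.convex_sdiff P.carrier_convex)
    exact (Finset.mem_filter.1 hx).2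
  set A : Set P.V := (fun x => p + x) '' (W : Set P.V) with hA
  have hAc : IsClosed A := by
    rw [hA]
    exact (Homeomorph.addLeft p).isClosedMap _ W.closed_of_finiteDimensional
  have hAconv : Convex ℝ A := W.convex.translate p
  -- `A` is the affine hull of `F`. From the relatively interior point `p` one can move inside `F`
  -- away from any `q ∈ A`; if `q` lies in the polytope, extremeness then puts `q` in `F`.
  have hdisj : Disjoint (convexHull ℝ (u : Set P.V)) A := by
    rw [Set.disjoint_left]
    rintro _ hq ⟨w, hw, rfl⟩
    obtain ⟨ε, hε, hmem⟩ := hrel w hw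
    refine (hC hq).2 (mem_of_sub_smul_mem hF.extreme (hC hq).1 hp hε ?_)
    simpa using hmem
  obtain ⟨f, a, b, hfa, hab, hfb⟩ := geometric_hahn_banach_compact_closed
    (convex_convexHull ℝ (u : Set P.V)) (u.finite_toSet.isCompact_convexHull ℝ) hAconv hAc hdisj
  -- A functional bounded below on an affine subspace is constant on it; otherwise the chosen
  -- multiple of `w` would reach the value `b`.
  have hf0 : ∀ w ∈ W, f w = 0 := by
    intro w hw
    by_contra hne
    have := hfb (p + ((b - f p) / f w) • w) ⟨_, W.smul_mem _ hw, rfl⟩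
    rw [map_add, map_smul, smul_eq_mul, div_mul_cancel₀ _ hne] at this
    linarith
  have hfF : ∀ x ∈ F, f x = f p := by
    intro x hx
    have : x - p ∈ W := by
      rw [hW, ← vectorSpan_convexHull, ← hFs]
      exact vsub_mem_vectorSpan ℝ hx hp
    have := hf0 _ this
    rw [map_sub] at this
    linarith
  have hfp : a < f p := by
    have := hfb (p + 0) ⟨0, W.zero_mem, rfl⟩
    rw [add_zero] at this
    linarith
  refine ⟨-(f : P.V →ₗ[ℝ] ℝ), ?_⟩
  set g : P.V →ₗ[ℝ] ℝ := -(f : P.V →ₗ[ℝ] ℝ) with hg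
  have hgf : ∀ x, g x = - f x := fun x => rfl
  have hmin : ∀ y ∈ P.carrier, f y ≤ f p := by
    have : convexHull ℝ (t : Set P.V) ⊆ {y | (f : P.V →ₗ[ℝ] ℝ) y ≤ f p} := by
      refine convexHull_min (fun z hz => ?_)
        (convex_halfSpace_le (f : P.V →ₗ[ℝ] ℝ).isLinear _)
      by_cases hzF : z ∈ F
      · exact (hfF z hzF).le
      · exact ((hfa z (subset_convexHull ℝ _ (Finset.mem_filter.2 ⟨hz, hzF⟩))).trans hfp).le
    intro y hy
    exact this (hP ▸ hy)
  have hsub : F ⊆ (P.minFace g).1 := fun x hx => ⟨hF.extreme.subset hx, fun y hy => by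
    rw [hgf, hgf, hfF x hx]
    linarith [hmin y hy]⟩
  refine Subtype.ext (Set.Subset.antisymm ?_ hsub)
  have h5 := face_eq_convexHull t (P.minFace g).2.convex (hP ▸ (P.minFace g).2.extreme)
  rw [h5]
  refine convexHull_min ?_ hF.convex
  rintro x ⟨hxt, hx⟩
  by_contra hxF
  have h6 := hfa x (subset_convexHull ℝ _ (Finset.mem_filter.2 ⟨hxt, hxF⟩))
  have h7 := hx.2 p (hF.extreme.subset hp)
  rw [hgf, hgf] at h7
  linarith

/-! ### The dimension of a polytope is the height of its face poset -/

/-- The dimension of a proper face is smaller. -/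
theorem finrank_vectorSpan_lt {F G : P.Face} (h : F < G) :
    Module.finrank ℝ (vectorSpan ℝ F.1) < Module.finrank ℝ (vectorSpan ℝ G.1) := by
  have hle : F.1 ⊆ G.1 := h.le
  have : FiniteDimensional ℝ (vectorSpan ℝ G.1) :=
    (inferInstance : FiniteDimensional ℝ (vectorSpan ℝ G.toPolytope.carrier))
  refine Submodule.finrank_lt_finrank_of_lt (lt_of_le_of_ne (vectorSpan_mono ℝ hle) fun heq => ?_)
  obtain ⟨s, hs, hFs⟩ := F.2.exists_finset
  obtain ⟨p, hp, hrel⟩ := exists_relint hs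
  rw [← vectorSpan_convexHull, ← hFs] at hrel
  rw [← hFs] at hp
  -- With equal spans, `x - p` is a direction in which the relatively interior point `p` of `F` can
  -- be moved, so every `x ∈ G` falls into `F`.
  refine h.not_ge fun x hx => ?_
  have hxp : x - p ∈ vectorSpan ℝ F.1 := by
    rw [heq]
    exact vsub_mem_vectorSpan ℝ hx (hle hp)
  obtain ⟨ε, hε, hmem⟩ := hrel _ hxp
  exact mem_of_sub_smul_mem F.2.extreme (G.2.extreme.subset hx) hp hε hmem

/-- A face of codimension at least two is contained in a larger proper face. -/
theorem exists_between (F : P.Face) (h : Module.finrank ℝ (vectorSpan ℝ F.1) + 2 ≤ P.dim) :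
    ∃ G : P.Face, F < G ∧ G < ⊤ := by
  classical
  obtain ⟨t, ht, hP⟩ := P.exists_finset
  obtain ⟨f, rfl⟩ := P.exists_minFace_eq F
  set F := P.minFace f with hF
  set U := vectorSpan ℝ P.carrier with hU
  set W := vectorSpan ℝ F.1 with hW
  obtain ⟨p, hp⟩ := F.2.nonempty
  have hf : ∀ x ∈ F.1, f x = f p := fun x hx =>
    le_antisymm (hx.2 p hp.1) (hp.2 x hx.1)
  -- a direction along which `f` vanishes, but which is not a direction of `F`
  obtain ⟨v, hvU, hfv, hvW⟩ : ∃ v ∈ U, f v = 0 ∧ v ∉ W := by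
    by_contra! hcon
    -- The kernel of `f` has codimension at most one in `U`, while `W` has codimension at least two,
    -- so the kernel cannot lie in `W`.
    set f' : U →ₗ[ℝ] ℝ := f.domRestrict U with hf'
    have h1 : Submodule.map U.subtype (LinearMap.ker f') ≤ W := by
      rintro _ ⟨v, hv, rfl⟩
      exact hcon v v.2 hv
    have hfdW : FiniteDimensional ℝ W :=
      (inferInstance : FiniteDimensional ℝ (vectorSpan ℝ F.toPolytope.carrier))
    have h2 := Submodule.finrank_mono h1
    rw [(Submodule.equivMapOfInjective _ U.injective_subtype _).symm.finrank_eq] at h2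
    have h3 := LinearMap.finrank_range_add_finrank_ker f'
    have h4 : Module.finrank ℝ (LinearMap.range f') ≤ 1 :=
      (Submodule.finrank_le _).trans (Module.finrank_self ℝ).le
    change _ + 2 ≤ Module.finrank ℝ U at h
    omega
  obtain ⟨g, hgv, hgW⟩ := Submodule.exists_le_ker_of_notMem hvW
  have hg : ∀ x ∈ F.1, g x = g p := fun x hx => by
    have := hgW (vsub_mem_vectorSpan ℝ hx hp)
    rw [LinearMap.mem_ker, vsub_eq_sub, map_sub] at this
    linarith
  set u := t.filter (· ∉ F.1) with hu
  have hut : ∀ x ∈ u, x ∈ P.carrier := fun x hx =>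
    hP ▸ subset_convexHull ℝ _ (Finset.mem_filter.1 hx).1
  have hpos : ∀ x ∈ u, 0 < f x - f p := fun x hx => by
    by_contra hle
    exact (Finset.mem_filter.1 hx).2 ⟨hut x hx, fun y hy => by
      have := hp.2 y hy
      linarith⟩
  have hune : u.Nonempty := by
    by_contra hemp
    rw [Finset.not_nonempty_iff_eq_empty, hu, Finset.filter_eq_empty_iff] at hemp
    have : P.carrier ⊆ F.1 := by
      rw [hP]
      exact convexHull_min (fun x hx => not_not.1 (hemp hx)) F.2.convex
    have : F.1 = P.carrier := Set.Subset.antisymm F.2.extreme.subset this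
    rw [hW, this] at h
    change Module.finrank ℝ U + 2 ≤ Module.finrank ℝ U at h
    omega
  -- Rotate the supporting hyperplane about `F`: the smallest slope `r` keeps `g - r • f` minimal on
  -- `F` and brings the new generator `x₀` into the face.
  obtain ⟨x₀, hx₀, hmin⟩ := u.exists_min_image (fun x => (g x - g p) / (f x - f p)) hune
  set r := (g x₀ - g p) / (f x₀ - f p) with hr
  have hx₀' : g x₀ - r * f x₀ = g p - r * f p := by
    have := (hpos x₀ hx₀).ne'
    rw [hr]
    field_simp
    ring
  have hge : ∀ y ∈ P.carrier, (g - r • f) p ≤ (g - r • f) y := by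
    intro y hy
    have : convexHull ℝ (t : Set P.V) ⊆ {y | (g - r • f) p ≤ (g - r • f) y} := by
      refine convexHull_min (fun z hz => ?_) (convex_halfSpace_ge (g - r • f).isLinear _)
      simp only [Set.mem_ofPred_eq, LinearMap.sub_apply, LinearMap.smul_apply, smul_eq_mul]
      by_cases hzF : z ∈ F.1
      · rw [hf z hzF, hg z hzF]
      · have hz' : z ∈ u := Finset.mem_filter.2 ⟨hz, hzF⟩
        have := hmin z hz'
        rw [le_div_iff₀ (hpos z hz')] at this
        linarith
    exact this (hP ▸ hy)
  refine ⟨P.minFace (g - r • f), lt_of_le_not_ge (fun x hx => ⟨hx.1, fun y hy => ?_⟩) ?_,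
    lt_top_iff_ne_top.2 ?_⟩
  · have := hge y hy
    simp only [LinearMap.sub_apply, LinearMap.smul_apply, smul_eq_mul] at this ⊢
    rw [hf x hx, hg x hx]
    exact this
  · intro hle
    refine (Finset.mem_filter.1 hx₀).2 (hle ⟨hut x₀ hx₀, fun y hy => ?_⟩)
    have := hge y hy
    simp only [LinearMap.sub_apply, LinearMap.smul_apply, smul_eq_mul] at this ⊢
    linarith
  · intro heq
    -- If the new face were all of `P`, then `g - r • f` would vanish on `U`; at `v` its value is `g
    -- v ≠ 0`.
    have hconst : ∀ x ∈ P.carrier, ∀ y ∈ P.carrier, (g - r • f) x = (g - r • f) y := by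
      have hall : ∀ x ∈ P.carrier, x ∈ (P.minFace (g - r • f)).1 := fun x hx => by
        rw [heq]; exact hx
      exact fun x hx y hy => le_antisymm ((hall x hx).2 y hy) ((hall y hy).2 x hx)
    have hU0 : U ≤ LinearMap.ker (g - r • f) := by
      refine Submodule.span_le.2 ?_
      rintro _ ⟨x, hx, y, hy, rfl⟩
      dsimp only
      rw [SetLike.mem_coe, LinearMap.mem_ker, vsub_eq_sub, map_sub, hconst x hx y hy, sub_self]
    have := hU0 hvU
    rw [LinearMap.mem_ker, LinearMap.sub_apply, LinearMap.smul_apply, hfv, smul_zero,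
      sub_zero] at this
    exact hgv this

/-- A polytope of positive dimension has a proper face. -/
theorem exists_lt_top (h : 0 < P.dim) : ∃ F : P.Face, F < ⊤ := by
  obtain ⟨v, hv, hv0⟩ : ∃ v ∈ vectorSpan ℝ P.carrier, v ≠ 0 :=
    Submodule.exists_mem_ne_zero_of_ne_bot fun hbot => by
      rw [dim, hbot, finrank_bot] at h
      exact lt_irrefl _ h
  obtain ⟨g, hg⟩ : ∃ g : Module.Dual ℝ P.V, g v ≠ 0 := by
    by_contra! hall
    exact hv0 ((Module.forall_dual_apply_eq_zero_iff ℝ v).1 hall)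
  refine ⟨P.minFace g, lt_top_iff_ne_top.2 fun heq => hg ?_⟩
  have hall : ∀ x ∈ P.carrier, x ∈ (P.minFace g).1 := fun x hx => by
    rw [heq]; exact hx
  have hle : vectorSpan ℝ P.carrier ≤ LinearMap.ker g := by
    refine Submodule.span_le.2 ?_
    rintro _ ⟨x, hx, y, hy, rfl⟩
    dsimp only
    rw [SetLike.mem_coe, LinearMap.mem_ker, vsub_eq_sub, map_sub, sub_eq_zero]
    exact le_antisymm ((hall x hx).2 y hy) ((hall y hy).2 x hx)
  exact hle hv

theorem coe_top : (⊤ : P.Face).1 = P.carrier := rfl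

theorem finrank_lt_dim {F : P.Face} (h : F < ⊤) :
    Module.finrank ℝ (vectorSpan ℝ F.1) < P.dim := by
  have := P.finrank_vectorSpan_lt h
  rw [coe_top] at this
  exact this

/-- A polytope of positive dimension has a facet of codimension one. -/
theorem exists_face_finrank_add_one (h : 0 < P.dim) :
    ∃ F : P.Face, F < ⊤ ∧ Module.finrank ℝ (vectorSpan ℝ F.1) + 1 = P.dim := by
  obtain ⟨F₀, hF₀⟩ := P.exists_lt_top h
  rcases eq_top_or_exists_le_coatom F₀ with h0 | ⟨F, hF, -⟩
  · exact absurd h0 hF₀.ne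
  have h1 : Module.finrank ℝ (vectorSpan ℝ F.1) < P.dim := P.finrank_lt_dim hF.lt_top
  rcases (Nat.succ_le_of_lt h1).eq_or_lt with h2 | h2
  · exact ⟨F, hF.lt_top, h2⟩
  · obtain ⟨G, h3, h4⟩ := P.exists_between F h2
    exact absurd (hF.2 G h3) h4.ne

/-- The height of a face in the face poset is its dimension. -/
theorem height_eq_finrank (F : P.Face) :
    Order.height F = Module.finrank ℝ (vectorSpan ℝ F.1) := by
  induction h : Module.finrank ℝ (vectorSpan ℝ F.1) using Nat.strong_induction_on
    generalizing F with
  | _ n ih =>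
    refine le_antisymm (Order.height_le_coe_iff.2 fun G hG => ?_) ?_
    · have hlt := finrank_vectorSpan_lt P hG
      rw [h] at hlt
      rw [ih _ hlt G rfl]
      exact_mod_cast hlt
    · rcases n with _ | n
      · simp
      · obtain ⟨G, hG, hdim⟩ := F.toPolytope.exists_face_finrank_add_one
          (by change 0 < Module.finrank ℝ (vectorSpan ℝ F.1); omega)
        change _ = Module.finrank ℝ (vectorSpan ℝ F.1) at hdim
        set G' := ((faceToPolytopeIso F) G) with hG'
        have hlt : G'.1 < F := lt_of_le_of_ne G'.2 fun heq => hG.ne (by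
          apply (faceToPolytopeIso F).injective
          exact Subtype.ext (heq.trans rfl))
        have hGG : Module.finrank ℝ (vectorSpan ℝ G'.1.1) = n := by
          change Module.finrank ℝ (vectorSpan ℝ G.1) = n
          exact Nat.succ.inj (hdim.trans h)
        have := Order.height_add_one_le hlt
        rw [ih n (Nat.lt_succ_self n) G'.1 hGG] at this
        exact_mod_cast this

/-- The dimension is a combinatorial invariant. -/
theorem CombEquiv.dim_eq {P Q : Polytope} (h : P.CombEquiv Q) : P.dim = Q.dim := by
  obtain ⟨e⟩ := h
  have h1 : Order.height (e ⊤) = Order.height (⊤ : P.Face) := Order.height_orderIso e ⊤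
  rw [e.map_top, height_eq_finrank, height_eq_finrank] at h1
  exact (Nat.cast_injective h1).symm

end Polytope

/-- Invariance of the dimension makes the existential in `HasDim` independent of the chosen
representative. -/
theorem CombType.hasDim_of_iff {P : Polytope} {n : ℕ} : (CombType.of P).HasDim n ↔ P.dim = n := by
  refine ⟨?_, fun h => ⟨P, rfl, h⟩⟩
  rintro ⟨Q, hQ, rfl⟩
  exact (Polytope.CombEquiv.dim_eq (Quotient.exact hQ)).symm

end

noncomputable section

/-! ### Minimisers of a function on a finite set -/

section Argmin

variable {ι κ : Type}

open Classical in
/-- The set of minimisers of `c` on `S`. -/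
def argmin (c : ι → ℝ) (S : Finset ι) : Finset ι := S.filter fun i => ∀ j ∈ S, c i ≤ c j

theorem mem_argmin {c : ι → ℝ} {S : Finset ι} {i : ι} :
    i ∈ argmin c S ↔ i ∈ S ∧ ∀ j ∈ S, c i ≤ c j := by
  classical
  simp [argmin]

theorem argmin_subset (c : ι → ℝ) (S : Finset ι) : argmin c S ⊆ S := fun _ h => (mem_argmin.1 h).1

theorem argmin_nonempty (c : ι → ℝ) {S : Finset ι} (hS : S.Nonempty) : (argmin c S).Nonempty := by
  obtain ⟨i, hi, h⟩ := S.exists_min_image c hS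
  exact ⟨i, mem_argmin.2 ⟨hi, h⟩⟩

theorem argmin_map (c : ι → ℝ) (e : κ ↪ ι) (S : Finset κ) :
    argmin c (S.map e) = (argmin (c ∘ e) S).map e := by
  ext i
  simp only [mem_argmin, Finset.mem_map, Function.comp]
  constructor
  · rintro ⟨⟨k, hk, rfl⟩, h⟩
    exact ⟨k, ⟨hk, fun j hj => h _ ⟨j, hj, rfl⟩⟩, rfl⟩
  · rintro ⟨k, ⟨hk, h⟩, rfl⟩
    refine ⟨⟨k, hk, rfl⟩, ?_⟩
    rintro _ ⟨j, hj, rfl⟩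
    exact h j hj

theorem argmin_add_const (c : ι → ℝ) (K : ℝ) (S : Finset ι) :
    argmin (fun i => c i + K) S = argmin c S := by
  ext i
  simp [mem_argmin]

/-- This allows a member of a building set to be replaced by its trace off `S` when working inside
the facet of `S`. -/
theorem argmin_eq_of_subset {c : ι → ℝ} {S T : Finset ι} (h : T ⊆ S) (hS : argmin c S ⊆ T)
    (hne : S.Nonempty) : argmin c S = argmin c T := by
  obtain ⟨i, hi⟩ := argmin_nonempty c hne
  have hi' := mem_argmin.1 hi
  ext j
  refine ⟨fun hj => mem_argmin.2 ⟨hS hj, fun k hk => (mem_argmin.1 hj).2 k (h hk)⟩, fun hj => ?_⟩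
  have hj' := mem_argmin.1 hj
  exact mem_argmin.2 ⟨h hj'.1, fun k hk => (hj'.2 i (hS hi)).trans (hi'.2 k hk)⟩

end Argmin

/-- Two posets covered by the same set in a compatible way are isomorphic. -/
theorem nonempty_orderIso_of_surjective {C : Type*} {X Y : Type} [PartialOrder X] [PartialOrder Y]
    {p : C → X} {q : C → Y} (hp : p.Surjective) (hq : q.Surjective)
    (h : ∀ a b, p a ≤ p b ↔ q a ≤ q b) : Nonempty (X ≃o Y) := by
  have key : ∀ a b, p a = p b → q a = q b := fun a b hab =>
    le_antisymm ((h a b).1 hab.le) ((h b a).1 hab.ge)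
  have hle : ∀ x y, q (Function.surjInv hp x) ≤ q (Function.surjInv hp y) ↔ x ≤ y := by
    intro x y
    rw [← h, Function.surjInv_eq hp, Function.surjInv_eq hp]
  refine ⟨RelIso.ofSurjective (OrderEmbedding.ofMapLEIff _ hle) ?_⟩
  · intro y
    obtain ⟨a, rfl⟩ := hq y
    exact ⟨p a, key _ _ (Function.surjInv_eq hp _)⟩

namespace BuildingSet

open Polytope

variable {ι : Type} [DecidableEq ι]

theorem union_mem' (B : BuildingSet ι) {S T : Finset ι} (hS : S ∈ B.sets) (hT : T ∈ B.sets) {i : ι}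
    (h1 : i ∈ S) (h2 : i ∈ T) : S ∪ T ∈ B.sets :=
  B.union_mem S hS T hT ⟨i, Finset.mem_inter.2 ⟨h1, h2⟩⟩

variable [Fintype ι]

/-! ### The faces of a nestohedron -/

/-- The simplex with vertex set `S`. -/
def stdSimplex (S : Finset ι) : Set (ι → ℝ) :=
  convexHull ℝ ((fun i : ι => (Pi.single i 1 : ι → ℝ)) '' (S : Set ι))

/-- The simplex with vertex set `S`, as a polytope. -/
def simplexPolytope (S : Finset ι) (hS : S.Nonempty) : Polytope where
  V := ι → ℝ
  carrier := stdSimplex S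
  exists_finset := ⟨S.image fun i : ι => (Pi.single i 1 : ι → ℝ), hS.image _, by
    rw [Finset.coe_image]; rfl⟩

/-- The linear functional with coefficients `c`. -/
def linForm (c : ι → ℝ) : (ι → ℝ) →ₗ[ℝ] ℝ := Fintype.linearCombination ℝ c

@[simp] theorem linForm_single (c : ι → ℝ) (i : ι) : linForm c (Pi.single i 1) = c i := by
  rw [linForm, Fintype.linearCombination_apply_single, one_smul]

theorem exists_linForm_eq (f : (ι → ℝ) →ₗ[ℝ] ℝ) : ∃ c, linForm c = f := by
  refine ⟨fun i => f (Pi.single i 1), LinearMap.pi_ext' fun i => LinearMap.ext_ring ?_⟩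
  simp

theorem single_mem_stdSimplex {S : Finset ι} {i : ι} (h : i ∈ S) :
    (Pi.single i 1 : ι → ℝ) ∈ stdSimplex S :=
  subset_convexHull ℝ _ ⟨i, h, rfl⟩

theorem stdSimplex_mono {S T : Finset ι} (h : S ⊆ T) : stdSimplex S ⊆ stdSimplex T :=
  convexHull_mono (Set.image_mono h)

@[simp] theorem linForm_zero (x : ι → ℝ) : linForm 0 x = 0 := by
  simp [linForm, Fintype.linearCombination_apply]

theorem le_linForm_iff {S : Finset ι} {c : ι → ℝ} {a : ℝ} :
    (∀ y ∈ stdSimplex S, a ≤ linForm c y) ↔ ∀ j ∈ S, a ≤ c j := by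
  constructor
  · intro h j hj
    simpa using h _ (single_mem_stdSimplex hj)
  · intro h y hy
    have : stdSimplex S ⊆ {y | a ≤ linForm c y} := by
      refine convexHull_min ?_ (convex_halfSpace_ge (linForm c).isLinear _)
      rintro _ ⟨j, hj, rfl⟩
      simpa using h j hj
    exact this hy

/-- The minimisers of a linear functional on a simplex. -/
theorem mem_stdSimplex_argmin_iff {S : Finset ι} (hS : S.Nonempty) {c : ι → ℝ} {x : ι → ℝ} :
    x ∈ stdSimplex (argmin c S) ↔
      x ∈ stdSimplex S ∧ ∀ y ∈ stdSimplex S, linForm c x ≤ linForm c y := by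
  set F : Set (ι → ℝ) := {x ∈ stdSimplex S | ∀ y ∈ stdSimplex S, linForm c x ≤ linForm c y} with hFdef
  have hF : (simplexPolytope S hS).IsFace F := ((simplexPolytope S hS).minFace (linForm c)).2
  have h := face_eq_convexHull (S.image fun i : ι => (Pi.single i 1 : ι → ℝ)) (F := F) hF.convex
    (by rw [Finset.coe_image]; exact hF.extreme)
  have h2 : ((S.image fun i : ι => (Pi.single i 1 : ι → ℝ) : Finset (ι → ℝ)) : Set (ι → ℝ)) ∩ F =
      (fun i : ι => (Pi.single i 1 : ι → ℝ)) '' (argmin c S : Set ι) := by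
    ext y
    rw [Finset.coe_image]
    constructor
    · rintro ⟨⟨i, hi, rfl⟩, h⟩
      refine ⟨i, mem_argmin.2 ⟨hi, ?_⟩, rfl⟩
      have := le_linForm_iff.1 h.2
      simpa only [linForm_single] using this
    · rintro ⟨i, hi, rfl⟩
      obtain ⟨hi, hmin⟩ := mem_argmin.1 hi
      refine ⟨⟨i, hi, rfl⟩, single_mem_stdSimplex hi, ?_⟩
      rw [le_linForm_iff]
      simpa only [linForm_single] using hmin
  rw [h2] at h
  exact (Set.ext_iff.1 h x).symm

variable (B : BuildingSet ι)

/-- The underlying set of the nestohedron. -/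
def carrierSet : Set (ι → ℝ) := (nestohedron B).carrier

theorem mem_carrierSet {x : ι → ℝ} : x ∈ B.carrierSet ↔
    ∃ g : Finset ι → ι → ℝ, (∀ S ∈ B.sets, g S ∈ stdSimplex S) ∧ ∑ S ∈ B.sets, g S = x := by
  refine (Set.mem_finsetSum _ _ _).trans ?_
  constructor
  · rintro ⟨g, hg, h⟩
    exact ⟨g, fun S hS => hg hS, h⟩
  · rintro ⟨g, hg, h⟩
    exact ⟨g, fun hS => hg _ hS, h⟩

/-- The face of the nestohedron on which the functional with coefficients `c` is minimal. -/
def face (c : ι → ℝ) : (nestohedron B).Face := (nestohedron B).minFace (linForm c)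

/-- The underlying set of `B.face c`. -/
def faceSet (c : ι → ℝ) : Set (ι → ℝ) := (B.face c).1

theorem mem_faceSet {c x : ι → ℝ} :
    x ∈ B.faceSet c ↔ x ∈ B.carrierSet ∧ ∀ y ∈ B.carrierSet, linForm c x ≤ linForm c y := Iff.rfl

theorem face_le_iff_faceSet {c c' : ι → ℝ} :
    B.face c ≤ B.face c' ↔ B.faceSet c ⊆ B.faceSet c' := Iff.rfl

theorem face_surjective : Function.Surjective B.face := by
  intro F
  obtain ⟨f, rfl⟩ := (nestohedron B).exists_minFace_eq F
  obtain ⟨c, hc⟩ := exists_linForm_eq f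
  exact ⟨c, congrArg _ hc⟩

/-- A sum is minimal only if each summand is: replacing one summand by a better point of its simplex
would lower the total. -/
theorem sum_mem_faceSet_iff {c : ι → ℝ} {g : Finset ι → ι → ℝ}
    (hg : ∀ S ∈ B.sets, g S ∈ stdSimplex S) :
    ∑ S ∈ B.sets, g S ∈ B.faceSet c ↔ ∀ S ∈ B.sets, g S ∈ stdSimplex (argmin c S) := by
  rw [mem_faceSet]
  constructor
  · rintro ⟨-, h⟩ S hS
    rw [mem_stdSimplex_argmin_iff (B.nonempty_of_mem S hS)]
    refine ⟨hg S hS, fun y hy => ?_⟩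
    have h1 := h (∑ T ∈ B.sets, Function.update g S y T) (B.mem_carrierSet.2
      ⟨_, fun T hT => ?_, rfl⟩)
    · rw [← Finset.add_sum_erase _ _ hS, ← Finset.add_sum_erase _ _ hS, Function.update_self,
        map_add, map_add, Finset.sum_congr rfl fun T hT =>
          Function.update_of_ne (Finset.ne_of_mem_erase hT) y g] at h1
      linarith
    · by_cases hTS : T = S
      · subst hTS; simpa using hy
      · rw [Function.update_of_ne hTS]; exact hg T hT
  · intro h
    refine ⟨B.mem_carrierSet.2 ⟨g, hg, rfl⟩, fun y hy => ?_⟩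
    obtain ⟨k, hk, rfl⟩ := B.mem_carrierSet.1 hy
    rw [map_sum, map_sum]
    exact Finset.sum_le_sum fun S hS =>
      ((mem_stdSimplex_argmin_iff (B.nonempty_of_mem S hS)).1 (h S hS)).2 _ (hk S hS)

theorem single_mem_stdSimplex_iff {S : Finset ι} {i : ι} :
    (Pi.single i 1 : ι → ℝ) ∈ stdSimplex S ↔ i ∈ S := by
  refine ⟨fun h => ?_, single_mem_stdSimplex⟩
  by_contra hi
  have := le_linForm_iff (S := S) (c := fun j => if j = i then 0 else 1) (a := 1) |>.2
    (fun j hj => by rw [if_neg (by rintro rfl; exact hi hj)]) _ h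
  rw [linForm_single, if_pos rfl] at this
  linarith

/-- Choosing one minimiser of `c` in every member and adding the unit vectors gives a point of the
smaller face; prescribing the choice `i` at `S` tests whether `i` minimises `c'` there. From here on
faces are handled only through minimiser sets. -/
theorem face_le_iff {c c' : ι → ℝ} :
    B.face c ≤ B.face c' ↔ ∀ S ∈ B.sets, argmin c S ⊆ argmin c' S := by
  rw [face_le_iff_faceSet]
  constructor
  · intro h S hS i hi
    have hex : ∀ T : Finset ι, ∃ j, T ∈ B.sets → j ∈ argmin c T := fun T => by
      by_cases hT : T ∈ B.sets
      · obtain ⟨j, hj⟩ := argmin_nonempty c (B.nonempty_of_mem T hT)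
        exact ⟨j, fun _ => hj⟩
      · exact ⟨i, fun h => absurd h hT⟩
    choose j hj using hex
    set j' := Function.update j S i with hj'
    have hj2 : ∀ T ∈ B.sets, j' T ∈ argmin c T := fun T hT => by
      by_cases hTS : T = S
      · subst hTS; simpa [hj'] using hi
      · rw [hj', Function.update_of_ne hTS]; exact hj T hT
    have hmem : ∀ T ∈ B.sets, (Pi.single (j' T) 1 : ι → ℝ) ∈ stdSimplex T := fun T hT =>
      single_mem_stdSimplex (argmin_subset _ _ (hj2 T hT))
    have h1 := (B.sum_mem_faceSet_iff (c := c) (g := fun T => Pi.single (j' T) 1) hmem).2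
      fun T hT => single_mem_stdSimplex (hj2 T hT)
    have h2 := (B.sum_mem_faceSet_iff hmem).1 (h h1) S hS
    rw [single_mem_stdSimplex_iff] at h2
    simpa [hj'] using h2
  · rintro h x hx
    obtain ⟨g, hg, rfl⟩ := B.mem_carrierSet.1 (B.mem_faceSet.1 hx).1
    rw [B.sum_mem_faceSet_iff hg] at hx ⊢
    exact fun S hS => stdSimplex_mono (h S hS) (hx S hS)

theorem face_zero : B.face 0 = ⊤ := by
  have : B.carrierSet ⊆ B.faceSet 0 := fun x hx => B.mem_faceSet.2 ⟨hx, fun y _ => by simp⟩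
  exact top_le_iff.1 this

/-! ### Vertices -/

/-- If `B.face c` is a vertex, then `c` has a unique minimiser on every member of `B`. -/
theorem argmin_subsingleton {c : ι → ℝ} {v : ι → ℝ} (hv : B.faceSet c = {v}) {S : Finset ι}
    (hS : S ∈ B.sets) {i j : ι} (hi : i ∈ argmin c S) (hj : j ∈ argmin c S) : i = j := by
  have hx : v ∈ B.faceSet c := by rw [hv]; rfl
  obtain ⟨g, hg, rfl⟩ := B.mem_carrierSet.1 (B.mem_faceSet.1 hx).1
  have hmin := (B.sum_mem_faceSet_iff hg).1 hx
  -- Replacing the `S`-summand by the unit vector at `k` stays in the face; as the face is one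
  -- point, cancellation identifies the two summands.
  have key : ∀ k ∈ argmin c S, Pi.single k 1 = g S := by
    intro k hk
    have hg' : ∀ T ∈ B.sets, Function.update g S (Pi.single k 1) T ∈ stdSimplex (argmin c T) := by
      intro T hT
      by_cases hTS : T = S
      · subst hTS; simpa using single_mem_stdSimplex hk
      · rw [Function.update_of_ne hTS]; exact hmin T hT
    have h1 := (B.sum_mem_faceSet_iff
      fun T hT => stdSimplex_mono (argmin_subset _ _) (hg' T hT)).2 hg'
    rw [hv, Set.mem_singleton_iff, ← Finset.add_sum_erase _ _ hS, ← Finset.add_sum_erase _ _ hS,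
      Function.update_self, Finset.sum_congr rfl fun T hT =>
        Function.update_of_ne (Finset.ne_of_mem_erase hT) (Pi.single k 1) g] at h1
    exact add_right_cancel h1
  have h2 := congrFun ((key i hi).trans (key j hj).symm) i
  by_contra hne
  rw [Pi.single_eq_same, Pi.single_eq_of_ne hne] at h2
  exact one_ne_zero h2

/-! ### Facets -/

/-- The indicator function of `S`. -/
def ind (S : Finset ι) : ι → ℝ := fun i => if i ∈ S then 1 else 0

theorem argmin_ind (S T : Finset ι) : argmin (ind S) T = if T ⊆ S then T else T \ S := by
  split_ifs with h
  · refine Finset.Subset.antisymm (argmin_subset _ _) fun i hi => mem_argmin.2 ⟨hi, fun j hj => ?_⟩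
    simp [ind, h hi, h hj]
  · obtain ⟨k, hkT, hkS⟩ := Finset.not_subset.1 h
    ext i
    rw [mem_argmin, Finset.mem_sdiff]
    refine and_congr_right fun hi => ⟨fun hmin hiS => ?_, fun hiS j _ => ?_⟩
    · have := hmin k hkT
      simp only [ind, if_pos hiS, if_neg hkS] at this
      linarith
    · simp only [ind, if_neg hiS]
      split_ifs <;> norm_num

/-- On subsets of `S` the indicator is constant and imposes nothing; on every other member its
minimum is taken exactly off `S`. -/
theorem face_le_face_ind_iff {c : ι → ℝ} {S : Finset ι} :
    B.face c ≤ B.face (ind S) ↔ ∀ T ∈ B.sets, ¬ T ⊆ S → argmin c T ⊆ T \ S := by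
  rw [face_le_iff]
  refine forall₂_congr fun T _ => ?_
  rw [argmin_ind]
  split_ifs with h
  · simp [h, argmin_subset]
  · simp [h]

end BuildingSet
end

/-! ### Facets as proper members of the building set, and their product structure -/

noncomputable section

namespace BuildingSet

open Polytope

variable {ι : Type} [DecidableEq ι] [Fintype ι] (B : BuildingSet ι)

/-- The full simplex is one of the summands and already detects every nonconstant functional. -/
theorem face_eq_top_iff (hB : Finset.univ ∈ B.sets) {c : ι → ℝ} :
    B.face c = ⊤ ↔ ∀ i j, c i = c j := by
  rw [← top_le_iff, ← B.face_zero, face_le_iff]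
  constructor
  · intro h i j
    have h1 : ∀ i, i ∈ argmin c Finset.univ := fun i =>
      h _ hB (mem_argmin.2 ⟨Finset.mem_univ i, fun _ _ => le_rfl⟩)
    exact le_antisymm ((mem_argmin.1 (h1 i)).2 j (Finset.mem_univ _))
      ((mem_argmin.1 (h1 j)).2 i (Finset.mem_univ _))
  · intro h S _ i hi
    exact mem_argmin.2 ⟨argmin_subset _ _ hi, fun j _ => (h i j).le⟩

theorem face_ind_ne_top (hB : Finset.univ ∈ B.sets) {S : Finset ι}
    (hS : S.Nonempty) (hSu : S ≠ Finset.univ) : B.face (ind S) ≠ ⊤ := by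
  rw [Ne, B.face_eq_top_iff hB]
  intro h
  obtain ⟨i, hi⟩ := hS
  obtain ⟨j, hj⟩ : ∃ j, j ∉ S := by
    by_contra! hall
    exact hSu (Finset.eq_univ_iff_forall.2 hall)
  have := h i j
  simp [ind, hi, hj] at this

/-- If the face of `c` contains that of `ind S`, the summand of `S` forces `c` to be constant on
`S`, and the full simplex forces `c` to be minimal at all points off `S`. So `c` is a constant plus
a nonnegative multiple of `ind S`: multiple zero gives the whole polytope, a positive one the same
face. -/
theorem isCoatom_face_ind (hB : Finset.univ ∈ B.sets) {S : Finset ι} (hS : S ∈ B.sets)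
    (hSu : S ≠ Finset.univ) : IsCoatom (B.face (ind S)) := by
  refine ⟨B.face_ind_ne_top hB (B.nonempty_of_mem S hS) hSu, fun F hlt => ?_⟩
  obtain ⟨c, rfl⟩ := B.face_surjective F
  have hle := B.face_le_iff.1 hlt.le
  rw [B.face_eq_top_iff hB]
  have h1 : ∀ i ∈ S, ∀ j ∈ S, c i ≤ c j := fun i hi j hj => by
    have := hle S hS
    rw [argmin_ind, if_pos subset_rfl] at this
    exact (mem_argmin.1 (this hi)).2 j hj
  have h2 : ∀ i ∉ S, ∀ j, c i ≤ c j := fun i hi j => by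
    have := hle _ hB
    rw [argmin_ind, if_neg fun h => hSu (Finset.univ_subset_iff.1 h)] at this
    exact (mem_argmin.1 (this (Finset.mem_sdiff.2 ⟨Finset.mem_univ _, hi⟩))).2 j
      (Finset.mem_univ _)
  by_contra hne
  -- otherwise `c` is strictly larger on `S`
  have h3 : ∀ i ∈ S, ∀ j ∉ S, c j < c i := by
    intro i hi j hj
    by_contra hcon
    refine hne fun k l => ?_
    have key : ∀ m, c m = c j := fun m => by
      by_cases hm : m ∈ S
      · exact le_antisymm ((h1 m hm i hi).trans (not_lt.1 hcon)) (h2 j hj m)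
      · exact le_antisymm (h2 m hm j) (h2 j hj m)
    rw [key k, key l]
  refine hlt.not_ge (B.face_le_face_ind_iff.2 fun T hT hTS i hi => ?_)
  obtain ⟨hiT, hmin⟩ := mem_argmin.1 hi
  obtain ⟨k, hkT, hkS⟩ := Finset.not_subset.1 hTS
  exact Finset.mem_sdiff.2 ⟨hiT, fun hiS => (hmin k hkT).not_gt (h3 i hiS k hkS)⟩

/-- Every proper face is contained in a facet of the form `B.face (ind S)`. -/
theorem exists_face_le_face_ind (hB : Finset.univ ∈ B.sets) {c : ι → ℝ} (hc : B.face c ≠ ⊤) :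
    ∃ S ∈ B.sets, S ≠ Finset.univ ∧ B.face c ≤ B.face (ind S) := by
  classical
  rw [Ne, B.face_eq_top_iff hB] at hc
  push Not at hc
  obtain ⟨i₀, j₀, hij⟩ := hc
  obtain ⟨m, -, hm⟩ := Finset.exists_max_image Finset.univ c ⟨i₀, Finset.mem_univ _⟩
  set M := Finset.univ.filter fun i => c i = c m with hM
  -- `S` is a largest member inside the set `M` where `c` is maximal. If a member `T` had its
  -- minimum at a point of `S`, all of `T` would lie in `M`, and `S ∪ T` would contradict maximality
  -- unless `T ⊆ S`.
  obtain ⟨S, hS, hmax⟩ := (B.sets.filter (· ⊆ M)).exists_max_image Finset.card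
    ⟨{m}, Finset.mem_filter.2 ⟨B.singleton_mem m, by simp [hM]⟩⟩
  obtain ⟨hSB, hSM⟩ := Finset.mem_filter.1 hS
  refine ⟨S, hSB, ?_, B.face_le_face_ind_iff.2 fun T hT hTS i hi => ?_⟩
  · rintro rfl
    have h1 := (Finset.mem_filter.1 (hSM (Finset.mem_univ i₀))).2
    have h2 := (Finset.mem_filter.1 (hSM (Finset.mem_univ j₀))).2
    exact hij (h1.trans h2.symm)
  · obtain ⟨hiT, hmin⟩ := mem_argmin.1 hi
    refine Finset.mem_sdiff.2 ⟨hiT, fun hiS => hTS ?_⟩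
    have hTM : T ⊆ M := fun k hk => Finset.mem_filter.2 ⟨Finset.mem_univ _,
      le_antisymm (hm k (Finset.mem_univ _)) ((Finset.mem_filter.1 (hSM hiS)).2 ▸ hmin k hk)⟩
    have h1 := hmax (S ∪ T) (Finset.mem_filter.2
      ⟨B.union_mem' hSB hT hiS hiT, Finset.union_subset hSM hTM⟩)
    have h2 := Finset.eq_of_subset_of_card_le Finset.subset_union_left h1
    rw [h2]
    exact Finset.subset_union_right

/-- The minimisers of `ind S` on the full set form the complement of `S`, so the face determines
`S`. -/
theorem face_ind_injective (hB : Finset.univ ∈ B.sets) {S T : Finset ι}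
    (hSu : S ≠ Finset.univ) (hTu : T ≠ Finset.univ) (h : B.face (ind S) = B.face (ind T)) :
    S = T := by
  have key : ∀ {S T : Finset ι}, S ≠ Finset.univ → T ≠ Finset.univ →
      B.face (ind S) ≤ B.face (ind T) → T ⊆ S := by
    intro S T hSu hTu h i hi
    have := B.face_le_iff.1 h _ hB
    rw [argmin_ind, argmin_ind, if_neg fun h => hSu (Finset.univ_subset_iff.1 h),
      if_neg fun h => hTu (Finset.univ_subset_iff.1 h)] at this
    by_contra hiS
    exact (Finset.mem_sdiff.1 (this (Finset.mem_sdiff.2 ⟨Finset.mem_univ i, hiS⟩))).2 hi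
  exact Finset.Subset.antisymm (key hTu hSu h.ge) (key hSu hTu h.le)

/-- The facets of the nestohedron correspond to the proper members of the building set. -/
def facetEquiv (hB : Finset.univ ∈ B.sets) :
    {S // S ∈ B.sets.erase Finset.univ} ≃ (nestohedron B).Facet :=
  Equiv.ofBijective
    (fun S => ⟨B.face (ind S.1), B.isCoatom_face_ind hB (Finset.mem_of_mem_erase S.2)
      (Finset.ne_of_mem_erase S.2)⟩) <| by
    constructor
    · intro S T h
      exact Subtype.ext (B.face_ind_injective hB
        (Finset.ne_of_mem_erase S.2)
        (Finset.ne_of_mem_erase T.2) (congrArg Subtype.val h))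
    · rintro ⟨F, hF⟩
      obtain ⟨c, rfl⟩ := B.face_surjective F
      obtain ⟨S, hS, hSu, hle⟩ := B.exists_face_le_face_ind hB hF.1
      refine ⟨⟨S, Finset.mem_erase.2 ⟨hSu, hS⟩⟩, Subtype.ext ?_⟩
      rcases hle.eq_or_lt with h | h
      · exact h.symm
      · exact absurd (hF.2 _ h) (B.isCoatom_face_ind hB hS hSu).1

theorem facetSum_nestohedron (hB : Finset.univ ∈ B.sets) :
    PolytopeRing.facetSum (nestohedron B) = ∑ S ∈ B.sets.erase Finset.univ,
      PolytopeRing.gen (CombType.of (B.face (ind S)).toPolytope) := by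
  rw [PolytopeRing.facetSum, ← Finset.sum_coe_sort (B.sets.erase Finset.univ)]
  exact (Fintype.sum_equiv (B.facetEquiv hB)
    (fun S => PolytopeRing.gen (CombType.of (B.face (ind S.1)).toPolytope))
    (fun F => PolytopeRing.gen (CombType.of F.1.toPolytope)) fun S => rfl).symm

theorem card_facet (hB : Finset.univ ∈ B.sets) :
    Nat.card (nestohedron B).Facet = B.sets.card - 1 := by
  rw [← Nat.card_congr (B.facetEquiv hB), Nat.card_eq_fintype_card, Fintype.card_coe,
    Finset.card_erase_of_mem hB]

/-- The facet given by `S` is the product of the nestohedra of the restriction to `S` and of the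
contraction by `S`. -/
theorem of_face_ind {ι₁ ι₂ : Type} [DecidableEq ι₁] [Fintype ι₁] [DecidableEq ι₂] [Fintype ι₂]
    (B₁ : BuildingSet ι₁) (B₂ : BuildingSet ι₂) {S : Finset ι} (e₁ : ι₁ ↪ ι) (e₂ : ι₂ ↪ ι)
    (hr₁ : ∀ i, i ∈ S ↔ ∃ k, e₁ k = i) (hr₂ : ∀ i, i ∉ S ↔ ∃ k, e₂ k = i)
    (h₁ : ∀ T, T ∈ B₁.sets ↔ T.map e₁ ∈ B.sets)
    (h₂ : ∀ U ∈ B₂.sets, ∃ T ∈ B.sets, T \ S = U.map e₂)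
    (h₃ : ∀ U : Finset ι₂, U.Nonempty → ∀ T ∈ B.sets, T \ S = U.map e₂ → U ∈ B₂.sets) :
    CombType.of (B.face (ind S)).toPolytope =
      CombType.of (nestohedron B₁) * CombType.of (nestohedron B₂) := by
  classical
  set F := B.face (ind S) with hF
  -- The functionals whose face lies in `F` cover both posets: `p` takes the face itself, `q` the
  -- pair of faces given by restricting `c` to `S` and to its complement.
  let C := {c : ι → ℝ // B.face c ≤ F}
  let p : C → Set.Iic F := fun c => ⟨B.face c.1, c.2⟩
  let q : C → (nestohedron B₁).Face × (nestohedron B₂).Face := fun c =>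
    (B₁.face (c.1 ∘ e₁), B₂.face (c.1 ∘ e₂))
  have hdisj : ∀ k l, e₁ k ≠ e₂ l := fun k l h =>
    (hr₂ (e₂ l)).2 ⟨l, rfl⟩ (h ▸ (hr₁ (e₁ k)).2 ⟨k, rfl⟩)
  have hp : p.Surjective := by
    rintro ⟨G, hG⟩
    obtain ⟨c, rfl⟩ := B.face_surjective G
    exact ⟨⟨c, hG⟩, rfl⟩
  have hq : q.Surjective := by
    rintro ⟨G₁, G₂⟩
    obtain ⟨c₁, rfl⟩ := B₁.face_surjective G₁
    obtain ⟨c₂, rfl⟩ := B₂.face_surjective G₂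
    -- A shift so large that every value on `S` exceeds every value off `S`. This places the glued
    -- functional in the facet of `S`, and adding a constant leaves the face of `c₁` unchanged.
    set K : ℝ := ∑ i, |c₁ i| + ∑ i, |c₂ i| + 1 with hK
    have hlt : ∀ k l, c₂ l < c₁ k + K := by
      intro k l
      have h1 := Finset.single_le_sum (f := fun i => |c₁ i|) (fun i _ => abs_nonneg _)
        (Finset.mem_univ k)
      have h2 := Finset.single_le_sum (f := fun i => |c₂ i|) (fun i _ => abs_nonneg _)
        (Finset.mem_univ l)
      have h3 := neg_abs_le (c₁ k)
      have h4 := le_abs_self (c₂ l)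
      linarith
    let e : ι₁ ⊕ ι₂ ≃ ι := Equiv.ofBijective (Sum.elim e₁ e₂) <| by
      refine ⟨Function.Injective.sumElim e₁.injective e₂.injective hdisj, fun i => ?_⟩
      by_cases hi : i ∈ S
      · obtain ⟨k, rfl⟩ := (hr₁ i).1 hi
        exact ⟨Sum.inl k, rfl⟩
      · obtain ⟨k, rfl⟩ := (hr₂ i).1 hi
        exact ⟨Sum.inr k, rfl⟩
    set c : ι → ℝ := Sum.elim (fun i => c₁ i + K) c₂ ∘ e.symm with hc
    have hc1 : ∀ k, c (e₁ k) = c₁ k + K := fun k => by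
      have : e.symm (e₁ k) = Sum.inl k := (Equiv.symm_apply_eq e).2 rfl
      rw [hc, Function.comp_apply, this, Sum.elim_inl]
    have hc2 : ∀ k, c (e₂ k) = c₂ k := fun k => by
      have : e.symm (e₂ k) = Sum.inr k := (Equiv.symm_apply_eq e).2 rfl
      rw [hc, Function.comp_apply, this, Sum.elim_inr]
    refine ⟨⟨c, B.face_le_face_ind_iff.2 fun T hT hTS i hi => ?_⟩, Prod.ext ?_ ?_⟩
    · obtain ⟨hiT, hmin⟩ := mem_argmin.1 hi
      refine Finset.mem_sdiff.2 ⟨hiT, fun hiS => ?_⟩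
      obtain ⟨k, rfl⟩ := (hr₁ i).1 hiS
      obtain ⟨j, hjT, hjS⟩ := Finset.not_subset.1 hTS
      obtain ⟨l, rfl⟩ := (hr₂ j).1 hjS
      have := hmin _ hjT
      rw [hc1, hc2] at this
      exact this.not_gt (hlt k l)
    · have h1 : c ∘ e₁ = fun i => c₁ i + K := funext hc1
      change B₁.face (c ∘ e₁) = _
      rw [h1]
      apply le_antisymm <;> rw [face_le_iff] <;> intro T _ <;> rw [argmin_add_const]
    · have h1 : c ∘ e₂ = c₂ := funext hc2
      change B₂.face (c ∘ e₂) = _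
      rw [h1]
  have hsub₁ : ∀ T, T ⊆ S → ∃ T₁ : Finset ι₁, T = T₁.map e₁ := by
    intro T hT
    refine ⟨Finset.univ.filter fun k => e₁ k ∈ T, ?_⟩
    ext i
    simp only [Finset.mem_map, Finset.mem_filter, Finset.mem_univ, true_and]
    constructor
    · intro hi
      obtain ⟨k, rfl⟩ := (hr₁ i).1 (hT hi)
      exact ⟨k, hi, rfl⟩
    · rintro ⟨k, hk, rfl⟩
      exact hk
  have hsub₂ : ∀ T, ∃ U : Finset ι₂, T \ S = U.map e₂ := by
    intro T
    refine ⟨Finset.univ.filter fun k => e₂ k ∈ T, ?_⟩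
    ext i
    simp only [Finset.mem_map, Finset.mem_filter, Finset.mem_univ, true_and, Finset.mem_sdiff]
    constructor
    · rintro ⟨hi, hiS⟩
      obtain ⟨k, rfl⟩ := (hr₂ i).1 hiS
      exact ⟨k, hi, rfl⟩
    · rintro ⟨k, hk, rfl⟩
      exact ⟨hk, (hr₂ _).2 ⟨k, rfl⟩⟩
  have hmapS : ∀ T₁ : Finset ι₁, T₁.map e₁ ⊆ S := by
    intro T₁ i hi
    obtain ⟨k, -, rfl⟩ := Finset.mem_map.1 hi
    exact (hr₁ _).2 ⟨k, rfl⟩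
  -- Inside the facet, a member not contained in `S` matters only through its trace off `S`. This is
  -- why the contraction appears as the second factor.
  have hsd : ∀ c : C, ∀ T ∈ B.sets, ¬ T ⊆ S → argmin c.1 T = argmin c.1 (T \ S) :=
    fun c T hT hTS => argmin_eq_of_subset Finset.sdiff_subset
      (B.face_le_face_ind_iff.1 c.2 T hT hTS) (B.nonempty_of_mem T hT)
  have hpq : ∀ a b, p a ≤ p b ↔ q a ≤ q b := by
    intro a b
    change B.face a.1 ≤ B.face b.1 ↔
      B₁.face (a.1 ∘ e₁) ≤ B₁.face (b.1 ∘ e₁) ∧ B₂.face (a.1 ∘ e₂) ≤ B₂.face (b.1 ∘ e₂)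
    rw [face_le_iff, face_le_iff, face_le_iff]
    constructor
    · intro h
      refine ⟨fun T₁ hT₁ => ?_, fun U hU => ?_⟩
      · have := h _ ((h₁ T₁).1 hT₁)
        rwa [argmin_map, argmin_map, Finset.map_subset_map] at this
      · obtain ⟨T, hT, hTU⟩ := h₂ U hU
        have hTS : ¬ T ⊆ S := fun hTS => by
          rw [Finset.sdiff_eq_empty_iff_subset.2 hTS, eq_comm, Finset.map_eq_empty] at hTU
          exact (B₂.nonempty_of_mem U hU).ne_empty hTU
        have := h T hT
        rwa [hsd a T hT hTS, hsd b T hT hTS, hTU, argmin_map, argmin_map,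
          Finset.map_subset_map] at this
    · rintro ⟨ha, hb⟩ T hT
      by_cases hTS : T ⊆ S
      · obtain ⟨T₁, rfl⟩ := hsub₁ T hTS
        rw [argmin_map, argmin_map, Finset.map_subset_map]
        exact ha T₁ ((h₁ T₁).2 hT)
      · obtain ⟨U, hU⟩ := hsub₂ T
        have hUne : U.Nonempty := by
          rw [← Finset.map_nonempty (f := e₂), ← hU, Finset.sdiff_nonempty]
          exact hTS
        rw [hsd a T hT hTS, hsd b T hT hTS, hU, argmin_map, argmin_map, Finset.map_subset_map]
        exact hb U (h₃ U hUne T hT hU)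
  obtain ⟨φ⟩ := nonempty_orderIso_of_surjective hp hq hpq
  exact Quotient.sound ⟨(faceToPolytopeIso F).trans (φ.trans (faceProdIso _ _).symm)⟩

/-! ### Dimension and simplicity -/

/-- Every simplex lies in the hyperplane of coordinate sum one. Conversely, varying only the vertex
chosen in the full simplex produces all differences of unit vectors. -/
theorem vectorSpan_carrierSet (hB : Finset.univ ∈ B.sets) [Nonempty ι] :
    vectorSpan ℝ B.carrierSet = LinearMap.ker (linForm (1 : ι → ℝ)) := by
  apply le_antisymm
  · refine Submodule.span_le.2 ?_
    rintro _ ⟨x, hx, y, hy, rfl⟩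
    obtain ⟨g, hg, rfl⟩ := B.mem_carrierSet.1 hx
    obtain ⟨k, hk, rfl⟩ := B.mem_carrierSet.1 hy
    dsimp only
    rw [SetLike.mem_coe, LinearMap.mem_ker, vsub_eq_sub, map_sub, sub_eq_zero, map_sum, map_sum]
    have key : ∀ S : Finset ι, ∀ x ∈ stdSimplex S, linForm (1 : ι → ℝ) x = 1 := by
      intro S x hx
      have : stdSimplex S ⊆ {y | linForm (1 : ι → ℝ) y = 1} := by
        refine convexHull_min ?_ (convex_hyperplane (linForm (1 : ι → ℝ)).isLinear _)
        rintro _ ⟨j, hj, rfl⟩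
        simp
      exact this hx
    exact Finset.sum_congr rfl fun S hS => by rw [key S _ (hg S hS), key S _ (hk S hS)]
  · intro x hx
    obtain ⟨i₀⟩ := ‹Nonempty ι›
    have hdiff : ∀ i, (Pi.single i 1 - Pi.single i₀ 1 : ι → ℝ) ∈ vectorSpan ℝ B.carrierSet := by
      intro i
      have hex : ∀ T : Finset ι, ∃ j, T ∈ B.sets → j ∈ T := fun T => by
        by_cases hT : T ∈ B.sets
        · obtain ⟨j, hj⟩ := B.nonempty_of_mem T hT
          exact ⟨j, fun _ => hj⟩
        · exact ⟨i, fun h => absurd h hT⟩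
      choose j hj using hex
      have hmem : ∀ k : ι, ((Pi.single k 1 : ι → ℝ) + ∑ T ∈ B.sets.erase Finset.univ,
          Pi.single (j T) 1) ∈ B.carrierSet := by
        intro k
        refine B.mem_carrierSet.2 ⟨Function.update (fun T => Pi.single (j T) 1) Finset.univ
          (Pi.single k 1), fun T hT => ?_, ?_⟩
        · by_cases hTu : T = Finset.univ
          · subst hTu; simpa using single_mem_stdSimplex (Finset.mem_univ k)
          · rw [Function.update_of_ne hTu]; exact single_mem_stdSimplex (hj T hT)
        · rw [← Finset.add_sum_erase _ _ hB, Function.update_self,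
            Finset.sum_congr rfl fun T hT =>
              Function.update_of_ne (Finset.ne_of_mem_erase hT) (Pi.single k 1)
                (fun T => Pi.single (j T) 1)]
      have := vsub_mem_vectorSpan ℝ (hmem i) (hmem i₀)
      rwa [vsub_eq_sub, add_sub_add_right_eq_sub] at this
    have hx0 : ∑ i, x i = 0 := by
      have : linForm (1 : ι → ℝ) x = ∑ i, x i := by
        simp [linForm, Fintype.linearCombination_apply]
      rw [← this]; exact hx
    have hxs : x = ∑ i, x i • (Pi.single i 1 - Pi.single i₀ 1 : ι → ℝ) := by
      simp only [smul_sub, Finset.sum_sub_distrib]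
      rw [← Finset.sum_smul, hx0, zero_smul, sub_zero]
      exact pi_eq_sum_univ' x
    rw [hxs]
    exact Submodule.sum_mem _ fun i _ => Submodule.smul_mem _ _ (hdiff i)

theorem dim_nestohedron (hB : Finset.univ ∈ B.sets) :
    (nestohedron B).dim + 1 = Fintype.card ι := by
  obtain ⟨i, -⟩ := B.nonempty_of_mem _ hB
  have : Nonempty ι := ⟨i⟩
  change Module.finrank ℝ (vectorSpan ℝ B.carrierSet) + 1 = _
  rw [B.vectorSpan_carrierSet hB]
  have hne : linForm (1 : ι → ℝ) ≠ 0 := fun h => by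
    have := linForm_single (1 : ι → ℝ) i
    rw [h] at this
    simp at this
  rw [← Module.finrank_fintype_fun_eq_card ℝ]
  exact Module.Dual.finrank_ker_add_one_of_ne_zero hne

/-- At a vertex `c` has exactly one minimiser on every member. Sending a member whose face contains
the vertex to its minimiser is a bijection onto `ι`. Discarding the full set, whose face is the
whole polytope, leaves as many facets as the dimension. -/
theorem isSimple_nestohedron (hB : Finset.univ ∈ B.sets) : (nestohedron B).IsSimple := by
  classical
  intro v hv
  have hF : (nestohedron B).IsFace {v} :=
    ⟨Set.singleton_nonempty v, convex_singleton v, isExtreme_singleton.2 hv⟩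
  obtain ⟨c, hc⟩ := B.face_surjective ⟨{v}, hF⟩
  have hcv : B.faceSet c = {v} := congrArg Subtype.val hc
  have huniq := fun S hS i j => B.argmin_subsingleton hcv (S := S) hS (i := i) (j := j)
  -- the members of `B` whose face contains `v`
  let N := B.sets.filter fun S => B.face c ≤ B.face (ind S)
  have huN : Finset.univ ∈ N := Finset.mem_filter.2 ⟨hB, B.face_le_face_ind_iff.2
    fun T _ h => absurd (Finset.subset_univ T) h⟩
  have hmN : ∀ {S}, S ∈ N → ∀ T ∈ B.sets, ∀ i ∈ argmin c T, i ∈ S → T ⊆ S := by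
    intro S hS T hT i hi hiS
    by_contra hTS
    exact (Finset.mem_sdiff.1
      (B.face_le_face_ind_iff.1 (Finset.mem_filter.1 hS).2 T hT hTS hi)).2 hiS
  have hcard : N.card = Fintype.card ι := by
    have hex : ∀ S : N, ∃ i, i ∈ argmin c S.1 := fun S =>
      argmin_nonempty c (B.nonempty_of_mem _ (Finset.mem_filter.1 S.2).1)
    choose m hm using hex
    rw [← Fintype.card_coe]
    refine Fintype.card_congr (Equiv.ofBijective m ⟨fun S T h => ?_, fun i => ?_⟩)
    · have key : ∀ S T : N, m S = m T → T.1 ⊆ S.1 := fun S T h =>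
        hmN S.2 T.1 (Finset.mem_filter.1 T.2).1 _ (hm T) (h ▸ argmin_subset _ _ (hm S))
      exact Subtype.ext (Finset.Subset.antisymm (key T S h.symm) (key S T h))
    -- The preimage of `i` is the largest member on which `i` is minimal. If some `T` had a
    -- minimiser in `S`, then `i` would be minimal on `S ∪ T` as well, forcing `T ⊆ S`.
    · obtain ⟨S, hS, hmax⟩ := (B.sets.filter (i ∈ argmin c ·)).exists_max_image Finset.card
        ⟨{i}, Finset.mem_filter.2 ⟨B.singleton_mem i, mem_argmin.2
          ⟨Finset.mem_singleton_self i, fun j hj => by rw [Finset.mem_singleton.1 hj]⟩⟩⟩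
      obtain ⟨hSB, hi⟩ := Finset.mem_filter.1 hS
      obtain ⟨hiS, hmin⟩ := mem_argmin.1 hi
      have hSN : S ∈ N := by
        refine Finset.mem_filter.2 ⟨hSB, B.face_le_face_ind_iff.2 fun T hT hTS j hj => ?_⟩
        obtain ⟨hjT, hjmin⟩ := mem_argmin.1 hj
        refine Finset.mem_sdiff.2 ⟨hjT, fun hjS => hTS ?_⟩
        have h1 := hmax (S ∪ T) (Finset.mem_filter.2 ⟨B.union_mem' hSB hT hjS hjT, mem_argmin.2
          ⟨Finset.mem_union_left _ hiS, fun k hk => ?_⟩⟩)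
        · rw [Finset.eq_of_subset_of_card_le Finset.subset_union_left h1]
          exact Finset.subset_union_right
        · rcases Finset.mem_union.1 hk with hk | hk
          · exact hmin k hk
          · exact (hmin j hjS).trans (hjmin k hk)
      exact ⟨⟨S, hSN⟩, huniq S hSB _ _ (hm ⟨S, hSN⟩) hi⟩
  have hmem : ∀ S : {S // S ∈ B.sets.erase Finset.univ},
      v ∈ (B.facetEquiv hB S).1.1 ↔ S.1 ∈ N := by
    intro S
    have h1 : v ∈ B.faceSet (ind S.1) ↔ B.faceSet c ⊆ B.faceSet (ind S.1) := by
      rw [hcv]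
      exact Set.singleton_subset_iff.symm
    refine h1.trans ⟨fun h => Finset.mem_filter.2 ⟨Finset.mem_of_mem_erase S.2, h⟩,
      fun h => (Finset.mem_filter.1 h).2⟩
  have e : {S // S ∈ N.erase Finset.univ} ≃ {F : (nestohedron B).Facet // v ∈ F.1.1} := by
    refine Equiv.trans ?_ ((B.facetEquiv hB).subtypeEquiv fun S => (hmem S).symm)
    exact
      { toFun := fun S => ⟨⟨S.1, Finset.mem_erase.2 ⟨Finset.ne_of_mem_erase S.2,
          (Finset.mem_filter.1 (Finset.mem_of_mem_erase S.2)).1⟩⟩, Finset.mem_of_mem_erase S.2⟩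
        invFun := fun S => ⟨S.1.1, Finset.mem_erase.2 ⟨Finset.ne_of_mem_erase S.1.2, S.2⟩⟩
        left_inv := fun _ => rfl
        right_inv := fun _ => rfl }
  have hd := B.dim_nestohedron hB
  rw [← Nat.card_congr e, Nat.card_eq_fintype_card, Fintype.card_coe,
    Finset.card_erase_of_mem huN, hcard]
  omega

/-- If `S ∪ T ∈ B` and neither of `S`, `T` contains the other, then their facets are disjoint. -/
theorem not_le_face_ind_of_union_mem {S T : Finset ι} (hST : S ∪ T ∈ B.sets) (h1 : ¬ S ⊆ T)
    (h2 : ¬ T ⊆ S) (F : (nestohedron B).Face) (hFS : F ≤ B.face (ind S)) :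
    ¬ F ≤ B.face (ind T) := by
  intro hFT
  obtain ⟨c, rfl⟩ := B.face_surjective F
  -- A minimiser on `S ∪ T` would have to avoid both `S` and `T`.
  obtain ⟨i, hi⟩ := argmin_nonempty c (B.nonempty_of_mem _ hST)
  have h3 := B.face_le_face_ind_iff.1 hFS _ hST
    (fun h => h2 (Finset.subset_union_right.trans h)) hi
  have h4 := B.face_le_face_ind_iff.1 hFT _ hST
    (fun h => h1 (Finset.subset_union_left.trans h)) hi
  rw [Finset.mem_sdiff, Finset.mem_union] at h3 h4
  tauto

end BuildingSet
end

/-! ### Indecomposable types and products of polytopes -/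

noncomputable section

open Polytope

namespace CombType

theorem of_eq_one_iff {P : Polytope} : of P = 1 ↔ Subsingleton P.Face := by
  constructor
  · intro h
    obtain ⟨e⟩ : P.CombEquiv point := Quotient.exact h
    exact e.toEquiv.subsingleton
  · intro h
    have : Unique P.Face := ⟨⟨⊤⟩, fun _ => Subsingleton.elim _ _⟩
    exact Quotient.sound ⟨OrderIso.ofUnique _ _⟩

/-- `c` is not a product of two nontrivial combinatorial types. -/
def Indecomposable (c : CombType) : Prop := ∀ a b, c = a * b → a = 1 ∨ b = 1

/-- In any product expression one factor is trivial and can be dropped, so unique factorisation is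
not needed. -/
theorem mem_of_mem_closure {D : Set CombType} {c : CombType} (hc : c ∈ Submonoid.closure D)
    (h1 : c ≠ 1) (hi : c.Indecomposable) : c ∈ D := by
  revert h1 hi
  refine Submonoid.closure_induction (motive := fun c _ => c ≠ 1 → c.Indecomposable → c ∈ D)
    (fun x hx _ _ => hx) (fun h => absurd rfl h) ?_ hc
  intro x y _ _ hx hy h1 hi
  rcases hi x y rfl with rfl | rfl
  · rw [one_mul] at h1 hi ⊢
    exact hy h1 hi
  · rw [mul_one] at h1 hi ⊢
    exact hx h1 hi

end CombType

theorem Prod.isCoatom_mk_iff {α β : Type*} [PartialOrder α] [PartialOrder β] [OrderTop α]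
    [OrderTop β] {a : α} {b : β} :
    IsCoatom (a, b) ↔ IsCoatom a ∧ b = ⊤ ∨ IsCoatom b ∧ a = ⊤ := by
  rw [← covBy_top_iff, ← covBy_top_iff, ← covBy_top_iff]
  exact Prod.mk_covBy_mk_iff

/-! ### The Leibniz rule and coefficients in the ring of a family -/

namespace PolytopeRing

theorem gen_mul (a b : CombType) : gen (a * b) = gen a * gen b := by
  rw [gen, gen, gen, MonoidAlgebra.single_mul_single, one_mul]

/-- The facets of a product. -/
def facetProdEquiv (P Q : Polytope) : P.Facet ⊕ Q.Facet ≃ (P.prod Q).Facet :=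
  Equiv.ofBijective
    (Sum.elim
      (fun F => ⟨(faceProdIso P Q).symm (F.1, ⊤), by
        rw [OrderIso.isCoatom_iff, Prod.isCoatom_mk_iff]; exact Or.inl ⟨F.2, rfl⟩⟩)
      (fun F => ⟨(faceProdIso P Q).symm (⊤, F.1), by
        rw [OrderIso.isCoatom_iff, Prod.isCoatom_mk_iff]; exact Or.inr ⟨F.2, rfl⟩⟩)) <| by
    constructor
    · rintro (F | F) (G | G) h
      all_goals
        have h' := (faceProdIso P Q).symm.injective (congrArg Subtype.val h)
        rw [Prod.mk.injEq] at h'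
      · exact congrArg Sum.inl (Subtype.ext h'.1)
      · exact absurd h'.1 F.2.1
      · exact absurd h'.1.symm G.2.1
      · exact congrArg Sum.inr (Subtype.ext h'.2)
    · rintro ⟨F, hF⟩
      obtain ⟨⟨a, b⟩, rfl⟩ := (faceProdIso P Q).symm.surjective F
      rcases Prod.isCoatom_mk_iff.1 ((OrderIso.isCoatom_iff _ _).1 hF) with ⟨h, rfl⟩ | ⟨h, rfl⟩
      · exact ⟨Sum.inl ⟨a, h⟩, rfl⟩
      · exact ⟨Sum.inr ⟨b, h⟩, rfl⟩

theorem facetSum_prod (P Q : Polytope) : facetSum (P.prod Q) =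
    facetSum P * gen (CombType.of Q) + gen (CombType.of P) * facetSum Q := by
  rw [facetSum, facetSum, facetSum, Finset.sum_mul, Finset.mul_sum]
  have := Fintype.sum_equiv (facetProdEquiv P Q)
    (Sum.elim (fun F => gen (CombType.of F.1.toPolytope) * gen (CombType.of Q))
      (fun F => gen (CombType.of P) * gen (CombType.of F.1.toPolytope)))
    (fun F => gen (CombType.of F.1.toPolytope)) (by
      rintro (F | F)
      · rw [Sum.elim_inl, ← gen_mul]
        rfl
      · rw [Sum.elim_inr, ← gen_mul]
        rfl)
  rw [← this, Fintype.sum_sum_type]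
  rfl

theorem d_gen_mul (a b : CombType) : d (gen (a * b)) = d (gen a) * gen b + gen a * d (gen b) := by
  obtain ⟨P, rfl⟩ := Quotient.exists_rep a
  obtain ⟨Q, rfl⟩ := Quotient.exists_rep b
  have := facetSum_prod P Q
  rw [← d_gen_of, ← d_gen_of, ← d_gen_of] at this
  exact this

/-- The boundary operator is a derivation. -/
theorem d_mul (x y : PolytopeRing) : d (x * y) = d x * y + x * d y := by
  induction x using MonoidAlgebra.induction_on with
  | of a =>
    induction y using MonoidAlgebra.induction_on with
    | of b =>
      rw [← map_mul]
      exact d_gen_mul a b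
    | add y z hy hz => rw [mul_add, map_add, hy, hz, map_add]; ring
    | smul r y hy =>
      rw [mul_smul_comm, map_smul, hy, map_smul, smul_add, mul_smul_comm, mul_smul_comm]
  | add x z hx hz => rw [add_mul, map_add, hx, hz, map_add]; ring
  | smul r x hx =>
    rw [smul_mul_assoc, map_smul, hx, map_smul, smul_add, smul_mul_assoc, smul_mul_assoc]

theorem d_one : d 1 = 0 := by
  have := d_mul 1 1
  simpa using this

theorem gen_mem_familyRing {D : Set CombType} {c : CombType} (hc : c ∈ Submonoid.closure D) :
    gen c ∈ familyRing D := by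
  refine Submonoid.closure_induction (motive := fun c _ => gen c ∈ familyRing D)
    (fun x hx => Subring.subset_closure ⟨x, hx, rfl⟩) ?_ ?_ hc
  · exact (familyRing D).one_mem
  · intro x y _ _ hx hy
    rw [gen_mul]
    exact (familyRing D).mul_mem hx hy

/-- By the Leibniz rule, closure under `d` need only be checked on generators. -/
theorem d_mem_familyRing {D : Set CombType} (h : ∀ c ∈ D, d (gen c) ∈ familyRing D) :
    ∀ x ∈ familyRing D, d x ∈ familyRing D := by
  intro x hx
  refine Subring.closure_induction (p := fun x _ => d x ∈ familyRing D) ?_ ?_ ?_ ?_ ?_ ?_ hx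
  · rintro _ ⟨c, hc, rfl⟩
    exact h c hc
  · rw [map_zero]; exact Subring.zero_mem _
  · rw [d_one]; exact Subring.zero_mem _
  · intro x y _ _ hx hy
    rw [map_add]; exact Subring.add_mem _ hx hy
  · intro x _ hx
    rw [map_neg]; exact Subring.neg_mem _ hx
  · intro x y hxm hym hx hy
    rw [d_mul]
    exact Subring.add_mem _ (Subring.mul_mem _ hx hym) (Subring.mul_mem _ hxm hy)

/-- The coefficient of `c`. -/
def coeffHom (c : CombType) : PolytopeRing →ₗ[ℤ] ℤ :=
  Finsupp.lapply c ∘ₗ (MonoidAlgebra.coeffLinearEquiv ℤ).toLinearMap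

open Classical in
theorem coeffHom_gen (c a : CombType) : coeffHom c (gen a) = if a = c then 1 else 0 := by
  change Finsupp.single a (1 : ℤ) c = _
  rw [Finsupp.single_apply]

/-- The ring is additively spanned by products of members, and each such product is a single basis
element of the ring of polytopes. -/
theorem mem_closure_of_mem_familyRing {D : Set CombType} {x : PolytopeRing}
    (hx : x ∈ familyRing D) {c : CombType} (hc : coeffHom c x ≠ 0) : c ∈ Submonoid.closure D := by
  by_contra hcD
  refine hc ?_
  have h1 := Subring.mem_closure_iff.1 hx
  have h2 : ∀ y ∈ Submonoid.closure (gen '' D), ∃ a ∈ Submonoid.closure D, gen a = y := by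
    intro y hy
    refine Submonoid.closure_induction
      (motive := fun y _ => ∃ a ∈ Submonoid.closure D, gen a = y) ?_ ?_ ?_ hy
    · rintro _ ⟨a, ha, rfl⟩
      exact ⟨a, Submonoid.subset_closure ha, rfl⟩
    · exact ⟨1, Submonoid.one_mem _, rfl⟩
    · rintro _ _ _ _ ⟨a, ha, rfl⟩ ⟨b, hb, rfl⟩
      exact ⟨a * b, Submonoid.mul_mem _ ha hb, gen_mul a b⟩
  refine AddSubgroup.closure_induction (p := fun y _ => coeffHom c y = 0) ?_ ?_ ?_ ?_ h1
  · intro y hy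
    obtain ⟨a, ha, rfl⟩ := h2 y hy
    rw [coeffHom_gen, if_neg]
    rintro rfl
    exact hcD ha
  · rw [map_zero]
  · intro y z _ _ hy hz
    rw [map_add, hy, hz, add_zero]
  · intro y _ hy
    rw [map_neg, hy, neg_zero]

/-- The coefficients of a boundary count facets, so they cannot cancel and the type of each facet
occurs with positive coefficient. -/
theorem facet_mem_closure {D : Set CombType} {P : Polytope} (h : facetSum P ∈ familyRing D)
    (F : P.Facet) : CombType.of F.1.toPolytope ∈ Submonoid.closure D := by
  classical
  refine mem_closure_of_mem_familyRing h ?_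
  rw [facetSum, map_sum]
  refine (lt_of_lt_of_le zero_lt_one ?_).ne'
  refine le_trans ?_ (Finset.single_le_sum (fun G _ => ?_) (Finset.mem_univ F))
  · rw [coeffHom_gen, if_pos rfl]
  · rw [coeffHom_gen]
    split_ifs <;> norm_num

end PolytopeRing

/-! ### Indecomposability of nestohedra -/

namespace BuildingSet

variable {ι : Type} [DecidableEq ι] [Fintype ι] (B : BuildingSet ι)

/-- A building set which contains every set containing a given point gives an indecomposable
nestohedron. -/
theorem indecomposable_of_hub {a : ι} (ha : ∀ S : Finset ι, a ∈ S → S ∈ B.sets) :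
    (CombType.of (nestohedron B)).Indecomposable := by
  classical
  intro x y hxy
  obtain ⟨Q, rfl⟩ := Quotient.exists_rep x
  obtain ⟨R, rfl⟩ := Quotient.exists_rep y
  change CombType.of Q = 1 ∨ CombType.of R = 1
  by_contra! hcon
  have hB : Finset.univ ∈ B.sets := ha _ (Finset.mem_univ a)
  obtain ⟨e₀⟩ : (nestohedron B).CombEquiv (Q.prod R) := Quotient.exact hxy
  let e := e₀.trans (faceProdIso Q R)
  have hco : ∀ (P : Polytope), CombType.of P ≠ 1 → ∃ F : P.Face, IsCoatom F := by
    intro P hP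
    rw [Ne, CombType.of_eq_one_iff, not_subsingleton_iff_nontrivial] at hP
    obtain ⟨F, hF⟩ := exists_ne (⊤ : P.Face)
    obtain ⟨G, hG, -⟩ := (eq_top_or_exists_le_coatom F).resolve_left hF
    exact ⟨G, hG⟩
  -- `S` is of the first kind if its facet comes from `Q`
  let K : Finset ι → Prop := fun S => (e (B.face (ind S))).1 = ⊤
  have hcoat : ∀ S ∈ B.sets, S ≠ Finset.univ → IsCoatom (e (B.face (ind S))) := fun S hS hSu =>
    (e.isCoatom_iff _).2 (B.isCoatom_face_ind hB hS hSu)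
  -- A facet of the form `Q × G` and one of the form `F × R` meet in `F × G`. Facets of incomparable
  -- members whose union is a member are disjoint, so they must come from the same factor.
  have hkind : ∀ S ∈ B.sets, S ≠ Finset.univ → ∀ T ∈ B.sets, T ≠ Finset.univ →
      S ∪ T ∈ B.sets → ¬ S ⊆ T → ¬ T ⊆ S → K S → K T := by
    intro S hS hSu T hT hTu hST h1 h2 hKS
    by_contra hKT
    have h3 : (e (B.face (ind T))).2 = ⊤ := by
      rcases Prod.isCoatom_mk_iff.1 (hcoat T hT hTu) with h | h
      · exact h.2
      · exact absurd h.2 hKT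
    refine B.not_le_face_ind_of_union_mem hST h1 h2
      (e.symm ((e (B.face (ind T))).1, (e (B.face (ind S))).2)) ?_ ?_
    · rw [e.symm_apply_le]
      exact ⟨le_top.trans hKS.ge, le_rfl⟩
    · rw [e.symm_apply_le]
      exact ⟨le_rfl, le_top.trans h3.ge⟩
  have hmem : ∀ F : Q.Face × R.Face, IsCoatom F →
      ∃ S ∈ B.sets, S ≠ Finset.univ ∧ e (B.face (ind S)) = F := by
    intro F hF
    obtain ⟨S, hS⟩ := (B.facetEquiv hB).surjective ⟨e.symm F, (e.symm.isCoatom_iff _).2 hF⟩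
    refine ⟨S.1, Finset.mem_of_mem_erase S.2, Finset.ne_of_mem_erase S.2, ?_⟩
    rw [← e.apply_symm_apply F]
    exact congrArg e (congrArg Subtype.val hS)
  obtain ⟨F, hF⟩ := hco Q hcon.1
  obtain ⟨G, hG⟩ := hco R hcon.2
  obtain ⟨S, hS, hSu, hSF⟩ := hmem (F, ⊤) (Prod.isCoatom_mk_iff.2 (Or.inl ⟨hF, rfl⟩))
  obtain ⟨T, hT, hTu, hTG⟩ := hmem (⊤, G) (Prod.isCoatom_mk_iff.2 (Or.inr ⟨hG, rfl⟩))
  have hKS : ¬ K S := fun h => hF.1 (by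
    have : (e (B.face (ind S))).1 = F := by rw [hSF]
    exact this.symm.trans h)
  have hKT : K T := by
    change (e (B.face (ind T))).1 = ⊤
    rw [hTG]
  -- If `a` were the only point, there would be no proper member at all.
  have haa : ({a} : Finset ι) ≠ Finset.univ := by
    intro h
    have hall : ∀ i, i = a := fun i => Finset.mem_singleton.1 (h ▸ Finset.mem_univ i)
    obtain ⟨i, hi⟩ := B.nonempty_of_mem S hS
    exact hSu (Finset.eq_univ_iff_forall.2 fun j => by rw [hall j, ← hall i]; exact hi)
  -- all members have the same kind as `{a}`
  have hout : ∀ S ∈ B.sets, a ∉ S → (K S ↔ K {a}) := by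
    intro S hS haS
    have hSu : S ≠ Finset.univ := by rintro rfl; exact haS (Finset.mem_univ _)
    have h1 : ¬ S ⊆ {a} := fun h => by
      obtain ⟨i, hi⟩ := B.nonempty_of_mem S hS
      exact haS (Finset.mem_singleton.1 (h hi) ▸ hi)
    have h2 : ¬ {a} ⊆ S := fun h => haS (h (Finset.mem_singleton_self a))
    have h3 := ha (S ∪ {a}) (by simp)
    exact ⟨hkind S hS hSu _ (B.singleton_mem a) haa h3 h1 h2,
      hkind _ (B.singleton_mem a) haa S hS hSu (by rwa [Finset.union_comm]) h2 h1⟩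
  have hall : ∀ S ∈ B.sets, S ≠ Finset.univ → (K S ↔ K {a}) := by
    intro S hS hSu
    by_cases haS : a ∈ S
    -- A set through `a` may contain `{a}` and cannot be compared with it directly. It is compared
    -- with a singleton `{j}` outside it, which misses `a` and so is already settled.
    · obtain ⟨j, hj⟩ : ∃ j, j ∉ S := by
        by_contra! h
        exact hSu (Finset.eq_univ_iff_forall.2 h)
      have haj : a ∉ ({j} : Finset ι) := fun h => hj (Finset.mem_singleton.1 h ▸ haS)
      have hju : ({j} : Finset ι) ≠ Finset.univ := by
        intro h; rw [h] at haj; exact haj (Finset.mem_univ _)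
      have h1 : ¬ S ⊆ {j} := fun h => haj (h haS)
      have h2 : ¬ {j} ⊆ S := fun h => hj (h (Finset.mem_singleton_self j))
      have h3 := ha (S ∪ {j}) (Finset.mem_union_left _ haS)
      rw [← hout {j} (B.singleton_mem j) haj]
      exact ⟨hkind S hS hSu _ (B.singleton_mem j) hju h3 h1 h2,
        hkind _ (B.singleton_mem j) hju S hS hSu (by rwa [Finset.union_comm]) h2 h1⟩
    · exact hout S hS haS
  exact hKS ((hall S hS hSu).2 ((hall T hT hTu).1 hKT))

end BuildingSet
end

noncomputable section

open Polytope

/-! ### Embeddings with prescribed values -/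

section Embedding

variable {ι : Type}

/-- The range of the embedding `e` is `S`. -/
def HasRange {κ : Type} (e : κ ↪ ι) (S : Finset ι) : Prop := ∀ i, i ∈ S ↔ ∃ k, e k = i

theorem exists_hasRange {S : Finset ι} {m : ℕ} (h : S.card = m) :
    ∃ e : Fin m ↪ ι, HasRange e S := by
  have e := (S.equivFinOfCardEq h).symm
  refine ⟨e.toEmbedding.trans (Function.Embedding.subtype _), fun i => ⟨fun hi => ?_, ?_⟩⟩
  · exact ⟨e.symm ⟨i, hi⟩, by simp⟩
  · rintro ⟨k, rfl⟩
    exact (e k).2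

/-- Precompose with the transposition of `k` and the preimage of `x`; values prescribed earlier at
other places survive, so special points can be fixed one at a time. -/
theorem HasRange.exists_apply_eq {κ : Type} {e : κ ↪ ι} {S : Finset ι} (h : HasRange e S) (k : κ)
    {x : ι} (hx : x ∈ S) :
    ∃ e' : κ ↪ ι, HasRange e' S ∧ e' k = x ∧ ∀ j, j ≠ k → e j ≠ x → e' j = e j := by
  classical
  obtain ⟨l, rfl⟩ := (h x).1 hx
  refine ⟨(Equiv.swap k l).toEmbedding.trans e, fun i => (h i).trans ?_, by simp, ?_⟩
  · constructor
    · rintro ⟨j, rfl⟩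
      exact ⟨Equiv.swap k l j, by simp⟩
    · rintro ⟨j, rfl⟩
      exact ⟨Equiv.swap k l j, by simp⟩
  · intro j hj hjl
    have : j ≠ l := fun h => hjl (by rw [h])
    simp [Equiv.swap_apply_of_ne_of_ne hj this]

theorem exists_hasRange_one {S : Finset ι} {m : ℕ} (h : S.card = m + 1) {a : ι} (ha : a ∈ S) :
    ∃ e : Fin (m + 1) ↪ ι, HasRange e S ∧ e 0 = a := by
  obtain ⟨e, he⟩ := exists_hasRange h
  obtain ⟨e', h1, h2, -⟩ := he.exists_apply_eq 0 ha
  exact ⟨e', h1, h2⟩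

theorem exists_hasRange_two {S : Finset ι} {m : ℕ} (h : S.card = m + 1) {a z : ι} (ha : a ∈ S)
    (hz : z ∈ S) (haz : a ≠ z) :
    ∃ e : Fin (m + 1) ↪ ι, HasRange e S ∧ e 0 = a ∧ e (Fin.last m) = z := by
  obtain ⟨e, he, h0⟩ := exists_hasRange_one h ha
  have hm : (0 : Fin (m + 1)) ≠ Fin.last m := by
    rintro h1
    have hm : m = 0 := (Fin.ext_iff.1 h1).symm
    subst hm
    obtain ⟨x, rfl⟩ := Finset.card_eq_one.1 h
    exact haz ((Finset.mem_singleton.1 ha).trans (Finset.mem_singleton.1 hz).symm)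
  obtain ⟨e', h1, h2, h3⟩ := he.exists_apply_eq (Fin.last m) hz
  exact ⟨e', h1, by rw [h3 0 hm (by rwa [h0]), h0], h2⟩

theorem exists_hasRange_three {S : Finset ι} {m : ℕ} (h : S.card = m + 1) {a b z : ι} (ha : a ∈ S)
    (hb : b ∈ S) (hz : z ∈ S) (hab : a ≠ b) (haz : a ≠ z) (hbz : b ≠ z) :
    ∃ e : Fin (m + 1) ↪ ι, HasRange e S ∧ e 0 = a ∧ e 1 = b ∧ e (Fin.last m) = z := by
  classical
  obtain ⟨e, he, h0, hl⟩ := exists_hasRange_two h ha hz haz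
  have hm : 2 ≤ m := by
    have h1 : ({a, b, z} : Finset ι).card = 3 := by
      rw [Finset.card_eq_three]; exact ⟨a, b, z, hab, haz, hbz, rfl⟩
    have h2 : ({a, b, z} : Finset ι) ⊆ S := by
      intro x hx
      simp only [Finset.mem_insert, Finset.mem_singleton] at hx
      rcases hx with rfl | rfl | rfl <;> assumption
    have := Finset.card_le_card h2
    omega
  obtain ⟨m, rfl⟩ : ∃ k, m = k + 2 := ⟨m - 2, by omega⟩
  obtain ⟨e', h1, h2, h3⟩ := he.exists_apply_eq 1 hb
  refine ⟨e', h1, ?_, h2, ?_⟩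
  · rw [h3 0 (by simp) (by rwa [h0]), h0]
  · rw [h3 _ (by simp [Fin.ext_iff]) (by rw [hl]; exact hbz.symm), hl]

end Embedding

/-! ### The building sets of the four families -/

/-- The graphical building set of the complete graph. -/
def permBuildingSet (n : ℕ) : BuildingSet (Fin (n + 1)) :=
  graphBuildingSet (⊤ : SimpleGraph (Fin (n + 1)))

/-- The graphical building set of the star. -/
def starBuildingSet (n : ℕ) : BuildingSet (Fin (n + 1)) :=
  graphBuildingSet (SimpleGraph.starGraph (0 : Fin (n + 1)))

section Predicates

variable {ι : Type}

/-- Membership in the building set of the star with centre `a`. -/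
def StarPred (a : ι) (S : Finset ι) : Prop := S.card = 1 ∨ a ∈ S

/-- Membership in the building set `B(Γ)` with special points `a`, `z`. -/
def GammaPred (a z : ι) (S : Finset ι) : Prop := S.card = 1 ∨ a ∈ S ∨ z ∉ S

/-- Membership in the building set `B(P)` with special points `a`, `b`, `z`. -/
def MasPred (a b z : ι) (S : Finset ι) : Prop := S.card = 1 ∨ a ∈ S ∧ (b ∈ S ∨ z ∉ S)

end Predicates

theorem mem_graphBuildingSet {ι : Type} [Fintype ι] [DecidableEq ι] {G : SimpleGraph ι}
    {S : Finset ι} : S ∈ (graphBuildingSet G).sets ↔ (G.induce (S : Set ι)).Connected := by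
  simp only [graphBuildingSet, Finset.mem_filter, Finset.mem_univ, true_and]

/-- If a vertex of `S` is adjacent to all the others, then `S` induces a connected graph. -/
theorem induce_connected_of_adj {ι : Type} {G : SimpleGraph ι} {S : Set ι} {a : ι} (ha : a ∈ S)
    (h : ∀ x ∈ S, a ≠ x → G.Adj a x) : (G.induce S).Connected := by
  have hr : ∀ x : S, (G.induce S).Reachable ⟨a, ha⟩ x := by
    rintro ⟨x, hx⟩
    by_cases hxa : a = x
    · subst hxa; exact SimpleGraph.Reachable.refl _
    · exact SimpleGraph.Adj.reachable (G := G.induce S) (h x hx hxa)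
  have : Nonempty S := ⟨⟨a, ha⟩⟩
  exact ⟨fun x y => (hr x).symm.trans (hr y)⟩

theorem mem_permBuildingSet {n : ℕ} {S : Finset (Fin (n + 1))} :
    S ∈ (permBuildingSet n).sets ↔ S.Nonempty := by
  refine ⟨(permBuildingSet n).nonempty_of_mem S, fun h => ?_⟩
  rw [permBuildingSet, mem_graphBuildingSet]
  obtain ⟨a, ha⟩ := h
  exact induce_connected_of_adj (Finset.mem_coe.2 ha) fun x _ hx => (SimpleGraph.top_adj a x).2 hx

theorem mem_starBuildingSet {n : ℕ} {S : Finset (Fin (n + 1))} :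
    S ∈ (starBuildingSet n).sets ↔ S.Nonempty ∧ StarPred 0 S := by
  constructor
  · intro h
    refine ⟨(starBuildingSet n).nonempty_of_mem S h, or_iff_not_imp_right.2 fun h0 => ?_⟩
    obtain ⟨x, hx⟩ := (starBuildingSet n).nonempty_of_mem S h
    rw [starBuildingSet, mem_graphBuildingSet] at h
    refine Finset.card_eq_one.2 ⟨x, Finset.eq_singleton_iff_unique_mem.2 ⟨hx, fun y hy => ?_⟩⟩
    by_contra hne
    -- A walk between distinct vertices begins with an edge, and every edge of the star contains the
    -- centre.
    obtain ⟨w⟩ := h.preconnected ⟨y, hy⟩ ⟨x, hx⟩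
    cases w with
    | nil => exact hne rfl
    | @cons _ v _ hadj _ =>
      have : (SimpleGraph.starGraph (0 : Fin (n + 1))).Adj y v.1 := hadj
      rw [SimpleGraph.starGraph_adj] at this
      rcases this.2 with h | h
      · exact h0 (h ▸ hy)
      · exact h0 (h ▸ v.2)
  · rintro ⟨-, h | h⟩
    · obtain ⟨x, rfl⟩ := Finset.card_eq_one.1 h
      exact (starBuildingSet n).singleton_mem x
    · rw [starBuildingSet, mem_graphBuildingSet]
      exact induce_connected_of_adj (Finset.mem_coe.2 h) fun x _ hx =>
        SimpleGraph.starGraph_center_adj hx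

theorem mem_gammaBuildingSet {n : ℕ} {S : Finset (Fin (n + 1))} :
    S ∈ (gammaBuildingSet n).sets ↔ S.Nonempty ∧ GammaPred 0 (Fin.last n) S := by
  have h0 : S ∈ (gammaBuildingSet n).sets ↔ gammaRel n S := by
    simp [gammaBuildingSet]
  rw [h0, gammaRel, GammaPred, ← Finset.card_pos]
  have h1 : 0 ∈ S → 0 < S.card := fun h => Finset.card_pos.2 ⟨_, h⟩
  have h2 : S.card = 1 ∨ 2 ≤ S.card ∨ S.card = 0 := by omega
  constructor
  · rintro (h | h | h)
    · exact ⟨by omega, Or.inl h⟩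
    · exact ⟨by omega, Or.inr (Or.inr h.1)⟩
    · exact ⟨h1 h.1, Or.inr (Or.inl h.1)⟩
  · rintro ⟨h, h3⟩
    have h4 : S.card = 1 ∨ 2 ≤ S.card := by omega
    tauto

theorem mem_masBuildingSet {n : ℕ} {S : Finset (Fin (n + 1))} :
    S ∈ (masBuildingSet n).sets ↔ S.Nonempty ∧ MasPred 0 1 (Fin.last n) S := by
  have h0 : S ∈ (masBuildingSet n).sets ↔ masRel n S := by
    simp [masBuildingSet]
  rw [h0, masRel, MasPred, ← Finset.card_pos]
  have h1 : 0 ∈ S → 0 < S.card := fun h => Finset.card_pos.2 ⟨_, h⟩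
  constructor
  · rintro (h | h | h)
    · exact ⟨by omega, Or.inl h⟩
    · exact ⟨h1 h.1, by tauto⟩
    · exact ⟨h1 h.1, by tauto⟩
  · rintro ⟨h, h3⟩
    have h4 : S.card = 1 ∨ 2 ≤ S.card := by omega
    tauto

theorem univ_mem_perm (n : ℕ) : Finset.univ ∈ (permBuildingSet n).sets :=
  mem_permBuildingSet.2 Finset.univ_nonempty

theorem of_nestohedron_fin_one (B : BuildingSet (Fin (0 + 1))) (hB : Finset.univ ∈ B.sets) :
    CombType.of (nestohedron B) = 1 := by
  rw [CombType.of_eq_one_iff]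
  refine subsingleton_of_forall_eq ⊤ fun F => ?_
  obtain ⟨c, rfl⟩ := B.face_surjective F
  rw [B.face_eq_top_iff hB]
  exact fun i j => congrArg c (Subsingleton.elim (α := Fin 1) i j)

/-! ### Restrictions and contractions up to relabelling -/

namespace BuildingSet

variable {ι : Type} [DecidableEq ι] [Fintype ι]

/-- The building set `B` is, up to relabelling, the building set on `S` given by the
predicate `p`. -/
def Represents {κ : Type} [DecidableEq κ] (B : BuildingSet κ) (S : Finset ι)
    (p : Finset ι → Prop) : Prop :=
  ∃ e : κ ↪ ι, HasRange e S ∧ ∀ T, T ∈ B.sets ↔ T.Nonempty ∧ p (T.map e)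

section Represents

variable {S : Finset ι} {m : ℕ} {a b z : ι}

theorem represents_perm (h : S.card = m + 1) :
    (permBuildingSet m).Represents S fun _ => True := by
  obtain ⟨e, he⟩ := exists_hasRange h
  exact ⟨e, he, fun T => by rw [mem_permBuildingSet, and_true]⟩

theorem represents_star (h : S.card = m + 1) (ha : a ∈ S) :
    (starBuildingSet m).Represents S (StarPred a) := by
  obtain ⟨e, he, rfl⟩ := exists_hasRange_one h ha
  exact ⟨e, he, fun T => by
    rw [mem_starBuildingSet, StarPred, StarPred, Finset.card_map, Finset.mem_map']⟩

theorem represents_gamma (h : S.card = m + 1) (ha : a ∈ S) (hz : z ∈ S) (haz : a ≠ z) :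
    (gammaBuildingSet m).Represents S (GammaPred a z) := by
  obtain ⟨e, he, rfl, rfl⟩ := exists_hasRange_two h ha hz haz
  exact ⟨e, he, fun T => by
    rw [mem_gammaBuildingSet, GammaPred, GammaPred, Finset.card_map, Finset.mem_map',
      Finset.mem_map']⟩

theorem represents_mas (h : S.card = m + 1) (ha : a ∈ S) (hb : b ∈ S) (hz : z ∈ S) (hab : a ≠ b)
    (haz : a ≠ z) (hbz : b ≠ z) :
    (masBuildingSet m).Represents S (MasPred a b z) := by
  obtain ⟨e, he, rfl, rfl, rfl⟩ := exists_hasRange_three h ha hb hz hab haz hbz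
  exact ⟨e, he, fun T => by
    rw [mem_masBuildingSet, MasPred, MasPred, Finset.card_map, Finset.mem_map',
      Finset.mem_map', Finset.mem_map']⟩

end Represents

/-- A form of `of_face_ind` with the relabelling absorbed: the predicates refer to subsets of the
original ground set, so no numbering of `S` or its complement intervenes. A prescribed trace `U` is
realised by `U` itself or by `U ∪ S`, which suffices for all the facets below. -/
theorem of_face_ind_of_represents {κ₁ κ₂ : Type} [DecidableEq κ₁] [Fintype κ₁] [DecidableEq κ₂]
    [Fintype κ₂] (B : BuildingSet ι) {B₁ : BuildingSet κ₁} {B₂ : BuildingSet κ₂} {S : Finset ι}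
    {p q : Finset ι → Prop} (hp : B₁.Represents S p) (hq : B₂.Represents Sᶜ q)
    (h₁ : ∀ T ⊆ S, T.Nonempty → (p T ↔ T ∈ B.sets))
    (h₂ : ∀ U, Disjoint U S → q U → U.Nonempty → U ∈ B.sets ∨ U ∪ S ∈ B.sets)
    (h₃ : ∀ T ∈ B.sets, ¬ T ⊆ S → q (T \ S)) :
    CombType.of (B.face (ind S)).toPolytope =
      CombType.of (nestohedron B₁) * CombType.of (nestohedron B₂) := by
  obtain ⟨e₁, hr₁, hp⟩ := hp
  obtain ⟨e₂, hr₂, hq⟩ := hq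
  refine B.of_face_ind B₁ B₂ e₁ e₂ hr₁ (fun i => by rw [← Finset.mem_compl]; exact hr₂ i) ?_ ?_ ?_
  · intro T
    rw [hp T]
    constructor
    · rintro ⟨hT, h⟩
      exact (h₁ _ (fun i hi => by
        obtain ⟨k, -, rfl⟩ := Finset.mem_map.1 hi
        exact (hr₁ _).2 ⟨k, rfl⟩) (hT.map)).1 h
    · intro h
      have hT : (T.map e₁).Nonempty := B.nonempty_of_mem _ h
      exact ⟨Finset.map_nonempty.1 hT, (h₁ _ (fun i hi => by
        obtain ⟨k, -, rfl⟩ := Finset.mem_map.1 hi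
        exact (hr₁ _).2 ⟨k, rfl⟩) hT).2 h⟩
  · intro U hU
    obtain ⟨hUne, hqU⟩ := (hq U).1 hU
    have hd : Disjoint (U.map e₂) S := by
      rw [Finset.disjoint_left]
      intro i hi
      obtain ⟨k, -, rfl⟩ := Finset.mem_map.1 hi
      exact Finset.mem_compl.1 ((hr₂ _).2 ⟨k, rfl⟩)
    rcases h₂ _ hd hqU hUne.map with h | h
    · exact ⟨_, h, Finset.sdiff_eq_self_of_disjoint hd⟩
    · exact ⟨_, h, by rw [Finset.union_sdiff_right, Finset.sdiff_eq_self_of_disjoint hd]⟩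
  · intro U hUne T hT hTU
    refine (hq U).2 ⟨hUne, hTU ▸ h₃ T hT fun h => ?_⟩
    rw [Finset.sdiff_eq_empty_iff_subset.2 h, eq_comm, Finset.map_eq_empty] at hTU
    exact hUne.ne_empty hTU

theorem card_sdiff_eq_one {S T : Finset ι} (h : T.card = 1) (hTS : ¬ T ⊆ S) :
    (T \ S).card = 1 := by
  have h1 := Finset.card_le_card (Finset.sdiff_subset (s := T) (t := S))
  have h2 := Finset.card_pos.2 (Finset.sdiff_nonempty.2 hTS)
  omega

/-- The facet given by a singleton. -/
theorem of_face_ind_singleton {κ : Type} [DecidableEq κ] [Fintype κ] (B : BuildingSet ι)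
    {B₂ : BuildingSet κ} {i : ι} {q : Finset ι → Prop} (hq : B₂.Represents {i}ᶜ q)
    (h₂ : ∀ U, i ∉ U → q U → U.Nonempty → U ∈ B.sets ∨ U ∪ {i} ∈ B.sets)
    (h₃ : ∀ T ∈ B.sets, ¬ T ⊆ {i} → q (T \ {i})) :
    CombType.of (B.face (ind {i})).toPolytope = CombType.of (nestohedron B₂) := by
  -- The restriction to a singleton is a point, presented as the zero-dimensional permutohedron and
  -- then dropped as the unit.
  rw [B.of_face_ind_of_represents (represents_perm (m := 0) (Finset.card_singleton i)) hq,
    of_nestohedron_fin_one _ (univ_mem_perm 0), one_mul]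
  · intro T hT hne
    have := B.singleton_mem i
    rcases Finset.subset_singleton_iff.1 hT with rfl | rfl
    · simp at hne
    · simp [this]
  · intro U hU
    exact h₂ U (Finset.disjoint_singleton_right.1 hU)
  · exact h₃

end BuildingSet
end

noncomputable section

open Polytope BuildingSet

/-! ### Facets of the four families -/

theorem univ_mem_star (n : ℕ) : Finset.univ ∈ (starBuildingSet n).sets :=
  mem_starBuildingSet.2 ⟨Finset.univ_nonempty, Or.inr (Finset.mem_univ _)⟩

theorem univ_mem_gamma (n : ℕ) : Finset.univ ∈ (gammaBuildingSet n).sets :=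
  mem_gammaBuildingSet.2 ⟨Finset.univ_nonempty, Or.inr (Or.inl (Finset.mem_univ _))⟩

theorem univ_mem_mas (n : ℕ) : Finset.univ ∈ (masBuildingSet n).sets :=
  mem_masBuildingSet.2 ⟨Finset.univ_nonempty, Or.inr ⟨Finset.mem_univ _, Or.inl (Finset.mem_univ _)⟩⟩

section Facets

variable {n s m : ℕ} {S : Finset (Fin (n + 1))}

/-- The combinatorial type of the facet of the nestohedron of `B` given by `S`. -/
abbrev facetType (B : BuildingSet (Fin (n + 1))) (S : Finset (Fin (n + 1))) : CombType :=
  CombType.of (B.face (ind S)).toPolytope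

theorem facetType_perm (hs : S.card = s + 1) (hm : Sᶜ.card = m + 1) :
    facetType (permBuildingSet n) S = permutohedron s * permutohedron m := by
  refine of_face_ind_of_represents _ (represents_perm hs) (represents_perm hm) ?_ ?_ ?_
  · intro T _ hne
    simp [mem_permBuildingSet, hne]
  · intro U _ _ hne
    exact Or.inl (mem_permBuildingSet.2 hne)
  · intros
    trivial

/-- Once the centre lies in `S`, every nonempty `U` off `S` is a trace, because `U ∪ S` contains the
centre. The contraction is therefore complete. -/
theorem facetType_star_of_mem (h0 : 0 ∈ S) (hs : S.card = s + 1) (hm : Sᶜ.card = m + 1) :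
    facetType (starBuildingSet n) S = stellahedron s * permutohedron m := by
  refine of_face_ind_of_represents _ (represents_star hs h0) (represents_perm hm) ?_ ?_ ?_
  · intro T _ hne
    simp [mem_starBuildingSet, hne]
  · intro U _ _ hne
    exact Or.inr (mem_starBuildingSet.2 ⟨hne.mono Finset.subset_union_left,
      Or.inr (Finset.mem_union_right _ h0)⟩)
  · intros
    trivial

theorem card_compl_singleton (i : Fin (m + 2)) : ({i}ᶜ : Finset (Fin (m + 2))).card = m + 1 := by
  rw [Finset.card_compl, Finset.card_singleton, Fintype.card_fin]
  rfl

theorem facetType_star_singleton {j : Fin (m + 2)} (hj : j ≠ 0) :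
    facetType (starBuildingSet (m + 1)) {j} = stellahedron m := by
  refine of_face_ind_singleton _
    (represents_star (a := 0) (card_compl_singleton j) (by simpa using hj.symm)) ?_ ?_
  · intro U _ hq hne
    exact Or.inl (mem_starBuildingSet.2 ⟨hne, hq⟩)
  · intro T hT hTS
    rcases (mem_starBuildingSet.1 hT).2 with h | h
    · exact Or.inl (card_sdiff_eq_one h hTS)
    · exact Or.inr (by simp [h, hj.symm])

theorem facetType_gamma_last :
    facetType (gammaBuildingSet (m + 1)) {Fin.last (m + 1)} = permutohedron m := by
  refine of_face_ind_singleton _ (represents_perm (card_compl_singleton _)) ?_ ?_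
  · intro U hU _ hne
    exact Or.inl (mem_gammaBuildingSet.2 ⟨hne, Or.inr (Or.inr hU)⟩)
  · intros
    trivial

theorem facetType_gamma_of_mem (h0 : 0 ∈ S) (hl : Fin.last n ∉ S) (hs : S.card = s + 1)
    (hm : Sᶜ.card = m + 1) :
    facetType (gammaBuildingSet n) S = permutohedron s * permutohedron m := by
  refine of_face_ind_of_represents _ (represents_perm hs) (represents_perm hm) ?_ ?_ ?_
  · intro T hT hne
    exact iff_of_true trivial
      (mem_gammaBuildingSet.2 ⟨hne, Or.inr (Or.inr fun h => hl (hT h))⟩)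
  · intro U _ _ hne
    exact Or.inr (mem_gammaBuildingSet.2 ⟨hne.mono Finset.subset_union_left,
      Or.inr (Or.inl (Finset.mem_union_right _ h0))⟩)
  · intros
    trivial

/-- Every nonempty subset of `S` avoids the last point and so is a member. Both special points
survive in the complement, where the membership rule is unchanged. -/
theorem facetType_gamma_of_notMem (h0 : 0 ∉ S) (hl : Fin.last n ∉ S) (hn : (0 : Fin (n + 1)) ≠ Fin.last n)
    (hs : S.card = s + 1) (hm : Sᶜ.card = m + 1) :
    facetType (gammaBuildingSet n) S =
      permutohedron s * CombType.of (nestohedron (gammaBuildingSet m)) := by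
  refine of_face_ind_of_represents _ (represents_perm hs)
    (represents_gamma hm (Finset.mem_compl.2 h0) (Finset.mem_compl.2 hl) hn) ?_ ?_ ?_
  · intro T hT hne
    exact iff_of_true trivial
      (mem_gammaBuildingSet.2 ⟨hne, Or.inr (Or.inr fun h => hl (hT h))⟩)
  · intro U _ hq hne
    exact Or.inl (mem_gammaBuildingSet.2 ⟨hne, hq⟩)
  · intro T hT hTS
    rcases (mem_gammaBuildingSet.1 hT).2 with h | h | h
    · exact Or.inl (card_sdiff_eq_one h hTS)
    · exact Or.inr (Or.inl (Finset.mem_sdiff.2 ⟨h, h0⟩))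
    · exact Or.inr (Or.inr fun h' => h (Finset.mem_sdiff.1 h').1)

theorem facetType_gamma_of_mem_mem (h0 : 0 ∈ S) (hl : Fin.last n ∈ S)
    (hn : (0 : Fin (n + 1)) ≠ Fin.last n) (hs : S.card = s + 1) (hm : Sᶜ.card = m + 1) :
    facetType (gammaBuildingSet n) S =
      CombType.of (nestohedron (gammaBuildingSet s)) * permutohedron m := by
  refine of_face_ind_of_represents _ (represents_gamma hs h0 hl hn) (represents_perm hm) ?_ ?_ ?_
  · intro T _ hne
    simp [mem_gammaBuildingSet, hne]
  · intro U _ _ hne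
    exact Or.inr (mem_gammaBuildingSet.2 ⟨hne.mono Finset.subset_union_left,
      Or.inr (Or.inl (Finset.mem_union_right _ h0))⟩)
  · intros
    trivial

theorem one_ne_last : (1 : Fin (m + 3)) ≠ Fin.last (m + 2) := by
  simp [Fin.ext_iff]

theorem zero_ne_last : (0 : Fin (m + 2)) ≠ Fin.last (m + 1) := by
  simp [Fin.ext_iff]

/-- Adjoining `1` turns any set through `0` into a member, so contraction removes the restriction on
the last point and leaves a star centred at `0`. -/
theorem facetType_mas_one :
    facetType (masBuildingSet (m + 2)) {1} = stellahedron (m + 1) := by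
  refine of_face_ind_singleton _
    (represents_star (a := 0) (card_compl_singleton _) (by simp)) ?_ ?_
  · rintro U _ (h | h) hne
    · exact Or.inl (mem_masBuildingSet.2 ⟨hne, Or.inl h⟩)
    · exact Or.inr (mem_masBuildingSet.2 ⟨hne.mono Finset.subset_union_left,
        Or.inr ⟨Finset.mem_union_left _ h, Or.inl (by simp)⟩⟩)
  · intro T hT hTS
    rcases (mem_masBuildingSet.1 hT).2 with h | h
    · exact Or.inl (card_sdiff_eq_one h hTS)
    · exact Or.inr (by simp [h.1])

/-- Off the last point, the condition on sets through `0` holds automatically, so again a star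
centred at `0` remains. -/
theorem facetType_mas_last :
    facetType (masBuildingSet (m + 2)) {Fin.last (m + 2)} = stellahedron (m + 1) := by
  refine of_face_ind_singleton _
    (represents_star (a := 0) (card_compl_singleton _) (by simp)) ?_ ?_
  · rintro U hU (h | h) hne
    · exact Or.inl (mem_masBuildingSet.2 ⟨hne, Or.inl h⟩)
    · exact Or.inl (mem_masBuildingSet.2 ⟨hne, Or.inr ⟨h, Or.inr hU⟩⟩)
  · intro T hT hTS
    rcases (mem_masBuildingSet.1 hT).2 with h | h
    · exact Or.inl (card_sdiff_eq_one h hTS)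
    · exact Or.inr (Finset.mem_sdiff.2 ⟨h.1, by simp⟩)

theorem facetType_mas_singleton {i : Fin (m + 3)} (h0 : i ≠ 0) (h1 : i ≠ 1)
    (hl : i ≠ Fin.last (m + 2)) :
    facetType (masBuildingSet (m + 2)) {i} = CombType.of (nestohedron (masBuildingSet (m + 1))) := by
  refine of_face_ind_singleton _
    (represents_mas (a := 0) (b := 1) (z := Fin.last (m + 2)) (card_compl_singleton _)
      (by simpa using h0.symm) (by simpa using h1.symm) (by simpa using hl.symm)
      (by simp) zero_ne_last one_ne_last) ?_ ?_
  · intro U _ hq hne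
    exact Or.inl (mem_masBuildingSet.2 ⟨hne, hq⟩)
  · intro T hT hTS
    rcases (mem_masBuildingSet.1 hT).2 with h | h
    · exact Or.inl (card_sdiff_eq_one h hTS)
    · refine Or.inr ⟨by simp [h.1, h0.symm], h.2.imp (fun h => by simp [h, h1.symm]) fun h => ?_⟩
      exact fun h' => h (Finset.mem_sdiff.1 h').1

/-- Since `S` avoids the last point, its members form a star centred at `0`. In the contraction `0`
comes for free, and a trace need only contain `1`, avoid the last point, or be a single point: this
is `B(Γ)` with `1` in the role of `0`. -/
theorem facetType_mas_of_mem {S : Finset (Fin (n + 3))} (h0 : 0 ∈ S) (h1 : 1 ∉ S)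
    (hl : Fin.last (n + 2) ∉ S) (hs : S.card = s + 1) (hm : Sᶜ.card = m + 1) :
    facetType (masBuildingSet (n + 2)) S =
      stellahedron s * CombType.of (nestohedron (gammaBuildingSet m)) := by
  refine of_face_ind_of_represents _ (represents_star hs h0)
    (represents_gamma hm (Finset.mem_compl.2 h1) (Finset.mem_compl.2 hl) one_ne_last) ?_ ?_ ?_
  · intro T hT hne
    have h2 : Fin.last (n + 2) ∉ T := fun h => hl (hT h)
    simp [mem_masBuildingSet, StarPred, MasPred, hne, h2]
  · rintro U _ (h | h | h) hne
    · exact Or.inl (mem_masBuildingSet.2 ⟨hne, Or.inl h⟩)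
    · exact Or.inr (mem_masBuildingSet.2 ⟨hne.mono Finset.subset_union_left,
        Or.inr ⟨Finset.mem_union_right _ h0, Or.inl (Finset.mem_union_left _ h)⟩⟩)
    · exact Or.inr (mem_masBuildingSet.2 ⟨hne.mono Finset.subset_union_left,
        Or.inr ⟨Finset.mem_union_right _ h0, Or.inr (by simp [h, hl])⟩⟩)
  · intro T hT hTS
    rcases (mem_masBuildingSet.1 hT).2 with h | ⟨-, h | h⟩
    · exact Or.inl (card_sdiff_eq_one h hTS)
    · exact Or.inr (Or.inl (Finset.mem_sdiff.2 ⟨h, h1⟩))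
    · exact Or.inr (Or.inr fun h' => h (Finset.mem_sdiff.1 h').1)

/-- With `0` and `1` both in `S`, every `U ∪ S` is a member and the contraction is complete; inside
`S` the absence of the last point leaves a star. -/
theorem facetType_mas_of_mem_mem {S : Finset (Fin (n + 3))} (h0 : 0 ∈ S) (h1 : 1 ∈ S)
    (hl : Fin.last (n + 2) ∉ S) (hs : S.card = s + 1) (hm : Sᶜ.card = m + 1) :
    facetType (masBuildingSet (n + 2)) S = stellahedron s * permutohedron m := by
  refine of_face_ind_of_represents _ (represents_star hs h0) (represents_perm hm) ?_ ?_ ?_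
  · intro T hT hne
    have h2 : Fin.last (n + 2) ∉ T := fun h => hl (hT h)
    simp [mem_masBuildingSet, StarPred, MasPred, hne, h2]
  · intro U _ _ hne
    exact Or.inr (mem_masBuildingSet.2 ⟨hne.mono Finset.subset_union_left,
        Or.inr ⟨Finset.mem_union_right _ h0, Or.inl (Finset.mem_union_right _ h1)⟩⟩)
  · intros
    trivial

theorem facetType_mas_of_mem_mem_mem {S : Finset (Fin (n + 3))} (h0 : 0 ∈ S) (h1 : 1 ∈ S)
    (hl : Fin.last (n + 2) ∈ S) (hs : S.card = s + 1) (hm : Sᶜ.card = m + 1) :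
    facetType (masBuildingSet (n + 2)) S =
      CombType.of (nestohedron (masBuildingSet s)) * permutohedron m := by
  refine of_face_ind_of_represents _
    (represents_mas hs h0 h1 hl (by simp) zero_ne_last one_ne_last) (represents_perm hm) ?_ ?_ ?_
  · intro T _ hne
    simp [mem_masBuildingSet, hne]
  · intro U _ _ hne
    exact Or.inr (mem_masBuildingSet.2 ⟨hne.mono Finset.subset_union_left,
        Or.inr ⟨Finset.mem_union_right _ h0, Or.inl (Finset.mem_union_right _ h1)⟩⟩)
  · intros
    trivial

end Facets

/-! ### Dimensions zero and one -/

theorem of_nestohedron_fin_two (B : BuildingSet (Fin (1 + 1))) (hB : Finset.univ ∈ B.sets) :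
    CombType.of (nestohedron B) = CombType.of segment := by
  -- Only the difference of the two coefficients matters, and it becomes the slope on `[0, 1]`: the
  -- endpoint `1` corresponds to the index `0` and the endpoint `0` to the index `1`.
  let f : (Fin (1 + 1) → ℝ) → ℝ →ₗ[ℝ] ℝ := fun c => (c 0 - c 1) • LinearMap.id
  let F : (Fin (1 + 1) → ℝ) → Set ℝ := fun c =>
    {x ∈ Set.Icc (0 : ℝ) 1 | ∀ y ∈ Set.Icc (0 : ℝ) 1, f c x ≤ f c y}
  let p : (Fin (1 + 1) → ℝ) → segment.Face := fun c => segment.minFace (f c)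
  have hF : ∀ c, F c = convexHull ℝ ((({0, 1} : Finset ℝ) : Set ℝ) ∩ F c) := by
    intro c
    have hface : segment.IsFace (F c) := (p c).2
    refine face_eq_convexHull {0, 1} hface.convex ?_
    rw [Finset.coe_insert, Finset.coe_singleton, convexHull_pair, segment_eq_Icc zero_le_one]
    exact hface.extreme
  have h0 : ∀ c, (0 : ℝ) ∈ F c ↔ c 1 ≤ c 0 := by
    intro c
    simp only [F, f, Set.mem_ofPred_eq, Set.mem_Icc, LinearMap.smul_apply, LinearMap.id_apply,
      smul_eq_mul, mul_zero]
    constructor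
    · rintro ⟨-, h⟩
      have := h 1 ⟨zero_le_one, le_rfl⟩
      linarith
    · intro h
      exact ⟨⟨le_rfl, zero_le_one⟩, fun y hy => mul_nonneg (by linarith) hy.1⟩
  have h1 : ∀ c, (1 : ℝ) ∈ F c ↔ c 0 ≤ c 1 := by
    intro c
    simp only [F, f, Set.mem_ofPred_eq, Set.mem_Icc, LinearMap.smul_apply, LinearMap.id_apply,
      smul_eq_mul, mul_one]
    constructor
    · rintro ⟨-, h⟩
      have := h 0 ⟨le_rfl, zero_le_one⟩
      linarith
    · intro h
      exact ⟨⟨zero_le_one, le_rfl⟩, fun y hy => by nlinarith [hy.1, hy.2]⟩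
  have hp : p.Surjective := by
    intro G
    obtain ⟨g, rfl⟩ := segment.exists_minFace_eq G
    refine ⟨![g (1 : ℝ), 0], congrArg segment.minFace ?_⟩
    refine LinearMap.ext_ring ?_
    change (g (1 : ℝ) - 0) • (1 : ℝ) = g (1 : ℝ)
    simp
  have hpq : ∀ a b, p a ≤ p b ↔ B.face a ≤ B.face b := by
    intro a b
    have h2 : p a ≤ p b ↔ (a 1 ≤ a 0 → b 1 ≤ b 0) ∧ (a 0 ≤ a 1 → b 0 ≤ b 1) := by
      rw [← h0, ← h0, ← h1, ← h1]
      change F a ⊆ F b ↔ _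
      refine ⟨fun h => ⟨fun h' => h h', fun h' => h h'⟩, fun h => ?_⟩
      rw [hF a, hF b]
      refine convexHull_mono ?_
      rintro x ⟨hx, hxa⟩
      refine ⟨hx, ?_⟩
      simp only [Finset.coe_insert, Finset.coe_singleton, Set.mem_insert_iff,
        Set.mem_singleton_iff] at hx
      rcases hx with rfl | rfl
      · exact h.1 hxa
      · exact h.2 hxa
    have hmem : ∀ (c : Fin (1 + 1) → ℝ), (0 ∈ argmin c Finset.univ ↔ c 0 ≤ c 1) ∧
        (1 ∈ argmin c Finset.univ ↔ c 1 ≤ c 0) := by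
      intro c
      simp [mem_argmin]
    rw [h2, face_le_iff]
    constructor
    · rintro ⟨h3, h4⟩ S hS
      by_cases hSu : S = Finset.univ
      · subst hSu
        intro i hi
        fin_cases i
        · exact (hmem b).1.2 (h4 ((hmem a).1.1 hi))
        · exact (hmem b).2.2 (h3 ((hmem a).2.1 hi))
      · have hS1 : S.card < 2 := (Finset.card_lt_iff_ne_univ S).2 hSu
        intro i hi
        obtain ⟨hiS, -⟩ := mem_argmin.1 hi
        refine mem_argmin.2 ⟨hiS, fun j hj => ?_⟩
        rw [Finset.card_le_one.1 (by omega) i hiS j hj]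
    · intro h
      exact ⟨fun h3 => (hmem b).2.1 (h _ hB ((hmem a).2.2 h3)),
        fun h4 => (hmem b).1.1 (h _ hB ((hmem a).1.2 h4))⟩
  obtain ⟨e⟩ := nonempty_orderIso_of_surjective hp B.face_surjective hpq
  exact Quotient.sound ⟨e.symm⟩

/-- The point and segment chosen by hand agree with the nestohedra, so the facet formulas need no
exceptions in low dimension. -/
theorem PMas_eq (n : ℕ) : PMas n = CombType.of (nestohedron (masBuildingSet n)) := by
  match n with
  | 0 => exact (of_nestohedron_fin_one _ (univ_mem_mas 0)).symm
  | 1 => exact (of_nestohedron_fin_two _ (univ_mem_mas 1)).symm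
  | n + 2 => rfl

theorem PGamma_eq (n : ℕ) : PGamma n = CombType.of (nestohedron (gammaBuildingSet n)) := by
  match n with
  | 0 => exact (of_nestohedron_fin_one _ (univ_mem_gamma 0)).symm
  | 1 => exact (of_nestohedron_fin_two _ (univ_mem_gamma 1)).symm
  | n + 2 => rfl

theorem permutohedron_zero : permutohedron 0 = 1 := of_nestohedron_fin_one _ (univ_mem_perm 0)

theorem stellahedron_zero : stellahedron 0 = 1 := of_nestohedron_fin_one _ (univ_mem_star 0)

theorem PMas_one : PMas 1 = permutohedron 1 :=
  (of_nestohedron_fin_two _ (univ_mem_perm 1)).symm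

end

noncomputable section

open Polytope BuildingSet PolytopeRing

/-! ### The boundary of `P_Mas` -/

/-- Summation over the proper members of `B(P,n)`. -/
theorem sum_masBuildingSet {R : Type*} [AddCommMonoid R] {n : ℕ} (f : Finset (Fin (n + 3)) → R)
    (M : Finset (Fin (n + 3))) (hM : M = Finset.univ \ {0, 1, Fin.last (n + 2)}) :
    ∑ S ∈ (masBuildingSet (n + 2)).sets.erase Finset.univ, f S =
      f {1} + f {Fin.last (n + 2)} + ∑ i ∈ M, f {i} + ∑ J ∈ M.powerset, f (insert 0 J) +
      ∑ J ∈ M.powerset, f (insert 0 (insert 1 J)) +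
      ∑ J ∈ M.powerset.erase M, f (insert 0 (insert 1 (insert (Fin.last (n + 2)) J))) := by
  classical
  set z := Fin.last (n + 2) with hz
  have h01 : (0 : Fin (n + 3)) ≠ 1 := by simp
  have h0z : (0 : Fin (n + 3)) ≠ z := zero_ne_last
  have h1z : (1 : Fin (n + 3)) ≠ z := one_ne_last
  have h0M : 0 ∉ M := by simp [hM]
  have h1M : 1 ∉ M := by simp [hM]
  have hzM : z ∉ M := by simp [hM]
  have hmemM : ∀ i, i ≠ 0 → i ≠ 1 → i ≠ z → i ∈ M := fun i h1 h2 h3 => by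
    simp [hM, h1, h2, h3]
  have hsub : ∀ {J : Finset (Fin (n + 3))} {i}, J ⊆ M → i ∉ M → i ∉ J := fun h h' hi => h' (h hi)
  have hset : (masBuildingSet (n + 2)).sets.erase Finset.univ =
      ({{1}, {z}} ∪ M.image (fun i => {i}) ∪ M.powerset.image (fun J => insert 0 J) ∪
      M.powerset.image (fun J => insert 0 (insert 1 J)) ∪
      (M.powerset.erase M).image fun J => insert 0 (insert 1 (insert z J))) := by
    ext S
    simp only [Finset.mem_erase, mem_masBuildingSet, Finset.mem_union, Finset.mem_insert,
      Finset.mem_singleton, Finset.mem_image, Finset.mem_powerset]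
    constructor
    · rintro ⟨hSu, hne, h | ⟨h0, h⟩⟩
      · obtain ⟨i, rfl⟩ := Finset.card_eq_one.1 h
        by_cases hi0 : i = 0
        · subst hi0
          -- The singleton `{0}` is counted as `{0} ∪ J` with `J` empty, not among the singletons.
          -- In the last group `J = M` is excluded since it gives the full set.
          exact Or.inl (Or.inl (Or.inr ⟨∅, Finset.empty_subset _, rfl⟩))
        by_cases hi1 : i = 1
        · subst hi1; simp
        by_cases hiz : i = z
        · subst hiz; simp
        · exact Or.inl (Or.inl (Or.inl (Or.inr ⟨i, hmemM i hi0 hi1 hiz, rfl⟩)))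
      · have hJ : S ∩ M ⊆ M := Finset.inter_subset_right
        by_cases h1 : 1 ∈ S
        · by_cases hzS : z ∈ S
          · have hS : insert 0 (insert 1 (insert z (S ∩ M))) = S := by
              ext i
              simp only [Finset.mem_insert, Finset.mem_inter]
              refine ⟨?_, fun hi => ?_⟩
              · rintro (rfl | rfl | rfl | h) <;> tauto
              · have := hmemM i
                tauto
            refine Or.inr ⟨S ∩ M, ⟨fun h => hSu ?_, hJ⟩, hS⟩
            rw [← hS, h]
            ext i
            have := hmemM i
            simp only [Finset.mem_insert, Finset.mem_univ, iff_true]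
            tauto
          · refine Or.inl (Or.inr ⟨S ∩ M, hJ, ?_⟩)
            ext i
            simp only [Finset.mem_insert, Finset.mem_inter]
            refine ⟨?_, fun hi => ?_⟩
            · rintro (rfl | rfl | h) <;> tauto
            · have h2 := hmemM i
              have h3 : i ≠ z := by rintro rfl; exact hzS hi
              tauto
        · have hzS : z ∉ S := h.resolve_left h1
          refine Or.inl (Or.inl (Or.inr ⟨S ∩ M, hJ, ?_⟩))
          ext i
          simp only [Finset.mem_insert, Finset.mem_inter]
          refine ⟨?_, fun hi => ?_⟩
          · rintro (rfl | h) <;> tauto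
          · have h2 := hmemM i
            have h3 : i ≠ z := by rintro rfl; exact hzS hi
            have h4 : i ≠ 1 := by rintro rfl; exact h1 hi
            tauto
    · have hne_univ : ∀ {S : Finset (Fin (n + 3))} {i}, i ∉ S → S ≠ Finset.univ := by
        rintro S i hi rfl
        exact hi (Finset.mem_univ i)
      rintro (((((rfl | rfl) | ⟨i, hi, rfl⟩) | ⟨J, hJ, rfl⟩) | ⟨J, hJ, rfl⟩) | ⟨J, ⟨hJM, hJ⟩, rfl⟩)
      · exact ⟨hne_univ (i := 0) (by simp), Finset.singleton_nonempty _, Or.inl rfl⟩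
      · exact ⟨hne_univ (i := 0) (by simpa using h0z), Finset.singleton_nonempty _, Or.inl rfl⟩
      · refine ⟨hne_univ (i := 0) ?_, Finset.singleton_nonempty _, Or.inl rfl⟩
        rw [Finset.mem_singleton]
        rintro rfl
        exact h0M hi
      · refine ⟨hne_univ (i := 1) ?_, Finset.insert_nonempty _ _, Or.inr ⟨by simp, Or.inr ?_⟩⟩
        · simp [hsub hJ h1M]
        · rw [Finset.mem_insert, not_or]
          exact ⟨h0z.symm, hsub hJ hzM⟩
      · refine ⟨hne_univ (i := z) ?_, Finset.insert_nonempty _ _, Or.inr ⟨by simp, Or.inl ?_⟩⟩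
        · simp [hsub hJ hzM, h0z.symm, h1z.symm]
        · simp
      · obtain ⟨i, hiM, hiJ⟩ := Finset.exists_of_ssubset (lt_of_le_of_ne hJ hJM)
        refine ⟨hne_univ (i := i) ?_, Finset.insert_nonempty _ _, Or.inr ⟨by simp, Or.inl ?_⟩⟩
        · simp only [Finset.mem_insert, hiJ, or_false]
          rintro (rfl | rfl | rfl) <;> contradiction
        · simp
  have hinj : ∀ {x : Fin (n + 3)} {J K : Finset (Fin (n + 3))}, x ∉ J → x ∉ K →
      insert x J = insert x K → J = K := by
    intro x J K hJ hK h
    rw [← Finset.erase_insert hJ, h, Finset.erase_insert hK]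
  rw [hset, Finset.sum_union, Finset.sum_union, Finset.sum_union, Finset.sum_union,
    Finset.sum_pair, Finset.sum_image, Finset.sum_image, Finset.sum_image, Finset.sum_image]
  · intro J hJ K hK h
    have hJ := Finset.mem_powerset.1 (Finset.mem_of_mem_erase hJ)
    have hK := Finset.mem_powerset.1 (Finset.mem_of_mem_erase hK)
    refine hinj (hsub hJ hzM) (hsub hK hzM) (hinj ?_ ?_ (hinj ?_ ?_ h))
    · simp [hsub hJ h1M, h1z]
    · simp [hsub hK h1M, h1z]
    · simp [hsub hJ h0M, h0z]
    · simp [hsub hK h0M, h0z]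
  · intro J hJ K hK h
    have hJ := Finset.mem_powerset.1 hJ
    have hK := Finset.mem_powerset.1 hK
    refine hinj (hsub hJ h1M) (hsub hK h1M) (hinj ?_ ?_ h)
    · simp [hsub hJ h0M]
    · simp [hsub hK h0M]
  · intro J hJ K hK h
    exact hinj (hsub (Finset.mem_powerset.1 hJ) h0M) (hsub (Finset.mem_powerset.1 hK) h0M) h
  · intro i _ j _ h
    exact Finset.singleton_injective h
  · simp [h1z]
  · simp only [Finset.disjoint_left, Finset.mem_insert, Finset.mem_singleton, Finset.mem_image]
    rintro S (rfl | rfl) ⟨i, hi, h⟩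
    · exact h1M (Finset.singleton_injective h ▸ hi)
    · exact hzM (Finset.singleton_injective h ▸ hi)
  · simp only [Finset.disjoint_left, Finset.mem_insert, Finset.mem_singleton, Finset.mem_image,
      Finset.mem_union]
    rintro S hS ⟨J, hJ, rfl⟩
    have h0 := Finset.mem_insert_self 0 J
    rcases hS with (h | h) | ⟨i, hi, h⟩
    · rw [h] at h0; simp at h0
    · rw [h, Finset.mem_singleton] at h0; exact h0z h0
    · rw [← h, Finset.mem_singleton] at h0; exact h0M (h0 ▸ hi)
  · simp only [Finset.disjoint_left, Finset.mem_insert, Finset.mem_singleton, Finset.mem_image,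
      Finset.mem_union, Finset.mem_powerset]
    rintro S hS ⟨J, hJ, rfl⟩
    have h0 := Finset.mem_insert_self 0 (insert 1 J)
    have h1 : 1 ∈ insert 0 (insert 1 J) := by simp
    rcases hS with ((h | h) | ⟨i, hi, h⟩) | ⟨K, hK, h⟩
    · rw [h] at h0; simp at h0
    · rw [h, Finset.mem_singleton] at h0; exact h0z h0
    · rw [← h, Finset.mem_singleton] at h0; exact h0M (h0 ▸ hi)
    · rw [← h] at h1; simp [hsub hK h1M] at h1
  · simp only [Finset.disjoint_left, Finset.mem_insert, Finset.mem_singleton, Finset.mem_image,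
      Finset.mem_union, Finset.mem_powerset]
    rintro S hS ⟨J, hJ, rfl⟩
    have h0 := Finset.mem_insert_self 0 (insert 1 (insert z J))
    have h1 : 1 ∈ insert 0 (insert 1 (insert z J)) := by simp
    have h2 : z ∈ insert 0 (insert 1 (insert z J)) := by simp
    rcases hS with (((h | h) | ⟨i, hi, h⟩) | ⟨K, hK, h⟩) | ⟨K, hK, h⟩
    · rw [h] at h0; simp at h0
    · rw [h, Finset.mem_singleton] at h0; exact h0z h0
    · rw [← h, Finset.mem_singleton] at h0; exact h0M (h0 ▸ hi)
    · rw [← h] at h1; simp [hsub hK h1M] at h1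
    · rw [← h] at h2; simp [hsub hK hzM, h0z.symm, h1z.symm] at h2

theorem d_nestohedron {n : ℕ} (B : BuildingSet (Fin (n + 1))) (hB : Finset.univ ∈ B.sets) :
    d (gen (CombType.of (nestohedron B))) =
      ∑ S ∈ B.sets.erase Finset.univ, gen (facetType B S) := by
  rw [d_gen_of, B.facetSum_nestohedron hB]

theorem sum_powerset_erase_apply_card {R β : Type*} [AddCommGroup R] [DecidableEq β]
    (f : ℕ → R) (M : Finset β) :
    ∑ J ∈ M.powerset.erase M, f J.card = ∑ j ∈ Finset.range M.card, M.card.choose j • f j := by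
  have h := Finset.sum_powerset_apply_card f (x := M)
  rw [Finset.sum_range_succ, Nat.choose_self, one_smul,
    ← Finset.sum_erase_add _ _ (Finset.mem_powerset_self M)] at h
  exact add_right_cancel h

/-- Here `n` is the number of ordinary points, those other than `0`, `1` and the last; the type of a
facet depends only on its group and on the size of `J`, whence the binomial coefficients. -/
theorem d_PMas (n : ℕ) : d (gen (PMas (n + 2))) =
    2 * gen (stellahedron (n + 1)) + (n : PolytopeRing) * gen (PMas (n + 1))
      + ∑ s ∈ Finset.range (n + 1),
          (n.choose s : PolytopeRing) * (gen (stellahedron s) * gen (PGamma (n - s + 1)))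
      + ∑ s ∈ Finset.range (n + 1),
          (n.choose s : PolytopeRing) *
            (gen (stellahedron (s + 1)) * gen (permutohedron (n - s)))
      + ∑ s ∈ Finset.range n,
          (n.choose s : PolytopeRing) *
            (gen (PMas (s + 2)) * gen (permutohedron (n - s - 1))) := by
  classical
  rw [PMas_eq, d_nestohedron _ (univ_mem_mas _), sum_masBuildingSet _ _ rfl]
  set M : Finset (Fin (n + 3)) := Finset.univ \ {0, 1, Fin.last (n + 2)} with hM
  have h3 : ({0, 1, Fin.last (n + 2)} : Finset (Fin (n + 3))).card = 3 := by
    rw [Finset.card_eq_three]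
    exact ⟨_, _, _, by simp, zero_ne_last, one_ne_last, rfl⟩
  have hcard : M.card = n := by
    rw [hM, ← Finset.compl_eq_univ_sdiff, Finset.card_compl, h3, Fintype.card_fin]
    omega
  have h0M : 0 ∉ M := by simp [hM]
  have h1M : 1 ∉ M := by simp [hM]
  have hzM : Fin.last (n + 2) ∉ M := by simp [hM]
  have hle : ∀ {J}, J ⊆ M → J.card ≤ n := fun h =>
    (Finset.card_le_card h).trans hcard.le
  have hsub : ∀ {J : Finset (Fin (n + 3))} {i}, J ⊆ M → i ∉ M → i ∉ J := fun h h' hi => h' (h hi)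
  have c0 : ∀ {J}, J ⊆ M → (insert 0 J).card = J.card + 1 := fun hJ =>
    Finset.card_insert_of_notMem fun h => h0M (hJ h)
  have c1 : ∀ {J}, J ⊆ M → (insert 0 (insert 1 J)).card = J.card + 2 := fun {J} hJ => by
    rw [Finset.card_insert_of_notMem, Finset.card_insert_of_notMem fun h => h1M (hJ h)]
    simp [hsub hJ h0M]
  have c2 : ∀ {J}, J ⊆ M → (insert 0 (insert 1 (insert (Fin.last (n + 2)) J))).card =
      J.card + 3 := fun {J} hJ => by
    rw [Finset.card_insert_of_notMem, Finset.card_insert_of_notMem,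
      Finset.card_insert_of_notMem (hsub hJ hzM)]
    · simp [hsub hJ h1M, one_ne_last]
    · simp [hsub hJ h0M]
  have e1 : ∑ i ∈ M, gen (facetType (masBuildingSet (n + 2)) {i}) =
      (n : PolytopeRing) * gen (PMas (n + 1)) := by
    rw [PMas_eq, ← nsmul_eq_mul]
    refine (Finset.sum_congr rfl fun i hi => ?_).trans (by rw [Finset.sum_const, hcard])
    rw [facetType_mas_singleton] <;> rintro rfl <;> contradiction
  have e2 : ∑ J ∈ M.powerset, gen (facetType (masBuildingSet (n + 2)) (insert 0 J)) =
      ∑ s ∈ Finset.range (n + 1),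
        (n.choose s : PolytopeRing) * (gen (stellahedron s) * gen (PGamma (n - s + 1))) := by
    have := Finset.sum_powerset_apply_card
      (fun s => gen (stellahedron s) * gen (PGamma (n - s + 1))) (x := M)
    simp only [hcard, nsmul_eq_mul] at this
    rw [← this]
    refine Finset.sum_congr rfl fun J hJ => ?_
    have hJ := Finset.mem_powerset.1 hJ
    have := hle hJ
    rw [facetType_mas_of_mem (s := J.card) (m := n - J.card + 1) (by simp)
      (by simp [hsub hJ h1M]) (by simp [hsub hJ hzM])
      (c0 hJ) (by rw [Finset.card_compl, c0 hJ, Fintype.card_fin]; omega), gen_mul, PGamma_eq]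
  have e3 : ∑ J ∈ M.powerset, gen (facetType (masBuildingSet (n + 2)) (insert 0 (insert 1 J))) =
      ∑ s ∈ Finset.range (n + 1), (n.choose s : PolytopeRing) *
        (gen (stellahedron (s + 1)) * gen (permutohedron (n - s))) := by
    have := Finset.sum_powerset_apply_card
      (fun s => gen (stellahedron (s + 1)) * gen (permutohedron (n - s))) (x := M)
    simp only [hcard, nsmul_eq_mul] at this
    rw [← this]
    refine Finset.sum_congr rfl fun J hJ => ?_
    have hJ := Finset.mem_powerset.1 hJ
    have := hle hJ
    rw [facetType_mas_of_mem_mem (s := J.card + 1) (m := n - J.card) (by simp) (by simp)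
      (by simp [hsub hJ hzM, one_ne_last.symm])
      (c1 hJ) (by rw [Finset.card_compl, c1 hJ, Fintype.card_fin]; omega), gen_mul]
  have e4 : ∑ J ∈ M.powerset.erase M, gen (facetType (masBuildingSet (n + 2))
        (insert 0 (insert 1 (insert (Fin.last (n + 2)) J)))) =
      ∑ s ∈ Finset.range n, (n.choose s : PolytopeRing) *
        (gen (PMas (s + 2)) * gen (permutohedron (n - s - 1))) := by
    have := sum_powerset_erase_apply_card
      (fun s => gen (PMas (s + 2)) * gen (permutohedron (n - s - 1))) M
    simp only [hcard, nsmul_eq_mul] at this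
    rw [← this]
    refine Finset.sum_congr rfl fun J hJ => ?_
    obtain ⟨hJM, hJ⟩ := Finset.mem_erase.1 hJ
    have hJ := Finset.mem_powerset.1 hJ
    have := Finset.card_lt_card (lt_of_le_of_ne hJ hJM)
    rw [facetType_mas_of_mem_mem_mem (s := J.card + 2) (m := n - J.card - 1) (by simp) (by simp)
      (by simp)
      (c2 hJ) (by rw [Finset.card_compl, c2 hJ, Fintype.card_fin]; omega), gen_mul, PMas_eq]
  rw [e1, e2, e3, e4, facetType_mas_one, facetType_mas_last, two_mul]

end

noncomputable section

open Polytope BuildingSet PolytopeRing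

/-! ### Line families of nestohedra -/

/-- A sequence of simple polytopes, one in each dimension. -/
structure IsLine (f : ℕ → CombType) : Prop where
  isSimple : ∀ n, (f n).IsSimple
  hasDim_iff : ∀ n m, (f n).HasDim m ↔ n = m

theorem isLine_nestohedron (B : ∀ n, BuildingSet (Fin (n + 1)))
    (hB : ∀ n, Finset.univ ∈ (B n).sets) : IsLine fun n => CombType.of (nestohedron (B n)) where
  isSimple n := ⟨_, rfl, (B n).isSimple_nestohedron (hB n)⟩
  hasDim_iff n m := by
    have := (B n).dim_nestohedron (hB n)
    rw [Fintype.card_fin] at this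
    rw [CombType.hasDim_of_iff]
    omega

theorem isLine_permutohedron : IsLine permutohedron := isLine_nestohedron _ univ_mem_perm

theorem isLine_stellahedron : IsLine stellahedron := isLine_nestohedron _ univ_mem_star

theorem isLine_PGamma : IsLine PGamma := by
  rw [funext PGamma_eq]
  exact isLine_nestohedron _ univ_mem_gamma

theorem isLine_PMas : IsLine PMas := by
  rw [funext PMas_eq]
  exact isLine_nestohedron _ univ_mem_mas

theorem IsLine.ne_one {f : ℕ → CombType} (hf : IsLine f) (n : ℕ) : f (n + 1) ≠ 1 := by
  intro h
  have h1 := (hf.hasDim_iff (n + 1) (n + 1)).2 rfl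
  rw [h, ← permutohedron_zero, isLine_permutohedron.hasDim_iff] at h1
  omega

theorem isFamily_iUnion_range {k : ℕ} [NeZero k] {L : Fin k → ℕ → CombType}
    (hL : ∀ i, IsLine (L i)) : IsFamily (⋃ i, Set.range (L i)) := by
  refine ⟨fun c hc => ?_, fun n => ⟨⟨L 0 n, ?_, ((hL 0).hasDim_iff n n).2 rfl⟩, ?_⟩⟩
  · obtain ⟨i, n, rfl⟩ := Set.mem_iUnion.1 hc
    exact (hL i).isSimple n
  · exact Set.mem_iUnion.2 ⟨0, n, rfl⟩
  · refine (Set.finite_range fun i => L i n).subset ?_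
    rintro c ⟨hc, hn⟩
    obtain ⟨i, m, rfl⟩ := Set.mem_iUnion.1 hc
    obtain rfl := ((hL i).hasDim_iff m n).1 hn
    exact ⟨i, rfl⟩

theorem IsLine.isLineFamily {f : ℕ → CombType} (hf : IsLine f) : IsLineFamily (Set.range f) := by
  have h := isFamily_iUnion_range (k := 1) (L := fun _ => f) fun _ => hf
  rw [Set.iUnion_const] at h
  refine ⟨h, fun n => ⟨f n, ⟨⟨n, rfl⟩, (hf.hasDim_iff n n).2 rfl⟩, ?_⟩⟩
  rintro _ ⟨⟨m, rfl⟩, hm⟩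
  rw [(hf.hasDim_iff m n).1 hm]

/-! ### The `d`-closure of `P_Mas` -/

/-- The four line families in the `d`-closure of `P_Mas`. -/
def masLines : Fin 4 → ℕ → CombType := ![PMas, stellahedron, permutohedron, PGamma]

/-- The `d`-closure of `P_Mas`. -/
def masClosure : Set CombType := ⋃ i, Set.range (masLines i)

theorem isLine_masLines (i : Fin 4) : IsLine (masLines i) := by
  fin_cases i
  · exact isLine_PMas
  · exact isLine_stellahedron
  · exact isLine_permutohedron
  · exact isLine_PGamma

theorem PMas_mem (n : ℕ) : PMas n ∈ masClosure := Set.mem_iUnion.2 ⟨0, n, rfl⟩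

theorem stellahedron_mem (n : ℕ) : stellahedron n ∈ masClosure := Set.mem_iUnion.2 ⟨1, n, rfl⟩

theorem permutohedron_mem (n : ℕ) : permutohedron n ∈ masClosure := Set.mem_iUnion.2 ⟨2, n, rfl⟩

theorem PGamma_mem (n : ℕ) : PGamma n ∈ masClosure := Set.mem_iUnion.2 ⟨3, n, rfl⟩

theorem d_nestohedron_mem {D : Set CombType} {n : ℕ} (B : BuildingSet (Fin (n + 1)))
    (hB : Finset.univ ∈ B.sets)
    (h : ∀ S ∈ B.sets, S ≠ Finset.univ → facetType B S ∈ Submonoid.closure D) :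
    d (gen (CombType.of (nestohedron B))) ∈ familyRing D := by
  rw [d_nestohedron B hB]
  refine Subring.sum_mem _ fun S hS => gen_mem_familyRing ?_
  exact h S (Finset.mem_of_mem_erase hS) (Finset.ne_of_mem_erase hS)

theorem exists_card_eq {n : ℕ} {S : Finset (Fin (n + 1))} (hS : S.Nonempty)
    (hSu : S ≠ Finset.univ) : ∃ s m, S.card = s + 1 ∧ Sᶜ.card = m + 1 := by
  have h1 := hS.card_pos
  have h2 := (Finset.card_lt_iff_ne_univ S).2 hSu
  rw [← Finset.card_add_card_compl S] at h2
  exact ⟨S.card - 1, Sᶜ.card - 1, by omega, by omega⟩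

theorem mul_mem_closure {D : Set CombType} {a b : CombType} (ha : a ∈ D) (hb : b ∈ D) :
    a * b ∈ Submonoid.closure D :=
  Submonoid.mul_mem _ (Submonoid.subset_closure ha) (Submonoid.subset_closure hb)

theorem d_permutohedron_mem (n : ℕ) : d (gen (permutohedron n)) ∈ familyRing masClosure := by
  refine d_nestohedron_mem (permBuildingSet n) (univ_mem_perm n) fun S hS hSu => ?_
  obtain ⟨s, m, hs, hm⟩ := exists_card_eq (mem_permBuildingSet.1 hS) hSu
  rw [facetType_perm hs hm]
  exact mul_mem_closure (permutohedron_mem s) (permutohedron_mem m)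

theorem d_stellahedron_mem (n : ℕ) : d (gen (stellahedron n)) ∈ familyRing masClosure := by
  refine d_nestohedron_mem (starBuildingSet n) (univ_mem_star n) fun S hS hSu => ?_
  obtain ⟨hne, h⟩ := mem_starBuildingSet.1 hS
  obtain ⟨s, m, hs, hm⟩ := exists_card_eq hne hSu
  by_cases h0 : 0 ∈ S
  · rw [facetType_star_of_mem h0 hs hm]
    exact mul_mem_closure (stellahedron_mem s) (permutohedron_mem m)
  · obtain ⟨j, rfl⟩ := Finset.card_eq_one.1 (h.resolve_right h0)
    have hj : j ≠ 0 := fun h => h0 (by simp [h])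
    obtain _ | n := n
    · exact absurd (Subsingleton.elim (α := Fin 1) j 0) hj
    · rw [facetType_star_singleton hj]
      exact Submonoid.subset_closure (stellahedron_mem n)

theorem d_PGamma_mem (n : ℕ) : d (gen (PGamma n)) ∈ familyRing masClosure := by
  obtain _ | n := n
  · have : PGamma 0 = permutohedron 0 := permutohedron_zero.symm
    rw [this]
    exact d_permutohedron_mem 0
  rw [PGamma_eq]
  refine d_nestohedron_mem _ (univ_mem_gamma _) fun S hS hSu => ?_
  obtain ⟨hne, h⟩ := mem_gammaBuildingSet.1 hS
  obtain ⟨s, m, hs, hm⟩ := exists_card_eq hne hSu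
  by_cases hl : Fin.last (n + 1) ∈ S
  · by_cases h0 : 0 ∈ S
    · rw [facetType_gamma_of_mem_mem h0 hl zero_ne_last hs hm, ← PGamma_eq]
      exact mul_mem_closure (PGamma_mem s) (permutohedron_mem m)
    · rcases h with h | h | h
      · obtain ⟨j, rfl⟩ := Finset.card_eq_one.1 h
        rw [← Finset.mem_singleton.1 hl, facetType_gamma_last]
        exact Submonoid.subset_closure (permutohedron_mem n)
      · exact absurd h h0
      · exact absurd hl h
  · by_cases h0 : 0 ∈ S
    · rw [facetType_gamma_of_mem h0 hl hs hm]
      exact mul_mem_closure (permutohedron_mem s) (permutohedron_mem m)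
    · rw [facetType_gamma_of_notMem h0 hl zero_ne_last hs hm, ← PGamma_eq]
      exact mul_mem_closure (permutohedron_mem s) (PGamma_mem m)

theorem gen_mem {c : CombType} (hc : c ∈ masClosure) : gen c ∈ familyRing masClosure :=
  gen_mem_familyRing (Submonoid.subset_closure hc)

theorem d_PMas_mem (n : ℕ) : d (gen (PMas n)) ∈ familyRing masClosure := by
  obtain _ | _ | n := n
  · have : PMas 0 = permutohedron 0 := permutohedron_zero.symm
    rw [this]
    exact d_permutohedron_mem 0
  · rw [PMas_one]
    exact d_permutohedron_mem 1
  · have hnat : ∀ k : ℕ, (k : PolytopeRing) ∈ familyRing masClosure := fun k => natCast_mem _ k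
    have hmul : ∀ {x y : CombType}, x ∈ masClosure → y ∈ masClosure →
        gen x * gen y ∈ familyRing masClosure := fun hx hy => mul_mem (gen_mem hx) (gen_mem hy)
    rw [d_PMas]
    refine add_mem (add_mem (add_mem (add_mem ?_ ?_) ?_) ?_) ?_
    · exact mul_mem (by exact_mod_cast hnat 2) (gen_mem (stellahedron_mem _))
    · exact mul_mem (hnat _) (gen_mem (PMas_mem _))
    · exact sum_mem fun s _ => mul_mem (hnat _) (hmul (stellahedron_mem _) (PGamma_mem _))
    · exact sum_mem fun s _ => mul_mem (hnat _) (hmul (stellahedron_mem _) (permutohedron_mem _))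
    · exact sum_mem fun s _ => mul_mem (hnat _) (hmul (PMas_mem _) (permutohedron_mem _))

theorem isDFamily_masClosure : IsDFamily masClosure := by
  refine ⟨isFamily_iUnion_range isLine_masLines, d_mem_familyRing fun c hc => ?_⟩
  obtain ⟨i, n, rfl⟩ := Set.mem_iUnion.1 hc
  fin_cases i
  · exact d_PMas_mem n
  · exact d_stellahedron_mem n
  · exact d_permutohedron_mem n
  · exact d_PGamma_mem n

/-- The facets of a member of a differential family are products of its members. -/
theorem facetType_mem_closure {D : Set CombType} (hD : IsDFamily D) {n : ℕ}
    {B : BuildingSet (Fin (n + 1))} (hB : Finset.univ ∈ B.sets)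
    (h : CombType.of (nestohedron B) ∈ D) {S : Finset (Fin (n + 1))} (hS : S ∈ B.sets)
    (hSu : S ≠ Finset.univ) : facetType B S ∈ Submonoid.closure D := by
  have h1 := hD.2 _ (gen_mem_familyRing (Submonoid.subset_closure h))
  rw [d_gen_of] at h1
  exact facet_mem_closure h1 (B.facetEquiv hB ⟨S, Finset.mem_erase.2 ⟨hSu, hS⟩⟩)

theorem singleton_ne_univ {n : ℕ} (i : Fin (n + 2)) : ({i} : Finset (Fin (n + 2))) ≠ Finset.univ := by
  intro h
  have := congrArg Finset.card h
  rw [Finset.card_singleton, Finset.card_univ, Fintype.card_fin] at this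
  omega

/-- The stellahedron is the facet `{1}` of the next `P_Mas`, hence a product of members of `D`;
having the hub `0`, it is indecomposable. -/
theorem stellahedron_mem_of_isDFamily {D : Set CombType} (hD : IsDFamily D)
    (h : Set.range PMas ⊆ D) (n : ℕ) : stellahedron n ∈ D := by
  obtain _ | n := n
  · rw [stellahedron_zero]
    exact h ⟨0, rfl⟩
  · have h1 := facetType_mem_closure hD (univ_mem_mas (n + 2)) (PMas_eq _ ▸ h ⟨n + 2, rfl⟩)
      ((masBuildingSet (n + 2)).singleton_mem 1) (singleton_ne_univ _)
    rw [facetType_mas_one] at h1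
    refine CombType.mem_of_mem_closure h1 (isLine_stellahedron.ne_one n) ?_
    exact (starBuildingSet _).indecomposable_of_hub (a := 0)
      fun S hS => mem_starBuildingSet.2 ⟨⟨0, hS⟩, Or.inr hS⟩

/-- Contracting the centre of the next stellahedron gives the permutohedron. -/
theorem permutohedron_mem_of_isDFamily {D : Set CombType} (hD : IsDFamily D)
    (h : Set.range PMas ⊆ D) (n : ℕ) : permutohedron n ∈ D := by
  obtain _ | n := n
  · rw [permutohedron_zero]
    exact h ⟨0, rfl⟩
  · have h1 := facetType_mem_closure hD (univ_mem_star (n + 2))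
      (stellahedron_mem_of_isDFamily hD h (n + 2))
      ((starBuildingSet (n + 2)).singleton_mem 0) (singleton_ne_univ _)
    rw [facetType_star_of_mem (s := 0) (m := n + 1) (Finset.mem_singleton_self 0)
      (Finset.card_singleton _) (card_compl_singleton _), stellahedron_zero, one_mul] at h1
    refine CombType.mem_of_mem_closure h1 (isLine_permutohedron.ne_one n) ?_
    exact (permBuildingSet _).indecomposable_of_hub (a := 0)
      fun S hS => mem_permBuildingSet.2 ⟨0, hS⟩

/-- The facet `{0}` of the next `P_Mas` is `P_Γ`, its stellahedron factor being a point. -/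
theorem PGamma_mem_of_isDFamily {D : Set CombType} (hD : IsDFamily D)
    (h : Set.range PMas ⊆ D) (n : ℕ) : PGamma n ∈ D := by
  obtain _ | n := n
  · exact h ⟨0, rfl⟩
  · have h1 := facetType_mem_closure hD (univ_mem_mas (n + 2)) (PMas_eq _ ▸ h ⟨n + 2, rfl⟩)
      ((masBuildingSet (n + 2)).singleton_mem 0) (singleton_ne_univ _)
    rw [facetType_mas_of_mem (s := 0) (m := n + 1) (Finset.mem_singleton_self 0) (by simp)
      (by simp) (Finset.card_singleton _) (card_compl_singleton _),
      stellahedron_zero, one_mul] at h1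
    rw [PGamma_eq]
    refine CombType.mem_of_mem_closure h1 (PGamma_eq _ ▸ isLine_PGamma.ne_one n) ?_
    exact (gammaBuildingSet _).indecomposable_of_hub (a := 0)
      fun S hS => mem_gammaBuildingSet.2 ⟨⟨0, hS⟩, Or.inr (Or.inl hS)⟩

theorem isDClosure_masClosure : IsDClosure (Set.range PMas) masClosure := by
  refine ⟨⟨Set.range_subset_iff.2 PMas_mem, isDFamily_masClosure⟩, ?_⟩
  rintro D ⟨h, hD⟩ c hc
  obtain ⟨i, n, rfl⟩ := Set.mem_iUnion.1 hc
  fin_cases i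
  · exact h ⟨n, rfl⟩
  · exact stellahedron_mem_of_isDFamily hD h n
  · exact permutohedron_mem_of_isDFamily hD h n
  · exact PGamma_mem_of_isDFamily hD h n

/-! ### The complexity -/

/-- Nestohedra of building sets of different sizes are not combinatorially equivalent. -/
theorem card_sets_eq_of_eq {n : ℕ} {B B' : BuildingSet (Fin (n + 1))} (hB : Finset.univ ∈ B.sets)
    (hB' : Finset.univ ∈ B'.sets)
    (h : CombType.of (nestohedron B) = CombType.of (nestohedron B')) :
    B.sets.card = B'.sets.card := by
  obtain ⟨e⟩ : (nestohedron B).CombEquiv (nestohedron B') := Quotient.exact h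
  have h1 : Nat.card (nestohedron B).Facet = Nat.card (nestohedron B').Facet :=
    Nat.card_congr (e.toEquiv.subtypeEquiv fun F => (e.isCoatom_iff F).symm)
  rw [B.card_facet hB, B'.card_facet hB'] at h1
  have := Finset.card_pos.2 ⟨_, hB⟩
  have := Finset.card_pos.2 ⟨_, hB'⟩
  omega

theorem card_permBuildingSet_three : (permBuildingSet 3).sets.card = 15 := by
  have : (permBuildingSet 3).sets = Finset.univ.filter fun S => S.Nonempty := by
    ext S
    simp [mem_permBuildingSet]
  rw [this]
  decide

theorem card_starBuildingSet_three : (starBuildingSet 3).sets.card = 11 := by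
  have : (starBuildingSet 3).sets =
      Finset.univ.filter fun S => S.Nonempty ∧ (S.card = 1 ∨ 0 ∈ S) := by
    ext S
    simp [mem_starBuildingSet, StarPred]
  rw [this]
  decide

theorem card_gammaBuildingSet_three : (gammaBuildingSet 3).sets.card = 12 := by
  have : (gammaBuildingSet 3).sets =
      Finset.univ.filter fun S => S.Nonempty ∧ (S.card = 1 ∨ 0 ∈ S ∨ Fin.last 3 ∉ S) := by
    ext S
    simp [mem_gammaBuildingSet, GammaPred]
  rw [this]
  decide

theorem card_masBuildingSet_three : (masBuildingSet 3).sets.card = 9 := by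
  have : (masBuildingSet 3).sets =
      Finset.univ.filter fun S => S.Nonempty ∧ (S.card = 1 ∨ 0 ∈ S ∧ (1 ∈ S ∨ Fin.last 3 ∉ S)) := by
    ext S
    simp [mem_masBuildingSet, MasPred]
  rw [this]
  decide

/-- The numbers of facets are 8, 10, 14 and 11, one less than the sizes of the building sets.
Dimension two would not do: there `B(Γ,2)` is the building set of a star. -/
theorem masLines_three_injective : Function.Injective fun i => masLines i 3 := by
  let B : Fin 4 → BuildingSet (Fin (3 + 1)) :=
    ![masBuildingSet 3, starBuildingSet 3, permBuildingSet 3, gammaBuildingSet 3]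
  have hB : ∀ i, Finset.univ ∈ (B i).sets := by
    intro i
    fin_cases i
    · exact univ_mem_mas 3
    · exact univ_mem_star 3
    · exact univ_mem_perm 3
    · exact univ_mem_gamma 3
  have hL : ∀ i, masLines i 3 = CombType.of (nestohedron (B i)) := by
    intro i
    fin_cases i <;> rfl
  have hcard : ∀ i, (B i).sets.card = ![9, 11, 15, 12] i := by
    intro i
    fin_cases i
    · exact card_masBuildingSet_three
    · exact card_starBuildingSet_three
    · exact card_permBuildingSet_three
    · exact card_gammaBuildingSet_three
  intro i j h
  have h1 : masLines i 3 = masLines j 3 := h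
  rw [hL, hL] at h1
  have h2 := card_sets_eq_of_eq (hB i) (hB j) h1
  rw [hcard, hcard] at h2
  have key : ∀ i j : Fin 4, (![9, 11, 15, 12] : Fin 4 → ℕ) i = ![9, 11, 15, 12] j → i = j := by
    decide
  exact key i j h2

/-- A line family has a single 3-dimensional member, so the four distinct ones in the closure lie in
four different lines. -/
theorem hasComplexity_PMas : HasComplexity (Set.range PMas) 4 := by
  refine ⟨masClosure, isDClosure_masClosure,
    ⟨fun i => Set.range (masLines i), fun i => (isLine_masLines i).isLineFamily, rfl⟩, ?_⟩
  rintro k ⟨L, hL, hD⟩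
  have hmem : ∀ i, ∃ j, masLines i 3 ∈ L j := fun i => by
    have : masLines i 3 ∈ masClosure := Set.mem_iUnion.2 ⟨i, 3, rfl⟩
    rw [hD] at this
    exact Set.mem_iUnion.1 this
  choose j hj using hmem
  have hinj : Function.Injective j := by
    intro a b hab
    refine masLines_three_injective ?_
    exact ((hL (j a)).2 3).unique ⟨hj a, ((isLine_masLines a).hasDim_iff 3 3).2 rfl⟩
      ⟨hab ▸ hj b, ((isLine_masLines b).hasDim_iff 3 3).2 rfl⟩
  simpa using Fintype.card_le_of_injective j hinj

end

/-! ### The boundary formula and the complexity -/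

open PolytopeRing in
theorem theorem3p9 :
    (∀ n : ℕ, 2 ≤ n →
      d (gen (PMas n)) =
        2 * gen (stellahedron (n - 1)) + ((n - 2 : ℕ) : PolytopeRing) * gen (PMas (n - 1))
        + ∑ s ∈ Finset.range (n - 1),
            ((n - 2).choose s : PolytopeRing) * (gen (stellahedron s) * gen (PGamma (n - s - 1)))
        + ∑ s ∈ Finset.range (n - 1),
            ((n - 2).choose s : PolytopeRing) *
              (gen (stellahedron (s + 1)) * gen (permutohedron (n - s - 2)))
        + ∑ s ∈ Finset.range (n - 2),
            ((n - 2).choose s : PolytopeRing) *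
              (gen (PMas (s + 2)) * gen (permutohedron (n - s - 3)))) ∧
    HasComplexity (Set.range PMas) 4 := by
  refine ⟨fun n hn => ?_, hasComplexity_PMas⟩
  obtain ⟨n, rfl⟩ : ∃ k, n = k + 2 := ⟨n - 2, by omega⟩
  refine (d_PMas n).trans ?_
  refine congrArg₂ _ (congrArg₂ _ (congrArg₂ _ rfl ?_) ?_) ?_
  · refine Finset.sum_congr rfl fun s hs => ?_
    have := Finset.mem_range.1 hs
    rw [show n + 2 - s - 1 = n - s + 1 by omega, Nat.add_sub_cancel]
  · refine Finset.sum_congr rfl fun s hs => ?_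
    have := Finset.mem_range.1 hs
    rw [show n + 2 - s - 2 = n - s by omega, Nat.add_sub_cancel]
  · refine Finset.sum_congr rfl fun s hs => ?_
    have := Finset.mem_range.1 hs
    rw [show n + 2 - s - 3 = n - s - 1 by omega, Nat.add_sub_cancel]
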